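/- **Setting.** Fix a domain $D$ and a function-free vocabulary $\Sigma$. A (four-valued) structure over a set of atoms is a set $I$ of literals over these atoms; $I\subseteq I'$ reads "$I'$ is more precise than $I$" (or "expands $I$"). $I$ is consistent if it contains no complementary literals, and two-valued on a set of atoms if it contains exactly one of $a,\neg a$ for each $a$ in the set. A theory $T=\{p_T,\Delta\}$ consists of an atomic sentence $p_T$ and a definition $\Delta$: a finite set of rules $\forall \bar x\in \bar D: P(\bar x)\leftarrow\varphi$, with $\varphi$ a first-order formula in negation normal form whose quantifiers range over subsets of $D$, such that each domain atom is defined by at most one rule. For a definition $\Delta$ and a structure $O$ of its open (not defined) atoms, $wf_\Delta(O)$ is the (three-valued) parametrized well-founded model; $\Delta$ is total if $wf_\Delta(O)$ is two-valued for every two-valued $O$. $M$ is a model of $T$ if it is two-valued, $p_T\in M$ and $M=wf_\Delta(M|_{open(\Delta)})$. Assume that $\Delta$ is total, and that $I_{in}$ is a consistent $\Sigma$-structure in which all atoms defined by $\Delta$ are unknown. **The algorithm $\mathsf{lazy\_mx}$** maintains a set $S_g$ of ground clauses, ground rules $\Delta_g$, delayed rules $\Delta_d$, a partial map $J$ from literals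 to sets of literals (direct justifications), a structure $I$ (over the domain atoms of $\Sigma$ and new propositional Tseitin symbols) and a FIFO queue $q$ of literals. Initially $S_g=\{p_T\}$, $\Delta_g=\emptyset$, $\Delta_d=\Delta$, $J=\emptyset$, $I=I_{in}$, $q=\emptyset$. Each iteration of its main loop does the following; all choices left open are nondeterministic. 1. *Propagate*: add to $I$ a finite set $L$ of literals not in $I$, over atoms of $S_g\cup\Delta_g$, that are true in all two-valued models of $S_g\cup\Delta_g$ expanding $I$. If no conflict arises, $L$ contains the literals not in $I$ obtained by unit propagation from the clauses in $S_g$; a structure that is two-valued on the atoms of $S_g\cup\Delta_g$ but not a model of $S_g\cup\Delta_g$ is detected as a conflict. *Check* each $l\in L$: enqueue $l$ if it is defined in $\Delta_d$ and $J(l)$ is undefined; enqueue each $l'$ with $\neg l\in J(l')$, and $\neg l$ if $J(\neg l)$ is defined. 2. If $I$ is inconsistent: if no choice is active, return $\mathit{false}$. Otherwise add to $S_g$ a clause that is violated by $I$ and true in all two-valued models of $S_g\cup\Delta_g$ expanding $I_{in}$, and reset $I$ to its value just before an active choice where this clause is unit (one literal unknown, the others false). 3. Else, if $q$ is nonempty,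 dequeue a literal $l$. - The justification consists of the direct justifications of literals not on $q$. $J(l)=S$ is *valid* if $S$ contains no literals defined in $\Delta_g$; each literal of $S$ defined in $\Delta_d$ has a direct justification or is on $q$; every infinite path in the justification consists of negative literals from some point on; and the set of literals in the justification is consistent and contains no literal that is false in $I$. - If $J(l)$ is defined and valid, do nothing. - Else, if $l\in I$ and $l$ is defined in $\Delta_d$: either set $J(l)$ to a valid set of literals obtained from the body $\varphi$ of the rule instance defining $l$ (from the negation normal form of $\neg\varphi$ if $l$ is negative) by taking all conjuncts and universal instances, one disjunct, and one existential instance or all of a nonempty range; or, if the (possibly incomplete) search for such a set fails, split off the rule instance from $\Delta_d$ and ground it one step, moving it to $\Delta_g$ with its direct subformulas (or instances) replaced by new Tseitin symbols defined in $\Delta_d$; for a true head with a disjunctive or existential body (a false head with a conjunctive or universal body), it is also allowed to split off a single disjunct or instance (conjunct or instance) and to replace the remainder by one new Tseitin symbol. In the latter case $J(l)$ and $J(\neg l)$ become undefined and each $l'$ with $l\in J(l')$ or $\neg l\in J(l')$ is enqueued. - Else $J(l)$ becomes undefined and each $l'$ with $l\in J(l')$ is enqueued. 4. Else, if $I$ is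 two-valued on the atoms of $S_g\cup\Delta_g$ and a model of $S_g\cup\Delta_g$, return $(I,J)$. 5. Else choose a literal over an unknown atom of $S_g\cup\Delta_g$, add it to $I$, and check it as in 1. **Theorem (Correctness and termination).** (a) If $\mathsf{lazy\_mx}$ returns $(I,J)$, then $E=I\cup\bigcup_l J(l)$ is consistent, and for every two-valued structure $O$ of the open atoms of $\Delta_g\cup\Delta_d$ that expands $E|_{open(\Delta_g\cup\Delta_d)}$, the well-founded model $wf_{\Delta_g\cup\Delta_d}(O)$ is two-valued and expands $E$, and its restriction to $\Sigma$ is a model of $T$ that expands $I_{in}$. (b) If $\mathsf{lazy\_mx}$ returns $\mathit{false}$, then no model of $T$ is more precise than $I_{in}$. (c) In every reachable state in which the algorithm has not returned, a further iteration is possible. If $D$ is finite, then $\mathsf{lazy\_mx}$ terminates: it has no infinite run. (d) If $D$ is infinite, then termination is possible but not guaranteed: there are a theory over $D$ that defines infinitely many domain atoms and an input structure (satisfying the assumptions above) on which some run returns a structure; and there are such a theory and input structure with an infinite run and without any run that returns. -/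

import Mathlib

universe u v w

noncomputable section

namespace LazyMX

/-! ### Domain literals and four-valued structures -/

/-- A literal over a set `A` of (domain) atoms: an atom (`sign = true`) or its negation. -/
structure Lit (A : Type w) where
  atom : A
  sign : Bool

/-- The complementary literal. -/
def Lit.neg {A : Type w} (l : Lit A) : Lit A := ⟨l.atom, !l.sign⟩

/-- A four-valued structure is a set of domain literals: an atom is inconsistent if both it and its
negation belong to the set, true or false if exactly one of them does, unknown otherwise.
Thus `I ⊆ I'` says that `I'` is more precise than (an expansion of) `I`. -/
abbrev Struc (A : Type w) : Type w := Set (Lit A)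

/-- No atom is inconsistent: the structure is three-valued. -/
def Consistent {A : Type w} (I : Struc A) : Prop := ∀ l ∈ I, l.neg ∉ I

/-- Every atom of `B` is either true or false in `I`. -/
def TwoValuedOn {A : Type w} (I : Struc A) (B : Set A) : Prop :=
  ∀ a ∈ B, Xor (⟨a, true⟩ ∈ I) (⟨a, false⟩ ∈ I)

/-- Every atom is either true or false in `I`. -/
def TwoValued {A : Type w} (I : Struc A) : Prop := TwoValuedOn I Set.univ

/-- The restriction of a structure to a set of atoms. -/
def restrict {A : Type w} (I : Struc A) (B : Set A) : Struc A := {l | l ∈ I ∧ l.atom ∈ B}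

/-- `I` is a two-valued structure of `B`: two-valued on `B` and unknown elsewhere. -/
def TwoValuedStrucOf {A : Type w} (I : Struc A) (B : Set A) : Prop :=
  TwoValuedOn I B ∧ ∀ l ∈ I, l.atom ∈ B

/-! ### Domain formulas (all variables instantiated) -/

/-- Closed formulas in negation normal form over the domain `D` and the domain atoms `A`.
A quantification `∀ x ∈ S : ψ` or `∃ x ∈ S : ψ` is given by the family of its instances `ψ[x/d]`. -/
inductive DFormula (D : Type u) (A : Type w) : Type (max u w)
  | lit (l : Lit A) : DFormula D A
  | conj (n : ℕ) (f : Fin n → DFormula D A) : DFormula D A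
  | disj (n : ℕ) (f : Fin n → DFormula D A) : DFormula D A
  | all (S : Set D) (f : D → DFormula D A) : DFormula D A
  | ex (S : Set D) (f : D → DFormula D A) : DFormula D A

namespace DFormula

variable {D : Type u} {A : Type w}

/-- The negation normal form of the negation. -/
def neg : DFormula D A → DFormula D A
  | lit l => lit l.neg
  | conj n f => disj n fun i => (f i).neg
  | disj n f => conj n fun i => (f i).neg
  | all S f => ex S fun d => (f d).neg
  | ex S f => all S fun d => (f d).neg

/-- Four-valued truth: `Holds I φ` says that the value of `φ` in `I` is true or inconsistent,
`Holds I φ.neg` that it is false or inconsistent. In particular, in a consistent structure, `φ` is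
true iff `Holds I φ` and false iff `Holds I φ.neg`. -/
def Holds (I : Struc A) : DFormula D A → Prop
  | lit l => l ∈ I
  | conj _ f => ∀ i, (f i).Holds I
  | disj _ f => ∃ i, (f i).Holds I
  | all S f => ∀ d ∈ S, (f d).Holds I
  | ex S f => ∃ d ∈ S, (f d).Holds I

/-- The atoms that occur in a domain formula. -/
def atoms : DFormula D A → Set A
  | lit l => {l.atom}
  | conj _ f => {a | ∃ i, a ∈ (f i).atoms}
  | disj _ f => {a | ∃ i, a ∈ (f i).atoms}
  | all S f => {a | ∃ d ∈ S, a ∈ (f d).atoms}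
  | ex S f => {a | ∃ d ∈ S, a ∈ (f d).atoms}

/-- No quantifier occurs. -/
def QuantifierFree : DFormula D A → Prop
  | lit _ => True
  | conj _ f => ∀ i, (f i).QuantifierFree
  | disj _ f => ∀ i, (f i).QuantifierFree
  | all _ _ => False
  | ex _ _ => False

end DFormula

/-! ### Well-founded semantics -/

/-- The instances of the rules of a definition: to each defined domain atom the body of the unique
rule instance that defines it, and `none` to each open atom. -/
abbrev Rules (D : Type u) (A : Type w) : Type (max u w) := A → Option (DFormula D A)

section WellFounded

variable {D : Type u} {A : Type w}

def definedAtoms (Δ : Rules D A) : Set A := {a | Δ a ≠ none}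

def openAtoms (Δ : Rules D A) : Set A := {a | Δ a = none}

/-- The literal assignment in which open atoms are read in `O`, positive occurrences of defined
atoms in `Y` and negative occurrences of defined atoms in `X`. -/
def mixed (Δ : Rules D A) (O : Struc A) (Y X : Set A) : Struc A :=
  restrict O (openAtoms Δ) ∪ {l | l.atom ∈ definedAtoms Δ ∧ l.sign = true ∧ l.atom ∈ Y} ∪
    {l | l.atom ∈ definedAtoms Δ ∧ l.sign = false ∧ l.atom ∉ X}

/-- The least set of defined atoms that is closed under the rules, when negative occurrences of
defined atoms are evaluated in the fixed set `X` (the stable operator). -/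
def stableOp (Δ : Rules D A) (O : Struc A) (X : Set A) : Set A :=
  ⋂₀ {Y | ∀ a φ, Δ a = some φ → φ.Holds (mixed Δ O Y X) → a ∈ Y}

/-- The defined atoms that are true in the well-founded model: the least (pre)fixpoint of the
square of the stable operator (the alternating fixpoint). -/
def wfTrue (Δ : Rules D A) (O : Struc A) : Set A :=
  ⋂₀ {Y | stableOp Δ O (stableOp Δ O Y) ⊆ Y}

/-- The (three-valued) well-founded model of `Δ` in the structure `O` of the open atoms. -/
def wf (Δ : Rules D A) (O : Struc A) : Struc A :=
  restrict O (openAtoms Δ) ∪ {l | l.sign = true ∧ l.atom ∈ wfTrue Δ O} ∪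
    {l | l.sign = false ∧ l.atom ∈ definedAtoms Δ ∧ l.atom ∉ stableOp Δ O (wfTrue Δ O)}

/-- `I` is the well-founded model of `Δ` in its own restriction to the open atoms of `Δ`. -/
def IsWfModel (Δ : Rules D A) (I : Struc A) : Prop := I = wf Δ (restrict I (openAtoms Δ))

/-- The well-founded model is two-valued in each two-valued structure of the open atoms. -/
def Total (Δ : Rules D A) : Prop :=
  ∀ O : Struc A, TwoValuedStrucOf O (openAtoms Δ) → TwoValued (wf Δ O)

end WellFounded

/-! ### First-order formulas, rules, definitions, canonical theories -/

/-- Terms of the function-free language: one of `n` variables, or a domain element. -/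
inductive Term (D : Type u) (n : ℕ) : Type u
  | var (i : Fin n) : Term D n
  | elem (d : D) : Term D n

def Term.eval {D : Type u} {n : ℕ} (x : Fin n → D) : Term D n → D
  | var i => x i
  | elem d => d

/-- First-order formulas in negation normal form, with quantification over subsets of the domain,
over predicate symbols `V` with arities `ar`, and with free variables among `x₀, …, xₙ₋₁`.
The quantifiers bind the variable `xₙ`. The empty conjunction and disjunction serve as the
propositional constants true and false. -/
inductive Formula (D : Type u) {V : Type v} (ar : V → ℕ) : ℕ → Type (max u v)
  | lit {n : ℕ} (sign : Bool) (P : V) (t : Fin (ar P) → Term D n) : Formula D ar n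
  | conj {n : ℕ} (k : ℕ) (f : Fin k → Formula D ar n) : Formula D ar n
  | disj {n : ℕ} (k : ℕ) (f : Fin k → Formula D ar n) : Formula D ar n
  | all {n : ℕ} (S : Set D) (φ : Formula D ar (n + 1)) : Formula D ar n
  | ex {n : ℕ} (S : Set D) (φ : Formula D ar (n + 1)) : Formula D ar n

/-- Domain atoms `P(d₁, …, dₙ)`. -/
structure DomAtom (D : Type u) {V : Type v} (ar : V → ℕ) where
  pred : V
  args : Fin (ar pred) → D

section Theories

variable {D : Type u} {V : Type v} {ar : V → ℕ} {A : Type w}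

/-- The instance of a formula at domain elements for its free variables; `e` says in which set of
atoms the domain atoms are taken. -/
def Formula.inst (e : DomAtom D ar → A) : {n : ℕ} → Formula D ar n → (Fin n → D) → DFormula D A
  | _, .lit b P t, x => .lit ⟨e ⟨P, fun i => (t i).eval x⟩, b⟩
  | _, .conj k f, x => .conj k fun i => (f i).inst e x
  | _, .disj k f, x => .disj k fun i => (f i).inst e x
  | _, .all S φ, x => .all S fun d => φ.inst e (Fin.snoc x d)
  | _, .ex S φ, x => .ex S fun d => φ.inst e (Fin.snoc x d)

variable (D ar) in
/-- A rule `∀ x̄ ∈ dom : P(x̄) ← body`; all free variables of the body are among `x̄`. -/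
structure Rule where
  pred : V
  dom : Set (Fin (ar pred) → D)
  body : Formula D ar (ar pred)

variable (D ar) in
/-- A definition: a finite set of rules such that no domain atom is defined by two rules. -/
structure Definition where
  rules : Set (Rule D ar)
  finite : rules.Finite
  disjoint : ∀ r ∈ rules, ∀ r' ∈ rules, ∀ t ∈ r.dom, ∀ t' ∈ r'.dom,
    (⟨r.pred, t⟩ : DomAtom D ar) = ⟨r'.pred, t'⟩ → r = r'

/-- `ψ` is the body of an instance of a rule of `Δ` with head `a`. -/
def Definition.IsInstance (Δ : Definition D ar) (e : DomAtom D ar → A) (a : DomAtom D ar)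
    (ψ : DFormula D A) : Prop :=
  ∃ r ∈ Δ.rules, ∃ t ∈ r.dom, a = ⟨r.pred, t⟩ ∧ ψ = r.body.inst e t

open Classical in
/-- The rule instances of a definition. -/
def Definition.inst (Δ : Definition D ar) (e : DomAtom D ar → A) (a : DomAtom D ar) :
    Option (DFormula D A) :=
  if h : ∃ ψ, Δ.IsInstance e a ψ then some h.choose else none

/-- The rule instances of a definition over its own vocabulary. -/
def Definition.toRules (Δ : Definition D ar) : Rules D (DomAtom D ar) := Δ.inst id

variable (D ar) in
/-- A canonical theory: an atomic sentence and a definition. -/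
structure Theory where
  goal : DomAtom D ar
  defn : Definition D ar

/-- `M` is a model of the theory. -/
def Theory.IsModel (T : Theory D ar) (M : Struc (DomAtom D ar)) : Prop :=
  TwoValued M ∧ ⟨T.goal, true⟩ ∈ M ∧ IsWfModel T.defn.toRules M

end Theories

/-! ### Tseitin symbols and the grounding of one rule instance -/

/-- The position of a subformula: the `i`-th conjunct or disjunct, the instance of a quantified
formula for a domain element, or the remainder of a formula from which one part is split off. -/
inductive Pos (D : Type u) : Type u
  | sub (i : ℕ) : Pos D
  | elem (d : D) : Pos D
  | rest : Pos D

/-- Domain atoms, extended with propositional Tseitin symbols. The symbol `tse h p` names the part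
at position `p` of the body of the rule instance with head `h`; as a head is grounded at most once,
the symbols introduced by a grounding step are new. -/
inductive Atom (D : Type u) {V : Type v} (ar : V → ℕ) : Type (max u v)
  | dom (a : DomAtom D ar) : Atom D ar
  | tse (h : Atom D ar) (p : Pos D) : Atom D ar

section Algorithm

variable {D : Type u} {V : Type v} {ar : V → ℕ}

/-- The positive literal of a Tseitin symbol. -/
def tseLit (h : Atom D ar) (p : Pos D) : DFormula D (Atom D ar) := .lit ⟨.tse h p, true⟩

/-- How a part `ψ` that is split off appears in a ground rule: if it is quantifier-free, it may
stay as it is; or it is replaced by a Tseitin symbol, for which a rule with body `ψ` is added. -/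
inductive Part (h : Atom D ar) (p : Pos D) (ψ : DFormula D (Atom D ar)) :
    DFormula D (Atom D ar) → Option (DFormula D (Atom D ar)) → Prop
  | keep : ψ.QuantifierFree → Part h p ψ ψ none
  | tseitin : Part h p ψ (tseLit h p) (some ψ)

open Classical in
/-- One grounding step on a rule instance `h ← φ` in the structure `I`. `OneStep I h φ g new` says
that the instance can be replaced by the ground rule `h ← g` together with the (possibly
non-ground) rules `tse h p ← ψ` for all `p`, `ψ` with `new p = some ψ`. The first five cases are the
naive grounding step (a conjunction over all `d ∈ S` is written as a universal quantification of
propositional symbols, likewise for disjunctions); the last four split off one disjunct or instance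
of a rule with true head, or one conjunct or instance of a rule with false head. -/
inductive OneStep (I : Struc (Atom D ar)) (h : Atom D ar) :
    DFormula D (Atom D ar) → DFormula D (Atom D ar) →
      (Pos D → Option (DFormula D (Atom D ar))) → Prop
  | lit (l : Lit (Atom D ar)) : OneStep I h (.lit l) (.lit l) fun _ => none
  | conj (n : ℕ) (f : Fin n → DFormula D (Atom D ar)) :
      OneStep I h (.conj n f) (.conj n fun i => tseLit h (.sub i)) fun p =>
        match p with
        | .sub i => if hi : i < n then some (f ⟨i, hi⟩) else none
        | _ => none
  | disj (n : ℕ) (f : Fin n → DFormula D (Atom D ar)) :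
      OneStep I h (.disj n f) (.disj n fun i => tseLit h (.sub i)) fun p =>
        match p with
        | .sub i => if hi : i < n then some (f ⟨i, hi⟩) else none
        | _ => none
  | all (S : Set D) (f : D → DFormula D (Atom D ar)) :
      OneStep I h (.all S f) (.all S fun d => tseLit h (.elem d)) fun p =>
        match p with
        | .elem d => if d ∈ S then some (f d) else none
        | _ => none
  | ex (S : Set D) (f : D → DFormula D (Atom D ar)) :
      OneStep I h (.ex S f) (.ex S fun d => tseLit h (.elem d)) fun p =>
        match p with
        | .elem d => if d ∈ S then some (f d) else none
        | _ => none
  | disjTrue (n : ℕ) (f : Fin (n + 1) → DFormula D (Atom D ar)) (i : Fin (n + 1))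
      (g : DFormula D (Atom D ar)) (o : Option (DFormula D (Atom D ar))) :
      ⟨h, true⟩ ∈ I → Part h (.sub i) (f i) g o →
      OneStep I h (.disj (n + 1) f) (.disj 2 ![g, tseLit h .rest]) fun p =>
        match p with
        | .sub j => if j = i then o else none
        | .rest => some (.disj n fun j => f (i.succAbove j))
        | _ => none
  | exTrue (S : Set D) (f : D → DFormula D (Atom D ar)) (d : D)
      (g : DFormula D (Atom D ar)) (o : Option (DFormula D (Atom D ar))) :
      ⟨h, true⟩ ∈ I → d ∈ S → Part h (.elem d) (f d) g o →
      OneStep I h (.ex S f) (.disj 2 ![g, tseLit h .rest]) fun p =>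
        match p with
        | .elem c => if c = d then o else none
        | .rest => some (.ex (S \ {d}) f)
        | _ => none
  | conjFalse (n : ℕ) (f : Fin (n + 1) → DFormula D (Atom D ar)) (i : Fin (n + 1))
      (g : DFormula D (Atom D ar)) (o : Option (DFormula D (Atom D ar))) :
      ⟨h, false⟩ ∈ I → Part h (.sub i) (f i) g o →
      OneStep I h (.conj (n + 1) f) (.conj 2 ![g, tseLit h .rest]) fun p =>
        match p with
        | .sub j => if j = i then o else none
        | .rest => some (.conj n fun j => f (i.succAbove j))
        | _ => none
  | allFalse (S : Set D) (f : D → DFormula D (Atom D ar)) (d : D)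
      (g : DFormula D (Atom D ar)) (o : Option (DFormula D (Atom D ar))) :
      ⟨h, false⟩ ∈ I → d ∈ S → Part h (.elem d) (f d) g o →
      OneStep I h (.all S f) (.conj 2 ![g, tseLit h .rest]) fun p =>
        match p with
        | .elem c => if c = d then o else none
        | .rest => some (.all (S \ {d}) f)
        | _ => none

/-! ### States of the algorithm -/

variable (D ar) in
/-- A (partial) graph that assigns to some literals a set of children, their direct justification.
(`none` is "undefined"; a justification of a formula that is true in every structure may be `∅`.) -/
abbrev JGraph : Type (max u v) := Lit (Atom D ar) → Option (Set (Lit (Atom D ar)))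

variable (D ar) in
/-- The state of the algorithm: ground clauses `Sg`, ground rules `Dg`, delayed rules `Dd` (given by
their instances), justification `J`, structure `I`, the structures `trail` that were saved at the
choices made so far (the backjump points, most recent first), and the queue of literals whose direct
justification has to be checked. -/
structure State where
  Sg : Set (Set (Lit (Atom D ar)))
  Dg : Rules D (Atom D ar)
  Dd : Rules D (Atom D ar)
  J : JGraph D ar
  I : Struc (Atom D ar)
  trail : List (Struc (Atom D ar))
  queue : List (Lit (Atom D ar))

/-- The definition `Dg ∪ Dd`. -/
def State.Dgd (s : State D ar) : Rules D (Atom D ar) := fun a => (s.Dg a).or (s.Dd a)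

/-- A structure of the vocabulary, viewed as a structure of the extended vocabulary. -/
def embed (I : Struc (DomAtom D ar)) : Struc (Atom D ar) := {l | ∃ m ∈ I, l = ⟨.dom m.atom, m.sign⟩}

/-- The restriction of a structure of the extended vocabulary to the vocabulary of the theory. -/
def restrictVoc (I : Struc (Atom D ar)) : Struc (DomAtom D ar) := {l | ⟨.dom l.atom, l.sign⟩ ∈ I}

/-- The initial state for a theory and an input structure. -/
def initState (T : Theory D ar) (Iin : Struc (DomAtom D ar)) : State D ar where
  Sg := {{⟨.dom T.goal, true⟩}}
  Dg := fun _ => none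
  Dd := fun a => match a with
    | .dom b => T.defn.inst .dom b
    | .tse _ _ => none
  J := fun _ => none
  I := embed Iin
  trail := []
  queue := []

/-! ### Search over the ground part -/

/-- The atoms that occur in the ground part `Sg ∪ Dg`. -/
def groundAtoms (s : State D ar) : Set (Atom D ar) :=
  {a | ∃ C ∈ s.Sg, ∃ l ∈ C, l.atom = a} ∪ {a | ∃ h φ, s.Dg h = some φ ∧ (a = h ∨ a ∈ φ.atoms)}

/-- `I`, two-valued on the atoms that occur in `Sg ∪ Dg`, is a model of `Sg ∪ Dg`. -/
def IsGroundModel (s : State D ar) (I : Struc (Atom D ar)) : Prop :=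
  Consistent I ∧ TwoValuedOn I (groundAtoms s) ∧ (∀ C ∈ s.Sg, ∃ l ∈ C, l ∈ I) ∧ IsWfModel s.Dg I

/-- Every two-valued model of `Sg ∪ Dg` that expands `I` satisfies one of the literals in `C`. -/
def Entails (s : State D ar) (I : Struc (Atom D ar)) (C : Set (Lit (Atom D ar))) : Prop :=
  ∀ M, TwoValued M → IsGroundModel s M → I ⊆ M → ∃ l ∈ C, l ∈ M

/-- The structure `I` expanded with a list of literals. -/
def extend (I : Struc (Atom D ar)) (L : List (Lit (Atom D ar))) : Struc (Atom D ar) :=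
  I ∪ {l | l ∈ L}

/-- A possible result `L` of propagation: a finite set of new literals over `Sg ∪ Dg` that are
entailed by `Sg ∪ Dg` in the current structure. If no conflict arises, then it includes all literals
obtained from `I` by unit propagation on `Sg`, and if all atoms of `Sg ∪ Dg` have got a value, then
this is a model. Otherwise propagation may be incomplete. -/
def Propagates (s : State D ar) (L : List (Lit (Atom D ar))) : Prop :=
  L.Nodup ∧
  (∀ l ∈ L, l ∉ s.I ∧ l.atom ∈ groundAtoms s ∧ Entails s s.I {l}) ∧
  (Consistent (extend s.I L) →
    (∀ C ∈ s.Sg, ∀ l ∈ C, (∀ m ∈ C, m ≠ l → m.neg ∈ s.I) → l ∈ extend s.I L) ∧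
    (TwoValuedOn (extend s.I L) (groundAtoms s) → IsGroundModel s (extend s.I L)))

/-- `C` is a clause that can be learned in the conflict `I` with backjump point `I'`: it is entailed
by `Sg ∪ Dg` and the input structure `I₀`, it is violated by `I`, and at the backjump point it is a
unit clause. -/
def Learns (s : State D ar) (I₀ I I' : Struc (Atom D ar)) (C : Set (Lit (Atom D ar))) : Prop :=
  Entails s I₀ C ∧ (∀ m ∈ C, m.neg ∈ I) ∧
    ∃ l ∈ C, l ∉ I' ∧ l.neg ∉ I' ∧ ∀ m ∈ C, m ≠ l → m.neg ∈ I'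

/-! ### Justification management -/

/-- Check of a literal `l` that becomes true: enqueue `l` if it is defined in `Dd` and has no direct
justification, and enqueue each literal with a direct justification that is now in conflict: those
whose direct justification contains `¬l`, and `¬l` itself if it has one. -/
def CheckLiteral (s : State D ar) (l : Lit (Atom D ar)) (q q' : List (Lit (Atom D ar))) : Prop :=
  ∃ q₁ q₂ : List (Lit (Atom D ar)), q' = q ++ q₁ ++ q₂ ∧
    ((s.Dd l.atom ≠ none ∧ s.J l = none) ∧ q₁ = [l] ∨
      ¬(s.Dd l.atom ≠ none ∧ s.J l = none) ∧ q₁ = []) ∧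
    q₂.Nodup ∧ ∀ m, m ∈ q₂ ↔ ∃ S, s.J m = some S ∧ (l.neg ∈ S ∨ m = l.neg)

/-- Check of all literals in a list, one after the other. -/
inductive CheckLiterals (s : State D ar) :
    List (Lit (Atom D ar)) → List (Lit (Atom D ar)) → List (Lit (Atom D ar)) → Prop
  | nil (q : List (Lit (Atom D ar))) : CheckLiterals s [] q q
  | cons (l : Lit (Atom D ar)) (L q q' q'' : List (Lit (Atom D ar))) :
      CheckLiteral s l q q' → CheckLiterals s L q' q'' → CheckLiterals s (l :: L) q q''

/-- Enqueue each literal whose direct justification in `J` contains a literal of `B`. -/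
def Requeue (J : JGraph D ar) (B : Set (Lit (Atom D ar))) (q q' : List (Lit (Atom D ar))) : Prop :=
  ∃ q₁ : List (Lit (Atom D ar)), q' = q ++ q₁ ∧ q₁.Nodup ∧
    ∀ m, m ∈ q₁ ↔ ∃ S, J m = some S ∧ ∃ b ∈ B, b ∈ S

/-- The literals in a justification graph. -/
def JGraph.nodes (K : JGraph D ar) : Set (Lit (Atom D ar)) :=
  {m | K m ≠ none} ∪ {m | ∃ n S, K n = some S ∧ m ∈ S}

/-- No literal is unfounded: on each infinite path, all literals are negative from some point on. -/
def JGraph.NoUnfounded (K : JGraph D ar) : Prop :=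
  ∀ p : ℕ → Lit (Atom D ar), (∀ n, ∃ S, K (p n) = some S ∧ p (n + 1) ∈ S) →
    ∃ N, ∀ n, N ≤ n → (p n).sign = false

open Classical in
/-- The justification in which `l` has direct justification `S`; the direct justifications of the
other literals on the queue are not considered part of it. -/
def activeGraph (s : State D ar) (l : Lit (Atom D ar)) (S : Set (Lit (Atom D ar))) : JGraph D ar :=
  fun m => if m = l then some S else if m ∈ s.queue then none else s.J m

/-- `S` obeys the invariants to be the direct justification of `l`: it contains no literals defined
in `Dg`; each of its literals that is defined in `Dd` has a direct justification or belongs to the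
queue; no literal is unfounded; the set of literals in the justification is consistent, and none of
them is false in the current structure. -/
def Valid (s : State D ar) (l : Lit (Atom D ar)) (S : Set (Lit (Atom D ar))) : Prop :=
  (∀ m ∈ S, s.Dg m.atom = none) ∧
  (∀ m ∈ S, s.Dd m.atom ≠ none → activeGraph s l S m ≠ none ∨ m ∈ s.queue) ∧
  (activeGraph s l S).NoUnfounded ∧
  Consistent (activeGraph s l S).nodes ∧
  ∀ m ∈ (activeGraph s l S).nodes, m.neg ∉ s.I

/-- `l` has a direct justification, and it obeys the invariants. -/
def HasValid (s : State D ar) (l : Lit (Atom D ar)) : Prop := ∃ S, s.J l = some S ∧ Valid s l S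

/-- The sets of literals that can be collected by recursion over a formula in order to make it true:
all conjuncts and all instances of a universal quantification, one disjunct, and one instance, or
(for large domains) all instances, of an existential quantification. -/
inductive Collects : DFormula D (Atom D ar) → Set (Lit (Atom D ar)) → Prop
  | lit (l : Lit (Atom D ar)) : Collects (.lit l) {l}
  | conj (n : ℕ) (f : Fin n → DFormula D (Atom D ar)) (S : Fin n → Set (Lit (Atom D ar))) :
      (∀ i, Collects (f i) (S i)) → Collects (.conj n f) (⋃ i, S i)
  | disj (n : ℕ) (f : Fin n → DFormula D (Atom D ar)) (i : Fin n) (S : Set (Lit (Atom D ar))) :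
      Collects (f i) S → Collects (.disj n f) S
  | all (X : Set D) (f : D → DFormula D (Atom D ar)) (S : D → Set (Lit (Atom D ar))) :
      (∀ d ∈ X, Collects (f d) (S d)) → Collects (.all X f) (⋃ d ∈ X, S d)
  | ex (X : Set D) (f : D → DFormula D (Atom D ar)) (d : D) (S : Set (Lit (Atom D ar))) :
      d ∈ X → Collects (f d) S → Collects (.ex X f) S
  | exLarge (X : Set D) (f : D → DFormula D (Atom D ar)) (S : D → Set (Lit (Atom D ar))) :
      X.Nonempty → (∀ d ∈ X, Collects (f d) (S d)) → Collects (.ex X f) (⋃ d ∈ X, S d)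

/-- `l` needs a direct justification: it is true and defined in `Dd`. -/
def Needs (s : State D ar) (l : Lit (Atom D ar)) : Prop := l ∈ s.I ∧ s.Dd l.atom ≠ none

/-- The formula to be made true by a direct justification of `l`, given the body of its rule. -/
def goalFormula (l : Lit (Atom D ar)) (φ : DFormula D (Atom D ar)) : DFormula D (Atom D ar) :=
  if l.sign then φ else φ.neg

open Classical in
/-- Lazy grounding of a literal `l` that was just dequeued. If `l` has a direct justification that
obeys the invariants, nothing happens. Otherwise, if `l` needs one, either a valid direct
justification is built from the rule body, or (the search for one being allowed to fail) the
rule instance that defines `l` is split off from `Dd`, grounded one step, and the literals whose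
direct justification contains `l` or `¬l` are enqueued. If `l` does not need one, its invalid direct
justification (if any) is discarded, and the literals whose direct justification contains `l` are
enqueued. -/
inductive LazyGround (s : State D ar) (l : Lit (Atom D ar)) : State D ar → Prop
  | keep : HasValid s l → LazyGround s l s
  | build (φ : DFormula D (Atom D ar)) (S : Set (Lit (Atom D ar))) :
      ¬ HasValid s l → Needs s l → s.Dd l.atom = some φ →
      Collects (goalFormula l φ) S → Valid s l S →
      LazyGround s l { s with J := Function.update s.J l (some S) }
  | split (φ g : DFormula D (Atom D ar)) (new : Pos D → Option (DFormula D (Atom D ar)))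
      (J' : JGraph D ar) (q' : List (Lit (Atom D ar))) :
      ¬ HasValid s l → Needs s l → s.Dd l.atom = some φ → OneStep s.I l.atom φ g new →
      J' = Function.update (Function.update s.J l none) l.neg none →
      Requeue J' {l, l.neg} s.queue q' →
      LazyGround s l
        { s with
          Dg := Function.update s.Dg l.atom (some g)
          Dd := fun a => if a = l.atom then none else
            match a with
            | .dom b => s.Dd (.dom b)
            | .tse h p => if h = l.atom then new p else s.Dd (.tse h p)
          J := J'
          queue := q' }
  | discard (J' : JGraph D ar) (q' : List (Lit (Atom D ar))) :
      ¬ HasValid s l → ¬ Needs s l → J' = Function.update s.J l none →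
      Requeue J' {l} s.queue q' → LazyGround s l { s with J := J', queue := q' }

/-! ### The main loop -/

variable (D ar) in
/-- A configuration: at the start of the main loop in a state, or after returning. -/
inductive Config
  | running (s : State D ar) : Config
  | returned (s : State D ar) : Config
  | failed : Config

/-- One iteration of the main loop for the input structure `Iin`: propagate, add the propagated
literals and check them; then, at a conflict, learn a clause and backjump, or return false if no
choice has been made; else process the first literal of the queue, if any; else return the structure
and the justification if the structure is a model of `Sg ∪ Dg`; else make a choice. -/
inductive Step (Iin : Struc (DomAtom D ar)) : Config D ar → Config D ar → Prop
  | fail (s : State D ar) (L : List (Lit (Atom D ar))) :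
      Propagates s L → ¬ Consistent (extend s.I L) → s.trail = [] →
      Step Iin (.running s) .failed
  | backjump (s : State D ar) (L q : List (Lit (Atom D ar))) (C : Set (Lit (Atom D ar)))
      (t t' : List (Struc (Atom D ar))) (I' : Struc (Atom D ar)) :
      Propagates s L → CheckLiterals s L s.queue q → ¬ Consistent (extend s.I L) →
      s.trail = t ++ I' :: t' → Learns s (embed Iin) (extend s.I L) I' C →
      Step Iin (.running s)
        (.running { s with Sg := insert C s.Sg, I := I', trail := t', queue := q })
  | justify (s s' : State D ar) (L q : List (Lit (Atom D ar))) (l : Lit (Atom D ar)) :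
      Propagates s L → CheckLiterals s L s.queue (l :: q) → Consistent (extend s.I L) →
      LazyGround { s with I := extend s.I L, queue := q } l s' →
      Step Iin (.running s) (.running s')
  | success (s : State D ar) (L : List (Lit (Atom D ar))) :
      Propagates s L → CheckLiterals s L s.queue [] → Consistent (extend s.I L) →
      IsGroundModel s (extend s.I L) →
      Step Iin (.running s) (.returned { s with I := extend s.I L, queue := [] })
  | choose (s : State D ar) (L q : List (Lit (Atom D ar))) (l : Lit (Atom D ar)) :
      Propagates s L → CheckLiterals s L s.queue [] → Consistent (extend s.I L) →
      ¬ IsGroundModel s (extend s.I L) →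
      l.atom ∈ groundAtoms s → l ∉ extend s.I L → l.neg ∉ extend s.I L →
      CheckLiteral s l [] q →
      Step Iin (.running s)
        (.running { s with
          I := insert l (extend s.I L), trail := extend s.I L :: s.trail, queue := q })

/-- The configuration `c` can be reached by the algorithm on the theory `T` and the input
structure `Iin`. -/
def Reaches (T : Theory D ar) (Iin : Struc (DomAtom D ar)) (c : Config D ar) : Prop :=
  Relation.ReflTransGen (Step Iin) (.running (initState T Iin)) c

/-- There is a run of the algorithm that does not end. -/
def HasInfiniteRun (T : Theory D ar) (Iin : Struc (DomAtom D ar)) : Prop :=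
  ∃ c : ℕ → Config D ar, c 0 = .running (initState T Iin) ∧ ∀ n, Step Iin (c n) (c (n + 1))

/-- The inputs of the algorithm: a theory with a total definition, and a three-valued structure in
which the defined atoms are unknown. -/
def IsInput (T : Theory D ar) (Iin : Struc (DomAtom D ar)) : Prop :=
  Total T.defn.toRules ∧ Consistent Iin ∧ ∀ l ∈ Iin, l.atom ∈ openAtoms T.defn.toRules

/-- The structure of a state, expanded with the literals in the direct justifications. -/
def State.expanded (s : State D ar) : Struc (Atom D ar) :=
  s.I ∪ {m | ∃ l S, s.J l = some S ∧ m ∈ S}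

end Algorithm

end LazyMX

end

open LazyMX

namespace LazyMX

/-! ### Literals and formulas -/

section Semantics

variable {D : Type u} {A : Type w}

/-! Three groups of invariants, bundled in `Inv`, hold initially and survive every iteration
(`Step.inv`). The correctness and progress claims are read off them.

Rules. Grounding one rule instance replaces it by a ground rule and rules for fresh Tseitin symbols.
These symbols occur only positively, so they are computed inside the least fixpoint that defines the
stable operator, and the operator is unchanged on all other atoms (`Refines.splitRules`). So the
ground and delayed rules together have, on the vocabulary, the well-founded semantics of the
original definition and inherit its totality.

Justification. Each true delayed literal has a direct justification or is on the queue, and the part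
off the queue is consistent, compatible with the structure and without unfounded paths. If a
justified literal failed in the well-founded model, failing literals could be followed along the
justification forever, meeting positive ones infinitely often, which is excluded
(`mem_wf_of_justified`).

Search. Clauses and propagated literals are tested against `targetModels`: two-valued models of the
ground rules with the sentence true and the input expanded. A two-valued well-founded model of a
definition is one of every part of it (`IsWfModel.of_le`), so grounding more rules only shrinks this
set and nothing learned becomes wrong.

A returned structure is therefore contained in every well-founded model over an expansion of its
open part. The answer false is sound because a model of the theory would yield a target model that
propagation without choices can never leave. At a conflict, negating the decisions gives a clause
that can be learned, and grounding one step naively is always possible, so no state is stuck.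

On a finite domain a lexicographic measure decreases: the size of the delayed rules; the distance of
the search from its last position, with literal counts per decision level read as digits; the number
of unassigned ground atoms; and a measure of the queue. On an infinite domain both examples use `p ←
∀ x : q(x)` and `q(x) ← r(x)`. For the sentence `q(d)` a single justification suffices. For `p`, a
returned state would have to contain infinitely many justified or assigned literals, while every
state holds finitely many; since the theory has a model, false is not returned either, so every run
is infinite. -/

@[simp] theorem Lit.neg_neg (l : Lit A) : l.neg.neg = l := by simp [Lit.neg]

@[simp] theorem Lit.neg_atom (l : Lit A) : l.neg.atom = l.atom := rfl

@[simp] theorem Lit.neg_sign (l : Lit A) : l.neg.sign = !l.sign := rfl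

theorem Lit.ext_iff' {l m : Lit A} : l = m ↔ l.atom = m.atom ∧ l.sign = m.sign := by
  cases l; cases m; simp

theorem Lit.neg_ne (l : Lit A) : l.neg ≠ l := by
  simp [Lit.ext_iff']

theorem Lit.eq_or_eq_neg {l m : Lit A} (h : l.atom = m.atom) : l = m ∨ l = m.neg := by
  rcases l with ⟨a, _ | _⟩ <;> rcases m with ⟨b, _ | _⟩ <;> simp_all [Lit.neg]

theorem Lit.eq_neg_iff {l m : Lit A} : l = m.neg ↔ m = l.neg := by
  constructor <;> (rintro rfl; simp)

theorem TwoValuedOn.mem_or {I : Struc A} {B : Set A} (h : TwoValuedOn I B) {l : Lit A}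
    (hl : l.atom ∈ B) : l ∈ I ∨ l.neg ∈ I := by
  rcases l with ⟨a, _ | _⟩
  · exact (h a hl).or.symm
  · exact (h a hl).or

theorem TwoValued.mem_or {I : Struc A} (h : TwoValued I) (l : Lit A) : l ∈ I ∨ l.neg ∈ I :=
  TwoValuedOn.mem_or h (Set.mem_univ _)

theorem TwoValuedOn.neg_notMem {I : Struc A} {B : Set A} (h : TwoValuedOn I B) {l : Lit A}
    (hl : l.atom ∈ B) (hm : l ∈ I) : l.neg ∉ I := by
  have := h _ hl
  rcases l with ⟨a, _ | _⟩ <;> simp_all [Lit.neg, Xor]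

theorem TwoValued.consistent {I : Struc A} (h : TwoValued I) : Consistent I :=
  fun _ hl => TwoValuedOn.neg_notMem h (Set.mem_univ _) hl

theorem TwoValued.neg_mem_iff {I : Struc A} (h : TwoValued I) (l : Lit A) : l.neg ∈ I ↔ l ∉ I :=
  ⟨fun h1 h2 => h.consistent l h2 h1, fun h1 => (h.mem_or l).resolve_left h1⟩

theorem TwoValuedOn.of_mem_or {I : Struc A} {B : Set A} (hc : Consistent I)
    (h : ∀ a ∈ B, ⟨a, true⟩ ∈ I ∨ ⟨a, false⟩ ∈ I) : TwoValuedOn I B := by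
  intro a ha
  have h1 := hc ⟨a, true⟩
  simp only [Lit.neg, Bool.not_true] at h1
  rcases h a ha with h2 | h2
  · exact Or.inl ⟨h2, h1 h2⟩
  · exact Or.inr ⟨h2, fun h3 => h1 h3 h2⟩

theorem Consistent.mono {I I' : Struc A} (h : Consistent I') (hs : I ⊆ I') : Consistent I :=
  fun l hl hn => h l (hs hl) (hs hn)

namespace DFormula

/-- The literals that occur in a domain formula. -/
def lits : DFormula D A → Set (Lit A)
  | lit l => {l}
  | conj _ f => {a | ∃ i, a ∈ (f i).lits}
  | disj _ f => {a | ∃ i, a ∈ (f i).lits}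
  | all S f => {a | ∃ d ∈ S, a ∈ (f d).lits}
  | ex S f => {a | ∃ d ∈ S, a ∈ (f d).lits}

theorem mem_atoms_iff (φ : DFormula D A) (a : A) : a ∈ φ.atoms ↔ ∃ l ∈ φ.lits, l.atom = a := by
  induction φ with
  | lit l => simp [atoms, lits, eq_comm]
  | conj n f ih | disj n f ih | all S f ih | ex S f ih =>
    simp only [atoms, lits, Set.mem_ofPred_eq, ih]
    constructor
    · rintro ⟨i, h⟩
      first
      | (obtain ⟨l, h1, h2⟩ := h; exact ⟨l, ⟨i, h1⟩, h2⟩)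
      | (obtain ⟨hi, l, h1, h2⟩ := h; exact ⟨l, ⟨i, hi, h1⟩, h2⟩)
    · rintro ⟨l, ⟨i, h⟩, h2⟩
      first
      | exact ⟨i, l, h, h2⟩
      | exact ⟨i, h.1, l, h.2, h2⟩

theorem atom_mem_atoms {φ : DFormula D A} {l : Lit A} (h : l ∈ φ.lits) : l.atom ∈ φ.atoms :=
  (mem_atoms_iff _ _).2 ⟨l, h, rfl⟩

theorem Holds.imp {φ : DFormula D A} {I I' : Struc A} (h : φ.Holds I)
    (hi : ∀ l ∈ φ.lits, l ∈ I → l ∈ I') : φ.Holds I' := by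
  induction φ with
  | lit l => exact hi l rfl h
  | conj n f ih => exact fun i => ih i (h i) fun l hl => hi l ⟨i, hl⟩
  | disj n f ih =>
    obtain ⟨i, h⟩ := h
    exact ⟨i, ih i h fun l hl => hi l ⟨i, hl⟩⟩
  | all S f ih => exact fun d hd => ih d (h d hd) fun l hl => hi l ⟨d, hd, hl⟩
  | ex S f ih =>
    obtain ⟨d, hd, h⟩ := h
    exact ⟨d, hd, ih d h fun l hl => hi l ⟨d, hd, hl⟩⟩

theorem Holds.mono {φ : DFormula D A} {I I' : Struc A} (h : φ.Holds I) (hi : I ⊆ I') :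
    φ.Holds I' := h.imp fun _ _ hl => hi hl

theorem lits_neg (φ : DFormula D A) : φ.neg.lits = {l | l.neg ∈ φ.lits} := by
  induction φ with
  | lit l => ext m; simp [neg, lits, Lit.eq_neg_iff, eq_comm]
  | conj n f ih | disj n f ih | all S f ih | ex S f ih => ext m; simp [neg, lits, ih]

/-- A formula and its negation can only both hold because of complementary literals. -/
theorem Holds.exists_neg_mem {φ : DFormula D A} {I I' : Struc A} (h : φ.neg.Holds I)
    (h' : φ.Holds I') : ∃ l ∈ φ.lits, l.neg ∈ I ∧ l ∈ I' := by
  induction φ with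
  | lit l => exact ⟨l, rfl, h, h'⟩
  | conj n f ih =>
    obtain ⟨i, h⟩ := h
    obtain ⟨l, h1, h2⟩ := ih i h (h' i)
    exact ⟨l, ⟨i, h1⟩, h2⟩
  | disj n f ih =>
    obtain ⟨i, h'⟩ := h'
    obtain ⟨l, h1, h2⟩ := ih i (h i) h'
    exact ⟨l, ⟨i, h1⟩, h2⟩
  | all S f ih =>
    obtain ⟨i, hi, h⟩ := h
    obtain ⟨l, h1, h2⟩ := ih i h (h' i hi)
    exact ⟨l, ⟨i, hi, h1⟩, h2⟩
  | ex S f ih =>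
    obtain ⟨i, hi, h'⟩ := h'
    obtain ⟨l, h1, h2⟩ := ih i (h i hi) h'
    exact ⟨l, ⟨i, hi, h1⟩, h2⟩

end DFormula

/-! ### The stable operator and the well-founded model -/

variable {Δ Δ' : Rules D A} {O O' : Struc A} {X X' Y Y' : Set A}

theorem mem_definedAtoms {a : A} : a ∈ definedAtoms Δ ↔ ∃ φ, Δ a = some φ := by
  simp [definedAtoms, Option.ne_none_iff_exists']

theorem mem_openAtoms {a : A} : a ∈ openAtoms Δ ↔ Δ a = none := Iff.rfl

theorem notMem_openAtoms {a : A} : a ∉ openAtoms Δ ↔ a ∈ definedAtoms Δ := Iff.rfl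

theorem mem_mixed {l : Lit A} : l ∈ mixed Δ O Y X ↔
    (l.atom ∈ openAtoms Δ ∧ l ∈ O) ∨ (l.atom ∈ definedAtoms Δ ∧ l.sign = true ∧ l.atom ∈ Y) ∨
      (l.atom ∈ definedAtoms Δ ∧ l.sign = false ∧ l.atom ∉ X) := by
  simp only [mixed, restrict, Set.mem_union, Set.mem_ofPred_eq]; tauto

theorem mem_mixed_of_open {l : Lit A} (h : l.atom ∈ openAtoms Δ) :
    l ∈ mixed Δ O Y X ↔ l ∈ O := by
  rw [mem_mixed]; simp only [definedAtoms, openAtoms, Set.mem_ofPred_eq] at *; tauto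

theorem mem_mixed_of_defined {a : A} {b : Bool} (h : a ∈ definedAtoms Δ) :
    (⟨a, b⟩ : Lit A) ∈ mixed Δ O Y X ↔ if b then a ∈ Y else a ∉ X := by
  rw [mem_mixed]; simp only [definedAtoms, openAtoms, Set.mem_ofPred_eq] at *
  cases b <;> simp [h]

theorem mixed_mono (hY : Y ⊆ Y') (hX : X' ⊆ X) : mixed Δ O Y X ⊆ mixed Δ O Y' X' := by
  intro l; rw [mem_mixed, mem_mixed]
  exact Or.imp_right (Or.imp (fun h => ⟨h.1, h.2.1, hY h.2.2⟩) fun h =>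
    ⟨h.1, h.2.1, fun h' => h.2.2 (hX h')⟩)

theorem stableOp_closed {a : A} {φ : DFormula D A} (h : Δ a = some φ)
    (hφ : φ.Holds (mixed Δ O (stableOp Δ O X) X)) : a ∈ stableOp Δ O X := by
  rintro Y hY
  exact hY a φ h (hφ.mono (mixed_mono (fun b hb => hb Y hY) subset_rfl))

theorem stableOp_le (h : ∀ a φ, Δ a = some φ → φ.Holds (mixed Δ O Y X) → a ∈ Y) :
    stableOp Δ O X ⊆ Y := fun _ ha => ha Y h

/-- Knaster–Tarski: the heads of the rules whose bodies hold at the least closed set form a closed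
set themselves. -/
theorem mem_stableOp_iff {a : A} : a ∈ stableOp Δ O X ↔
    ∃ φ, Δ a = some φ ∧ φ.Holds (mixed Δ O (stableOp Δ O X) X) := by
  constructor
  · intro h
    refine stableOp_le (Y := {a | ∃ φ, Δ a = some φ ∧ φ.Holds (mixed Δ O (stableOp Δ O X) X)})
      (fun b φ hb hφ => ⟨φ, hb, hφ.mono (mixed_mono ?_ subset_rfl)⟩) h
    rintro c ⟨ψ, hc, hψ⟩
    exact stableOp_closed hc hψ
  · rintro ⟨φ, h, hφ⟩
    exact stableOp_closed h hφ

theorem stableOp_subset_defined : stableOp Δ O X ⊆ definedAtoms Δ := by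
  intro a ha
  obtain ⟨φ, h, -⟩ := mem_stableOp_iff.1 ha
  exact mem_definedAtoms.2 ⟨φ, h⟩

theorem stableOp_antitone (h : X ⊆ X') : stableOp Δ O X' ⊆ stableOp Δ O X :=
  stableOp_le fun _ _ ha hφ => stableOp_closed ha (hφ.mono (mixed_mono subset_rfl h))

theorem wfTrue_le (h : stableOp Δ O (stableOp Δ O Y) ⊆ Y) : wfTrue Δ O ⊆ Y :=
  fun _ ha => ha Y h

/-- The stable operator is antitone, so its square is monotone and the least prefixpoint of the
square is a fixpoint. -/
theorem stableOp_stableOp_wfTrue :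
    stableOp Δ O (stableOp Δ O (wfTrue Δ O)) = wfTrue Δ O := by
  have h1 : stableOp Δ O (stableOp Δ O (wfTrue Δ O)) ⊆ wfTrue Δ O := by
    intro a ha Y hY
    exact hY (stableOp_antitone (stableOp_antitone (wfTrue_le hY)) ha)
  exact h1.antisymm (wfTrue_le (stableOp_antitone (stableOp_antitone h1)))

theorem wfTrue_subset_defined : wfTrue Δ O ⊆ definedAtoms Δ := by
  rw [← stableOp_stableOp_wfTrue]; exact stableOp_subset_defined

theorem mem_wf {l : Lit A} : l ∈ wf Δ O ↔
    (l.atom ∈ openAtoms Δ ∧ l ∈ O) ∨ (l.sign = true ∧ l.atom ∈ wfTrue Δ O) ∨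
      (l.sign = false ∧ l.atom ∈ definedAtoms Δ ∧ l.atom ∉ stableOp Δ O (wfTrue Δ O)) := by
  simp only [wf, restrict, Set.mem_union, Set.mem_ofPred_eq]; tauto

theorem mem_wf_of_open {l : Lit A} (h : l.atom ∈ openAtoms Δ) : l ∈ wf Δ O ↔ l ∈ O := by
  have h2 : l.atom ∉ wfTrue Δ O := fun h' => wfTrue_subset_defined h' h
  have h3 : l.atom ∉ definedAtoms Δ := fun h' => h' h
  rw [mem_wf]; tauto

theorem pos_mem_wf {a : A} (h : a ∈ definedAtoms Δ) :
    (⟨a, true⟩ : Lit A) ∈ wf Δ O ↔ a ∈ wfTrue Δ O := by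
  have : a ∉ openAtoms Δ := h
  rw [mem_wf]; simp [this]

theorem neg_mem_wf {a : A} (h : a ∈ definedAtoms Δ) :
    (⟨a, false⟩ : Lit A) ∈ wf Δ O ↔ a ∉ stableOp Δ O (wfTrue Δ O) := by
  have : a ∉ openAtoms Δ := h
  rw [mem_wf]; simp [this, h]

/-- The stable operator depends on `O` and `X` only through the literals that occur in bodies. -/
theorem stableOp_congr (h : ∀ a φ, Δ a = some φ → ∀ l ∈ φ.lits, (l.atom ∈ openAtoms Δ →
    (l ∈ O ↔ l ∈ O')) ∧ (l.atom ∈ definedAtoms Δ → l.sign = false → (l.atom ∈ X ↔ l.atom ∈ X'))) :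
    stableOp Δ O X = stableOp Δ O' X' := by
  have key : ∀ a φ, Δ a = some φ → ∀ Y,
      (φ.Holds (mixed Δ O Y X) ↔ φ.Holds (mixed Δ O' Y X')) := by
    intro a φ ha Y
    have : ∀ l ∈ φ.lits, l ∈ mixed Δ O Y X ↔ l ∈ mixed Δ O' Y X' := by
      intro l hl
      obtain ⟨h1, h2⟩ := h a φ ha l hl
      rw [mem_mixed, mem_mixed]
      refine or_congr (and_congr_right h1) (or_congr Iff.rfl ?_)
      refine and_congr_right fun h3 => and_congr_right fun h4 => not_congr (h2 h3 h4)
    exact ⟨fun h' => h'.imp fun l hl => (this l hl).1, fun h' => h'.imp fun l hl => (this l hl).2⟩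
  simp only [stableOp]
  congr 1
  ext Y
  refine forall_congr' fun a => forall_congr' fun φ => forall_congr' fun ha => ?_
  rw [key a φ ha]

theorem wfTrue_congr (h : ∀ a φ, Δ a = some φ → ∀ l ∈ φ.lits, l.atom ∈ openAtoms Δ →
    (l ∈ O ↔ l ∈ O')) : wfTrue Δ O = wfTrue Δ O' := by
  have : ∀ X, stableOp Δ O X = stableOp Δ O' X := fun X =>
    stableOp_congr fun a φ ha l hl => ⟨h a φ ha l hl, fun _ _ => Iff.rfl⟩
  simp only [wfTrue, this]

/-- The value of a defined atom in the well-founded model depends on the structure of the open atoms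
only through the literals that occur in bodies. -/
theorem mem_wf_congr (h : ∀ a φ, Δ a = some φ → ∀ l ∈ φ.lits, l.atom ∈ openAtoms Δ →
    (l ∈ O ↔ l ∈ O')) {l : Lit A} (hl : l.atom ∈ definedAtoms Δ) :
    l ∈ wf Δ O ↔ l ∈ wf Δ O' := by
  rcases l with ⟨a, _ | _⟩
  · rw [neg_mem_wf hl, neg_mem_wf hl, ← wfTrue_congr h, stableOp_congr (O' := O')]
    exact fun a φ ha l hl => ⟨h a φ ha l hl, fun _ _ => Iff.rfl⟩
  · rw [pos_mem_wf hl, pos_mem_wf hl, wfTrue_congr h]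

theorem wf_restrict : wf Δ (restrict O (openAtoms Δ)) = wf Δ O := by
  ext l
  by_cases h : l.atom ∈ openAtoms Δ
  · rw [mem_wf_of_open h, mem_wf_of_open h]; simp [restrict, h]
  · exact mem_wf_congr (fun a φ _ l _ ho => by simp [restrict, ho]) h

theorem isWfModel_iff : IsWfModel Δ O ↔ O = wf Δ O := by rw [IsWfModel, wf_restrict]

theorem wf_wf : wf Δ (wf Δ O) = wf Δ O := by
  ext l
  by_cases h : l.atom ∈ openAtoms Δ
  · rw [mem_wf_of_open h, mem_wf_of_open h]
  · exact mem_wf_congr (fun a φ _ l _ ho => mem_wf_of_open ho) h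

theorem isWfModel_wf : IsWfModel Δ (wf Δ O) := isWfModel_iff.2 wf_wf.symm

/-- Two-valuedness says that the lower bound `wfTrue` and the upper bound of the alternating
fixpoint coincide; `twoValued_wf` is the converse. -/
theorem stableOp_wfTrue_of_twoValued (h : TwoValued (wf Δ O)) :
    stableOp Δ O (wfTrue Δ O) = wfTrue Δ O := by
  ext a
  by_cases ha : a ∈ definedAtoms Δ
  · rw [← pos_mem_wf ha, ← not_iff_not, ← neg_mem_wf ha]
    exact h.neg_mem_iff ⟨a, true⟩
  · exact ⟨fun h => absurd (stableOp_subset_defined h) ha,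
      fun h => absurd (wfTrue_subset_defined h) ha⟩

theorem twoValued_wf (hO : TwoValuedOn O (openAtoms Δ))
    (h : stableOp Δ O (wfTrue Δ O) = wfTrue Δ O) : TwoValued (wf Δ O) := by
  intro a _
  by_cases ha : a ∈ openAtoms Δ
  · rw [mem_wf_of_open ha, mem_wf_of_open ha]; exact hO a ha
  · rw [pos_mem_wf ha, neg_mem_wf ha, h]
    by_cases h' : a ∈ wfTrue Δ O <;> simp [h', Xor]

theorem mixed_eq_self {M : Struc A} (hM : TwoValued M)
    (h : ∀ a, a ∈ definedAtoms Δ → (a ∈ X ↔ ⟨a, true⟩ ∈ M)) : mixed Δ M X X = M := by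
  ext ⟨a, b⟩
  by_cases ha : a ∈ openAtoms Δ
  · exact mem_mixed_of_open ha
  · rw [mem_mixed_of_defined ha]
    cases b
    · simp only [h a ha, Bool.false_eq_true, if_false]
      exact (hM.neg_mem_iff ⟨a, true⟩).symm
    · simp [h a ha]

/-- Compares evaluation in a part `Δ` with evaluation in the whole `Δ'`, for the modularity theorem.
Atoms defined only in `Δ'` are open for `Δ`, hence read in `M`, where their value is given by `W`;
this is why the bounds outside `definedAtoms Δ` refer to `W`. -/
theorem mixed_subset_mixed_of_le {M : Struc A} {W Z Z' : Set A} (hM : TwoValued M)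
    (hdd : definedAtoms Δ ⊆ definedAtoms Δ')
    (hW : ∀ a, a ∈ definedAtoms Δ' → (a ∈ W ↔ ⟨a, true⟩ ∈ M))
    (h1 : ∀ a ∈ definedAtoms Δ, a ∈ Y → a ∈ Y') (h2 : ∀ a ∈ definedAtoms Δ, a ∈ Z' → a ∈ Z)
    (h3 : ∀ a ∉ definedAtoms Δ, a ∈ W → a ∈ Y') (h4 : ∀ a ∉ definedAtoms Δ, a ∈ Z' → a ∈ W) :
    mixed Δ M Y Z ⊆ mixed Δ' M Y' Z' := by
  rintro ⟨a, b⟩ hl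
  by_cases ha : a ∈ definedAtoms Δ
  · rw [mem_mixed_of_defined ha] at hl
    rw [mem_mixed_of_defined (hdd ha)]
    cases b
    · exact fun h => hl (h2 a ha h)
    · exact h1 a ha hl
  · have ho : a ∈ openAtoms Δ := not_not.1 ha
    rw [mem_mixed_of_open ho] at hl
    by_cases ha' : a ∈ openAtoms Δ'
    · rwa [mem_mixed_of_open ha']
    · rw [mem_mixed_of_defined ha']
      cases b
      · exact fun h => (hM.neg_mem_iff ⟨a, true⟩).1 hl ((hW a ha').1 (h4 a ha h))
      · exact h3 a ha ((hW a ha').2 hl)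

theorem mixed_subset_mixed_of_ge {M : Struc A} {W Z Z' : Set A} (hM : TwoValued M)
    (hdd : definedAtoms Δ ⊆ definedAtoms Δ')
    (hW : ∀ a, a ∈ definedAtoms Δ' → (a ∈ W ↔ ⟨a, true⟩ ∈ M))
    (h1 : ∀ a ∈ definedAtoms Δ, a ∈ Y' → a ∈ Y) (h2 : ∀ a ∈ definedAtoms Δ, a ∈ Z → a ∈ Z')
    (h3 : ∀ a ∉ definedAtoms Δ, a ∈ Y' → a ∈ W) (h4 : ∀ a ∉ definedAtoms Δ, a ∈ W → a ∈ Z') :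
    mixed Δ' M Y' Z' ⊆ mixed Δ M Y Z := by
  rintro ⟨a, b⟩ hl
  by_cases ha : a ∈ definedAtoms Δ
  · rw [mem_mixed_of_defined (hdd ha)] at hl
    rw [mem_mixed_of_defined ha]
    cases b
    · exact fun h => hl (h2 a ha h)
    · exact h1 a ha hl
  · have ho : a ∈ openAtoms Δ := not_not.1 ha
    rw [mem_mixed_of_open ho]
    by_cases ha' : a ∈ openAtoms Δ'
    · rwa [mem_mixed_of_open ha'] at hl
    · rw [mem_mixed_of_defined ha'] at hl
      cases b
      · exact (hM.neg_mem_iff ⟨a, true⟩).2 fun h => hl (h4 a ha ((hW a ha').2 h))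
      · exact (hW a ha').1 (h3 a ha hl)

/-- Modularity: a two-valued well-founded model of a definition is a well-founded model of each
part of the definition. -/
theorem IsWfModel.of_le {M : Struc A} (hM : TwoValued M) (h : IsWfModel Δ' M)
    (hle : ∀ a φ, Δ a = some φ → Δ' a = some φ) : IsWfModel Δ M := by
  rw [isWfModel_iff] at h ⊢
  have hdd : definedAtoms Δ ⊆ definedAtoms Δ' := fun a ha => by
    obtain ⟨φ, h⟩ := mem_definedAtoms.1 ha
    exact mem_definedAtoms.2 ⟨φ, hle a φ h⟩
  have hS' : stableOp Δ' M (wfTrue Δ' M) = wfTrue Δ' M :=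
    stableOp_wfTrue_of_twoValued (h ▸ hM)
  obtain ⟨W, hW⟩ : ∃ W, W = wfTrue Δ' M := ⟨_, rfl⟩
  rw [← hW] at hS'
  have hWM : ∀ a, a ∈ definedAtoms Δ' → (a ∈ W ↔ ⟨a, true⟩ ∈ M) := fun a ha => by
    conv_rhs => rw [h]
    rw [hW]; exact (pos_mem_wf ha).symm
  have hAM : ∀ a, a ∈ definedAtoms Δ → (a ∈ W ∩ definedAtoms Δ ↔ ⟨a, true⟩ ∈ M) := fun a ha => by
    rw [← hWM a (hdd ha)]; simp [ha]
  have hmix' : mixed Δ' M W W = M := mixed_eq_self hM hWM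
  have hmix : mixed Δ M (W ∩ definedAtoms Δ) (W ∩ definedAtoms Δ) = M := mixed_eq_self hM hAM
  have hWc : ∀ a φ, Δ' a = some φ → ∀ Y ⊆ W, ∀ Z, W ⊆ Z → φ.Holds (mixed Δ' M Y Z) → a ∈ W := by
    intro a φ ha Y hY Z hZ hφ
    rw [← hS']
    refine stableOp_closed ha (hφ.mono (mixed_mono (hY.trans hS'.ge) hZ))
  -- The part of `W` defined by `Δ` is a fixpoint of the stable operator of `Δ`. One inclusion holds
  -- because both evaluations amount to reading `M`; the other uses that `W` is least for `Δ'`.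
  have hA : stableOp Δ M (W ∩ definedAtoms Δ) = W ∩ definedAtoms Δ := by
    have h1 : stableOp Δ M (W ∩ definedAtoms Δ) ⊆ W ∩ definedAtoms Δ := by
      refine stableOp_le fun a φ ha hφ => ⟨?_, mem_definedAtoms.2 ⟨φ, ha⟩⟩
      rw [hmix, ← hmix'] at hφ
      exact hWc a φ (hle a φ ha) W subset_rfl W subset_rfl hφ
    refine h1.antisymm ?_
    have h2 : W ⊆ stableOp Δ M (W ∩ definedAtoms Δ) ∪ (W \ definedAtoms Δ) := by
      rw [← hS']
      conv_rhs => rw [hS']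
      refine stableOp_le fun a φ ha hφ => ?_
      by_cases had : a ∈ definedAtoms Δ
      · left
        obtain ⟨ψ, hψ⟩ := mem_definedAtoms.1 had
        obtain rfl : ψ = φ := by simpa [ha] using (hle a ψ hψ).symm
        refine stableOp_closed hψ (hφ.mono (mixed_subset_mixed_of_ge hM hdd hWM ?_ ?_ ?_ ?_))
        · rintro b hb (h | h)
          exacts [h, absurd hb h.2]
        · exact fun b hb h => h.1
        · rintro b hb (h | h)
          exacts [(h1 h).1, h.1]
        · exact fun b hb h => h
      · refine Or.inr ⟨hWc a φ ha _ ?_ W subset_rfl hφ, had⟩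
        rintro b (h | h)
        exacts [(h1 h).1, h.1]
    rintro a ⟨ha, hd⟩
    rcases h2 ha with h | h
    exacts [h, absurd hd h.2]
  -- It remains to see that this fixpoint is also the least one of the square. For this, `Y` is
  -- completed by the atoms of `W` outside `Δ` to a prefixpoint of the square for `Δ'`, which must
  -- contain `W`.
  obtain ⟨Y, hY⟩ : ∃ Y, Y = wfTrue Δ M := ⟨_, rfl⟩
  have hSY : stableOp Δ M (stableOp Δ M Y) = Y := by rw [hY, stableOp_stableOp_wfTrue]
  have hYA : Y ⊆ W ∩ definedAtoms Δ := by
    rw [hY]; exact wfTrue_le (by rw [hA, hA])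
  have hY'W : Y ∪ (W \ definedAtoms Δ) ⊆ W := by
    rintro b (h | h)
    exacts [(hYA h).1, h.1]
  have hWZ : W ⊆ stableOp Δ' M (Y ∪ (W \ definedAtoms Δ)) := by
    conv_lhs => rw [← hS']
    exact stableOp_antitone hY'W
  have hSYZ : stableOp Δ M Y ⊆ stableOp Δ' M (Y ∪ (W \ definedAtoms Δ)) := by
    refine stableOp_le fun a φ ha hφ => stableOp_closed (hle a φ ha) (hφ.mono
      (mixed_subset_mixed_of_le hM hdd hWM ?_ ?_ ?_ ?_))
    · exact fun b _ h => h
    · rintro b hb (h | h)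
      exacts [h, absurd hb h.2]
    · exact fun b hb h => hWZ h
    · exact fun b hb h => hY'W h
  have hWY : W ⊆ Y ∪ (W \ definedAtoms Δ) := by
    conv_lhs => rw [hW]
    refine wfTrue_le (stableOp_le fun a φ ha hφ => ?_)
    by_cases had : a ∈ definedAtoms Δ
    · left
      obtain ⟨ψ, hψ⟩ := mem_definedAtoms.1 had
      obtain rfl : ψ = φ := by simpa [ha] using (hle a ψ hψ).symm
      rw [← hSY]
      refine stableOp_closed hψ (hφ.mono (mixed_subset_mixed_of_ge hM hdd hWM ?_ ?_ ?_ ?_))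
      · rintro b hb (h | h)
        exacts [by rwa [hSY], absurd hb h.2]
      · exact fun b hb h => hSYZ h
      · exact fun b hb h => hY'W h
      · exact fun b hb h => hWZ h
    · exact Or.inr ⟨hWc a φ ha _ hY'W _ hWZ hφ, had⟩
  have hYeq : Y = W ∩ definedAtoms Δ := by
    refine hYA.antisymm fun a ha => ?_
    rcases hWY ha.1 with h | h
    exacts [h, absurd ha.2 h.2]
  ext ⟨a, b⟩
  by_cases ha : a ∈ openAtoms Δ
  · rw [mem_wf_of_open ha]
  · cases b
    · rw [neg_mem_wf ha, ← hY, hYeq, hA, hAM a ha]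
      exact hM.neg_mem_iff ⟨a, true⟩
    · rw [pos_mem_wf ha, ← hY, hYeq, hAM a ha]

end Semantics

/-! ### Instances of rules over the vocabulary and over the extended vocabulary -/

section Instances

variable {D : Type u} {V : Type v} {ar : V → ℕ} {A : Type w}

/-- Disjointness of the rules gives the same rule, and equality of the heads then gives the same
arguments. This makes the choice in `Definition.inst` harmless. -/
theorem Definition.IsInstance.unique {Δ : Definition D ar} {e : DomAtom D ar → A}
    {a : DomAtom D ar} {ψ ψ' : DFormula D A} (h : Δ.IsInstance e a ψ)
    (h' : Δ.IsInstance e a ψ') : ψ = ψ' := by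
  obtain ⟨r, hr, t, ht, rfl, rfl⟩ := h
  obtain ⟨r', hr', t', ht', h, rfl⟩ := h'
  obtain rfl := Δ.disjoint r hr r' hr' t ht t' ht' h
  simp only [DomAtom.mk.injEq, heq_eq_eq, true_and] at h
  rw [h]

theorem Definition.inst_eq_some {Δ : Definition D ar} {e : DomAtom D ar → A} {a : DomAtom D ar}
    {ψ : DFormula D A} : Δ.inst e a = some ψ ↔ Δ.IsInstance e a ψ := by
  unfold Definition.inst
  split_ifs with h
  · constructor
    · intro h'
      rw [← Option.some.inj h']
      exact h.choose_spec
    · intro h'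
      rw [h.choose_spec.unique h']
  · exact ⟨fun h' => by simp at h', fun h' => absurd ⟨ψ, h'⟩ h⟩

/-- Which atoms are defined depends on the heads alone, not on the set of atoms in which the bodies
are read. -/
theorem Definition.inst_eq_none_iff {A' : Type*} {Δ : Definition D ar} {e : DomAtom D ar → A}
    {e' : DomAtom D ar → A'} {a : DomAtom D ar} : Δ.inst e a = none ↔ Δ.inst e' a = none := by
  rw [Option.eq_none_iff_forall_ne_some, Option.eq_none_iff_forall_ne_some]
  simp only [ne_eq, Definition.inst_eq_some, Definition.IsInstance, not_exists, not_and]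
  constructor
  · exact fun h _ r hr t ht ha _ => h _ r hr t ht ha rfl
  · exact fun h _ r hr t ht ha _ => h _ r hr t ht ha rfl

theorem Formula.inst_holds {n : ℕ} (φ : Formula D ar n) (x : Fin n → D) (K : Struc (Atom D ar)) :
    (φ.inst .dom x).Holds K ↔ (φ.inst id x).Holds (restrictVoc K) := by
  induction φ with
  | lit b P t => exact Iff.rfl
  | conj k f ih => exact forall_congr' fun i => ih i x
  | disj k f ih => exact exists_congr fun i => ih i x
  | all S φ ih => exact forall_congr' fun d => forall_congr' fun _ => ih _
  | ex S φ ih => exact exists_congr fun d => and_congr_right fun _ => ih _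

theorem Formula.exists_dom_of_mem_lits {n : ℕ} (φ : Formula D ar n) (x : Fin n → D)
    {l : Lit (Atom D ar)} (hl : l ∈ (φ.inst .dom x).lits) : ∃ b, l.atom = .dom b := by
  induction φ with
  | lit b P t => obtain rfl := hl; exact ⟨_, rfl⟩
  | conj k f ih => obtain ⟨i, h⟩ := hl; exact ih i x h
  | disj k f ih => obtain ⟨i, h⟩ := hl; exact ih i x h
  | all S φ ih => obtain ⟨d, _, h⟩ := hl; exact ih _ h
  | ex S φ ih => obtain ⟨d, _, h⟩ := hl; exact ih _ h

/-- The instances of the rules of a theory, over the extended vocabulary. -/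
noncomputable def Theory.extRules (T : Theory D ar) : Rules D (Atom D ar) := fun a => match a with
  | .dom b => T.defn.inst .dom b
  | .tse _ _ => none

theorem Theory.exists_dom_of_mem_lits {T : Theory D ar} {a : Atom D ar}
    {φ : DFormula D (Atom D ar)} (h : T.extRules a = some φ) {l : Lit (Atom D ar)}
    (hl : l ∈ φ.lits) : ∃ b, l.atom = .dom b := by
  cases a with
  | dom b =>
    obtain ⟨r, hr, t, ht, -, rfl⟩ := Definition.inst_eq_some.1 h
    exact Formula.exists_dom_of_mem_lits _ _ hl
  | tse h' p => cases h

theorem mem_restrictVoc {I : Struc (Atom D ar)} {l : Lit (DomAtom D ar)} :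
    l ∈ restrictVoc I ↔ (⟨.dom l.atom, l.sign⟩ : Lit (Atom D ar)) ∈ I := Iff.rfl

theorem mem_embed {I : Struc (DomAtom D ar)} {b : DomAtom D ar} {s : Bool} :
    (⟨.dom b, s⟩ : Lit (Atom D ar)) ∈ embed I ↔ ⟨b, s⟩ ∈ I := by
  constructor
  · rintro ⟨⟨b', s'⟩, hm, h⟩
    simp only [Lit.mk.injEq, Atom.dom.injEq] at h
    rwa [h.1, h.2]
  · exact fun h => ⟨_, h, rfl⟩

/-- A definition over the extended vocabulary that has the same stable operator on domain atoms as
the definition of the theory, and in which Tseitin symbols only occur positively. -/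
structure Refines (T : Theory D ar) (Δ : Rules D (Atom D ar)) : Prop where
  neg_dom : ∀ a φ, Δ a = some φ → ∀ l ∈ φ.lits, l.sign = false → ∃ b, l.atom = .dom b
  open_iff : ∀ b, Atom.dom b ∈ openAtoms Δ ↔ b ∈ openAtoms T.defn.toRules
  stable_iff : ∀ O X b, Atom.dom b ∈ stableOp Δ O X ↔
    b ∈ stableOp T.defn.toRules (restrictVoc O) (Atom.dom ⁻¹' X)

theorem restrictVoc_mixed {T : Theory D ar} {Δ : Rules D (Atom D ar)}
    (h : ∀ b, Atom.dom b ∈ openAtoms Δ ↔ b ∈ openAtoms T.defn.toRules)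
    (O : Struc (Atom D ar)) (Y X : Set (Atom D ar)) : restrictVoc (mixed Δ O Y X) =
      mixed T.defn.toRules (restrictVoc O) (Atom.dom ⁻¹' Y) (Atom.dom ⁻¹' X) := by
  ext ⟨b, s⟩
  rw [mem_restrictVoc]
  by_cases ho : b ∈ openAtoms T.defn.toRules
  · rw [mem_mixed_of_open ((h b).2 ho), mem_mixed_of_open (l := ⟨b, s⟩) ho, mem_restrictVoc]
  · rw [mem_mixed_of_defined ho, mem_mixed_of_defined fun h' => ho ((h b).1 h')]
    rfl

/-- The starting point of the invariant: before any grounding, the rules mention no Tseitin symbols,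
and the two least closed sets correspond by transport along `restrictVoc`. -/
theorem Theory.refines_extRules (T : Theory D ar) : Refines T T.extRules where
  neg_dom _ _ h _ hl _ := Theory.exists_dom_of_mem_lits h hl
  open_iff _ := Definition.inst_eq_none_iff
  stable_iff O X b := by
    have ho : ∀ b, Atom.dom b ∈ openAtoms T.extRules ↔ b ∈ openAtoms T.defn.toRules :=
      fun _ => Definition.inst_eq_none_iff
    constructor
    · suffices stableOp T.extRules O X ⊆
          {a | ∀ b, a = .dom b → b ∈ stableOp T.defn.toRules (restrictVoc O) (Atom.dom ⁻¹' X)} from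
        fun h => this h b rfl
      refine stableOp_le fun a φ ha hφ b hb => ?_
      subst hb
      obtain ⟨r, hr, t, ht, rfl, rfl⟩ := Definition.inst_eq_some.1 ha
      rw [Formula.inst_holds, restrictVoc_mixed ho] at hφ
      exact stableOp_closed (Definition.inst_eq_some.2 ⟨r, hr, t, ht, rfl, rfl⟩)
        (hφ.mono (mixed_mono (fun c hc => hc c rfl) subset_rfl))
    · suffices stableOp T.defn.toRules (restrictVoc O) (Atom.dom ⁻¹' X) ⊆
          Atom.dom ⁻¹' stableOp T.extRules O X from fun h => this h
      refine stableOp_le fun a φ ha hφ => ?_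
      obtain ⟨r, hr, t, ht, rfl, rfl⟩ := Definition.inst_eq_some.1 ha
      rw [← restrictVoc_mixed ho, ← Formula.inst_holds] at hφ
      exact stableOp_closed (Δ := T.extRules)
        (Definition.inst_eq_some.2 ⟨r, hr, t, ht, rfl, rfl⟩) hφ

namespace Refines

variable {T : Theory D ar} {Δ : Rules D (Atom D ar)} {O : Struc (Atom D ar)}

theorem preimage_stableOp (h : Refines T Δ) (X : Set (Atom D ar)) :
    Atom.dom ⁻¹' stableOp Δ O X = stableOp T.defn.toRules (restrictVoc O) (Atom.dom ⁻¹' X) :=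
  Set.ext fun b => h.stable_iff O X b

/-- The argument of the stable operator is read at negative occurrences only, and these are domain
atoms. -/
theorem stableOp_eq (h : Refines T Δ) {X X' : Set (Atom D ar)}
    (hX : (Atom.dom ⁻¹' X : Set (DomAtom D ar)) = Atom.dom ⁻¹' X') :
    stableOp Δ O X = stableOp Δ O X' := by
  refine stableOp_congr fun a φ ha l hl => ⟨fun _ => Iff.rfl, fun _ hs => ?_⟩
  obtain ⟨b, hb⟩ := h.neg_dom a φ ha l hl hs
  rw [hb]
  exact Set.ext_iff.1 hX b

theorem preimage_wfTrue (h : Refines T Δ) :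
    Atom.dom ⁻¹' wfTrue Δ O = wfTrue T.defn.toRules (restrictVoc O) := by
  apply subset_antisymm
  · set W := wfTrue T.defn.toRules (restrictVoc O) with hW
    have hpre : (Atom.dom ⁻¹' (Atom.dom '' W : Set (Atom D ar)) : Set (DomAtom D ar)) = W :=
      Set.preimage_image_eq _ fun _ _ h => Atom.dom.inj h
    -- The image of `W` contains no Tseitin symbols and need not be a prefixpoint. Applying the
    -- square once adds the right ones and keeps the domain part, so the result is a fixpoint.
    set Y := stableOp Δ O (stableOp Δ O (Atom.dom '' W)) with hY
    have hYW : Atom.dom ⁻¹' Y = W := by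
      rw [hY, h.preimage_stableOp, h.preimage_stableOp, hpre, hW, stableOp_stableOp_wfTrue]
    have : wfTrue Δ O ⊆ Y := by
      refine wfTrue_le ?_
      rw [h.stableOp_eq (hYW.trans hpre.symm)]
    exact fun b hb => hYW ▸ this hb
  · refine wfTrue_le ?_
    rw [← h.preimage_stableOp, ← h.preimage_stableOp, stableOp_stableOp_wfTrue]

theorem restrictVoc_wf (h : Refines T Δ) :
    restrictVoc (wf Δ O) = wf T.defn.toRules (restrictVoc O) := by
  ext ⟨b, s⟩
  rw [mem_restrictVoc]
  by_cases ho : b ∈ openAtoms T.defn.toRules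
  · rw [mem_wf_of_open ((h.open_iff b).2 ho), mem_wf_of_open (l := ⟨b, s⟩) ho, mem_restrictVoc]
  · have hd : Atom.dom b ∈ definedAtoms Δ := fun h' => ho ((h.open_iff b).1 h')
    cases s
    · rw [neg_mem_wf ho, neg_mem_wf hd, h.stable_iff, h.preimage_wfTrue]
    · rw [pos_mem_wf ho, pos_mem_wf hd, ← h.preimage_wfTrue]; rfl

/-- The two bounds agree on domain atoms by totality of the original definition. Since the stable
operator looks only at those, one more application makes them agree on Tseitin symbols too. -/
theorem twoValued_wf (h : Refines T Δ) (hT : Total T.defn.toRules)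
    (hO : TwoValuedOn O (openAtoms Δ)) : TwoValued (wf Δ O) := by
  have h2 : TwoValued (wf T.defn.toRules (restrictVoc O)) := by
    rw [← wf_restrict]
    refine hT _ ⟨fun b hb => ?_, fun l hl => hl.2⟩
    have := hO (.dom b) ((h.open_iff b).2 hb)
    simpa [restrict, hb, mem_restrictVoc] using this
  have h3 := stableOp_wfTrue_of_twoValued h2
  rw [← h.preimage_wfTrue, ← h.preimage_stableOp] at h3
  refine LazyMX.twoValued_wf hO ?_
  conv_rhs => rw [← stableOp_stableOp_wfTrue]
  exact (h.stableOp_eq h3).symm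

end Refines

end Instances

/-! ### Grounding steps -/

section Grounding

variable {D : Type u} {V : Type v} {ar : V → ℕ} {I K : Struc (Atom D ar)} {h : Atom D ar}
  {φ g ψ : DFormula D (Atom D ar)} {new : Pos D → Option (DFormula D (Atom D ar))}

theorem Atom.tse_ne (h : Atom D ar) (p : Pos D) : Atom.tse h p ≠ h := by
  intro e
  have := congrArg sizeOf e
  simp at this
  omega

theorem Part.holds {p : Pos D} {o : Option (DFormula D (Atom D ar))} (hp : Part h p ψ g o)
    (hK : ∀ ψ, o = some ψ → ψ.Holds K → ⟨.tse h p, true⟩ ∈ K) (hψ : ψ.Holds K) : g.Holds K := by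
  cases hp with
  | keep _ => exact hψ
  | tseitin => exact hK _ rfl hψ

theorem Part.holds_of {p : Pos D} {o : Option (DFormula D (Atom D ar))} (hp : Part h p ψ g o)
    (hK : ∀ ψ, o = some ψ → ⟨.tse h p, true⟩ ∈ K → ψ.Holds K) (hg : g.Holds K) : ψ.Holds K := by
  cases hp with
  | keep _ => exact hg
  | tseitin => exact hK _ rfl hg

theorem Part.lits {p : Pos D} {o : Option (DFormula D (Atom D ar))} (hp : Part h p ψ g o)
    {l : Lit (Atom D ar)} (hl : l ∈ g.lits) : l ∈ ψ.lits ∨ ∃ p, l = ⟨.tse h p, true⟩ := by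
  cases hp with
  | keep _ => exact Or.inl hl
  | tseitin => exact Or.inr ⟨p, hl⟩

theorem Part.eq_of_some {p : Pos D} {o : Option (DFormula D (Atom D ar))} (hp : Part h p ψ g o)
    {ψ' : DFormula D (Atom D ar)} (ho : o = some ψ') : ψ' = ψ := by
  cases hp with
  | keep _ => cases ho
  | tseitin => cases ho; rfl

theorem OneStep.lits_new (hs : OneStep I h φ g new) {p : Pos D} (hp : new p = some ψ) :
    ψ.lits ⊆ φ.lits := by
  intro l hl
  cases hs with
  | lit => cases hp
  | conj n f | disj n f =>
    cases p with
    | sub i =>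
      simp only [Option.dite_none_right_eq_some, Option.some.injEq] at hp
      obtain ⟨hi, rfl⟩ := hp
      exact ⟨_, hl⟩
    | elem _ => cases hp
    | rest => cases hp
  | all S f | ex S f =>
    cases p with
    | elem d =>
      simp only [Option.ite_none_right_eq_some, Option.some.injEq] at hp
      obtain ⟨hi, rfl⟩ := hp
      exact ⟨_, hi, hl⟩
    | sub _ => cases hp
    | rest => cases hp
  | disjTrue n f i g o _ hpart | conjFalse n f i g o _ hpart =>
    cases p with
    | sub j =>
      simp only [Option.ite_none_right_eq_some] at hp
      obtain rfl := hpart.eq_of_some hp.2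
      exact ⟨_, hl⟩
    | elem _ => cases hp
    | rest =>
      cases hp
      obtain ⟨j, hj⟩ := hl
      exact ⟨_, hj⟩
  | exTrue S f d g o _ hd hpart | allFalse S f d g o _ hd hpart =>
    cases p with
    | elem j =>
      simp only [Option.ite_none_right_eq_some] at hp
      obtain rfl := hpart.eq_of_some hp.2
      exact ⟨_, hd, hl⟩
    | sub _ => cases hp
    | rest =>
      cases hp
      obtain ⟨j, hj, hl⟩ := hl
      exact ⟨_, hj.1, hl⟩

theorem OneStep.lits_ground (hs : OneStep I h φ g new) {l : Lit (Atom D ar)} (hl : l ∈ g.lits) :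
    l ∈ φ.lits ∨ ∃ p, l = ⟨.tse h p, true⟩ := by
  cases hs with
  | lit => exact Or.inl hl
  | conj n f | disj n f => obtain ⟨i, hl⟩ := hl; exact Or.inr ⟨_, hl⟩
  | all S f | ex S f => obtain ⟨i, _, hl⟩ := hl; exact Or.inr ⟨_, hl⟩
  | disjTrue n f i g o _ hpart | conjFalse n f i g o _ hpart =>
    obtain ⟨j, hl⟩ := hl
    match j with
    | 0 => exact (hpart.lits hl).imp_left fun h => ⟨_, h⟩
    | 1 => exact Or.inr ⟨_, hl⟩
  | exTrue S f d g o _ hd hpart | allFalse S f d g o _ hd hpart =>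
    obtain ⟨j, hl⟩ := hl
    match j with
    | 0 => exact (hpart.lits hl).imp_left fun h => ⟨_, hd, h⟩
    | 1 => exact Or.inr ⟨_, hl⟩

/-- Only one direction of the equivalence between a Tseitin symbol and its body is needed here, and
only the other one in `OneStep.holds_of_ground`; each matches one inclusion between least fixpoints.
In the split cases the remaining disjuncts or conjuncts are those reached by `succAbove`, or the
elements other than `d`. -/
theorem OneStep.holds_ground (hs : OneStep I h φ g new)
    (hK : ∀ p ψ, new p = some ψ → ψ.Holds K → ⟨.tse h p, true⟩ ∈ K) (hφ : φ.Holds K) :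
    g.Holds K := by
  cases hs with
  | lit => exact hφ
  | conj n f => exact fun i => hK (.sub i) (f i) (by simp) (hφ i)
  | disj n f =>
    obtain ⟨i, hi⟩ := hφ
    exact ⟨i, hK (.sub i) (f i) (by simp) hi⟩
  | all S f => exact fun d hd => hK (.elem d) (f d) (by simp [hd]) (hφ d hd)
  | ex S f =>
    obtain ⟨d, hd, hi⟩ := hφ
    exact ⟨d, hd, hK (.elem d) (f d) (by simp [hd]) hi⟩
  | disjTrue n f i g o _ hpart =>
    obtain ⟨j, hj⟩ := hφ
    by_cases hij : j = i
    · subst hij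
      exact ⟨0, hpart.holds (fun ψ ho => hK (.sub j) ψ (by simp [ho])) hj⟩
    · obtain ⟨k, rfl⟩ := Fin.exists_succAbove_eq hij
      exact ⟨1, hK .rest _ rfl ⟨k, hj⟩⟩
  | conjFalse n f i g o _ hpart =>
    intro j
    match j with
    | 0 => exact hpart.holds (fun ψ ho => hK (.sub i) ψ (by simp [ho])) (hφ i)
    | 1 => exact hK .rest _ rfl fun k => hφ _
  | exTrue S f d g o _ hd hpart =>
    obtain ⟨c, hc, hj⟩ := hφ
    by_cases hij : c = d
    · subst hij
      exact ⟨0, hpart.holds (fun ψ ho => hK (.elem c) ψ (by simp [ho])) hj⟩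
    · exact ⟨1, hK .rest _ rfl ⟨c, ⟨hc, hij⟩, hj⟩⟩
  | allFalse S f d g o _ hd hpart =>
    intro j
    match j with
    | 0 => exact hpart.holds (fun ψ ho => hK (.elem d) ψ (by simp [ho])) (hφ d hd)
    | 1 => exact hK .rest _ rfl fun k hk => hφ _ hk.1

theorem OneStep.holds_of_ground (hs : OneStep I h φ g new)
    (hK : ∀ p ψ, new p = some ψ → ⟨.tse h p, true⟩ ∈ K → ψ.Holds K) (hg : g.Holds K) :
    φ.Holds K := by
  cases hs with
  | lit => exact hg
  | conj n f => exact fun i => hK (.sub i) (f i) (by simp) (hg i)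
  | disj n f =>
    obtain ⟨i, hi⟩ := hg
    exact ⟨i, hK (.sub i) (f i) (by simp) hi⟩
  | all S f => exact fun d hd => hK (.elem d) (f d) (by simp [hd]) (hg d hd)
  | ex S f =>
    obtain ⟨d, hd, hi⟩ := hg
    exact ⟨d, hd, hK (.elem d) (f d) (by simp [hd]) hi⟩
  | disjTrue n f i g o _ hpart =>
    obtain ⟨j, hj⟩ := hg
    match j with
    | 0 => exact ⟨i, hpart.holds_of (fun ψ ho => hK (.sub i) ψ (by simp [ho])) hj⟩
    | 1 => obtain ⟨k, hk⟩ := hK .rest _ rfl hj; exact ⟨_, hk⟩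
  | conjFalse n f i g o _ hpart =>
    intro j
    by_cases hij : j = i
    · subst hij
      exact hpart.holds_of (fun ψ ho => hK (.sub j) ψ (by simp [ho])) (hg 0)
    · obtain ⟨k, rfl⟩ := Fin.exists_succAbove_eq hij
      exact hK .rest _ rfl (hg 1) k
  | exTrue S f d g o _ hd hpart =>
    obtain ⟨j, hj⟩ := hg
    match j with
    | 0 => exact ⟨d, hd, hpart.holds_of (fun ψ ho => hK (.elem d) ψ (by simp [ho])) hj⟩
    | 1 => obtain ⟨k, hk, hk'⟩ := hK .rest _ rfl hj; exact ⟨_, hk.1, hk'⟩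
  | allFalse S f d g o _ hd hpart =>
    intro c hc
    by_cases hij : c = d
    · subst hij
      exact hpart.holds_of (fun ψ ho => hK (.elem c) ψ (by simp [ho])) (hg 0)
    · exact hK .rest _ rfl (hg 1) c ⟨hc, hij⟩

/-- Each formula has a naive grounding step. -/
theorem OneStep.exists_step (I : Struc (Atom D ar)) (h : Atom D ar) (φ : DFormula D (Atom D ar)) :
    ∃ g new, OneStep I h φ g new := by
  cases φ with
  | lit l => exact ⟨_, _, .lit l⟩
  | conj n f => exact ⟨_, _, .conj n f⟩
  | disj n f => exact ⟨_, _, .disj n f⟩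
  | all S f => exact ⟨_, _, .all S f⟩
  | ex S f => exact ⟨_, _, .ex S f⟩

open Classical in
/-- The definition in which the rule instance of `h` is replaced by `h ← g` and the rules `new` for
its Tseitin symbols. -/
noncomputable def splitRules (Δ : Rules D (Atom D ar)) (h : Atom D ar) (g : DFormula D (Atom D ar))
    (new : Pos D → Option (DFormula D (Atom D ar))) : Rules D (Atom D ar) := fun a =>
  if a = h then some g else
    match a with
    | .dom b => Δ (.dom b)
    | .tse h' p => if h' = h then new p else Δ (.tse h' p)

variable {Δ : Rules D (Atom D ar)}

@[simp] theorem splitRules_self : splitRules Δ h g new h = some g := by simp [splitRules]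

@[simp] theorem splitRules_tse (p : Pos D) : splitRules Δ h g new (.tse h p) = new p := by
  simp [splitRules, Atom.tse_ne]

theorem splitRules_other {a : Atom D ar} (ha : a ≠ h) (ht : ∀ p, a ≠ .tse h p) :
    splitRules Δ h g new a = Δ a := by
  cases a with
  | dom b => simp [splitRules, ha]
  | tse h' p =>
    have : h' ≠ h := fun e => ht p (e ▸ rfl)
    simp [splitRules, ha, this]

/-- The symbols `tse h p` are new, so old bodies cannot distinguish evaluations that differ only on
them. Unfolding their rules turns the ground body back into the old body, and the two least closed
sets agree away from the new symbols. -/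
theorem Refines.splitRules {T : Theory D ar} (hr : Refines T Δ) (hh : Δ h = some φ)
    (hs : OneStep I h φ g new) (hnew : ∀ p, Δ (.tse h p) = none)
    (hocc : ∀ a ψ, Δ a = some ψ → ∀ l ∈ ψ.lits, ∀ p, l.atom ≠ .tse h p) :
    Refines T (splitRules Δ h g new) := by
  set Δ' := LazyMX.splitRules Δ h g new with hΔ'
  have hopen : ∀ a, (∀ p, a ≠ .tse h p) → (a ∈ openAtoms Δ' ↔ a ∈ openAtoms Δ) := by
    intro a ha
    by_cases hah : a = h
    · subst hah
      simp [mem_openAtoms, hΔ', hh]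
    · rw [mem_openAtoms, hΔ', splitRules_other hah ha, mem_openAtoms]
  have hmixed : ∀ (O : Struc (Atom D ar)) Y Y' X, (∀ a, (∀ p, a ≠ .tse h p) → (a ∈ Y ↔ a ∈ Y')) →
      ∀ l : Lit (Atom D ar), (∀ p, l.atom ≠ .tse h p) →
      (l ∈ mixed Δ' O Y X ↔ l ∈ mixed Δ O Y' X) := by
    rintro O Y Y' X hY ⟨a, b⟩ hl
    by_cases ha : a ∈ openAtoms Δ
    · rw [mem_mixed_of_open (l := ⟨a, b⟩) ((hopen a hl).2 ha), mem_mixed_of_open (l := ⟨a, b⟩) ha]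
    · rw [mem_mixed_of_defined ha, mem_mixed_of_defined fun h => ha ((hopen a hl).1 h), hY a hl]
  have hold : ∀ (O : Struc (Atom D ar)) X a, (∀ p, a ≠ .tse h p) →
      (a ∈ stableOp Δ' O X ↔ a ∈ stableOp Δ O X) := by
    intro O X a ha
    constructor
    · suffices stableOp Δ' O X ⊆ stableOp Δ O X ∪ {a | ∃ p ψ, a = .tse h p ∧ new p = some ψ ∧
          ψ.Holds (mixed Δ O (stableOp Δ O X) X)} by
        intro h'
        rcases this h' with h' | ⟨p, -, h', -⟩
        exacts [h', absurd h' (ha p)]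
      -- A candidate closed set for the new rules: the old least set together with exactly those new
      -- symbols whose bodies hold in it.
      set Y := stableOp Δ O X ∪ {a | ∃ p ψ, a = .tse h p ∧ new p = some ψ ∧
          ψ.Holds (mixed Δ O (stableOp Δ O X) X)} with hY
      have hYS : ∀ a, (∀ p, a ≠ .tse h p) → (a ∈ Y ↔ a ∈ stableOp Δ O X) := by
        intro a ha
        refine ⟨fun h' => ?_, Or.inl⟩
        rcases h' with h' | ⟨p, -, h', -⟩
        exacts [h', absurd h' (ha p)]
      have hm := hmixed O Y (stableOp Δ O X) X hYS
      refine stableOp_le fun a χ haχ hχ => ?_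
      by_cases hah : a = h
      · subst hah
        simp only [hΔ', splitRules_self, Option.some.injEq] at haχ
        subst haχ
        left
        refine stableOp_closed hh ?_
        have : φ.Holds (mixed Δ' O Y X) := by
          refine hs.holds_of_ground (fun p ψ hp hK => ?_) hχ
          have hd : Atom.tse a p ∈ definedAtoms Δ' :=
            mem_definedAtoms.2 ⟨ψ, by simp [hΔ', hp]⟩
          rw [mem_mixed_of_defined hd] at hK
          rcases hK with hK | ⟨p', ψ', he, hp', hK⟩
          · exact absurd (hnew p) (stableOp_subset_defined hK)
          · obtain rfl := (Atom.tse.inj he).2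
            rw [hp'] at hp
            obtain rfl := Option.some.inj hp
            exact hK.imp fun l hl h' =>
              (hm l (fun p => hocc a φ hh l (hs.lits_new hp' hl) p)).2 h'
        exact this.imp fun l hl h' => (hm l (hocc a φ hh l hl)).1 h'
      · by_cases hat : ∃ p, a = .tse h p
        · obtain ⟨p, rfl⟩ := hat
          simp only [hΔ', splitRules_tse] at haχ
          exact Or.inr ⟨p, χ, rfl, haχ, hχ.imp fun l hl h' =>
            (hm l (fun p => hocc h φ hh l (hs.lits_new haχ hl) p)).1 h'⟩
        · push Not at hat
          rw [hΔ', splitRules_other hah hat] at haχ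
          exact Or.inl (stableOp_closed haχ (hχ.imp fun l hl h' =>
            (hm l (hocc a χ haχ l hl)).1 h'))
    -- Conversely, the new least set is closed under the old rules: when the old body of `h` holds,
    -- the symbols of its true parts are derived first and the ground rule then gives `h`.
    · suffices stableOp Δ O X ⊆ stableOp Δ' O X from fun h' => this h'
      have hm := hmixed O (stableOp Δ' O X) (stableOp Δ' O X) X fun _ _ => Iff.rfl
      refine stableOp_le fun a χ haχ hχ => ?_
      have hχ' : χ.Holds (mixed Δ' O (stableOp Δ' O X) X) :=
        hχ.imp fun l hl h' => (hm l (hocc a χ haχ l hl)).2 h'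
      by_cases hah : a = h
      · subst hah
        rw [haχ] at hh
        obtain rfl := Option.some.inj hh
        refine stableOp_closed (by simp [hΔ']) (hs.holds_ground (fun p ψ hp hψ => ?_) hχ')
        have hd : Δ' (.tse a p) = some ψ := by simp [hΔ', hp]
        rw [mem_mixed_of_defined (mem_definedAtoms.2 ⟨ψ, hd⟩)]
        exact stableOp_closed hd hψ
      · have hat : ∀ p, a ≠ .tse h p := by
          rintro p rfl
          simp [hnew] at haχ
        exact stableOp_closed (by rw [hΔ', splitRules_other hah hat, haχ]) hχ'
  refine ⟨fun a χ haχ l hl hsgn => ?_, fun b => ?_, fun O X b => ?_⟩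
  · by_cases hah : a = h
    · subst hah
      simp only [hΔ', splitRules_self, Option.some.injEq] at haχ
      subst haχ
      rcases hs.lits_ground hl with h' | ⟨p, rfl⟩
      · exact hr.neg_dom a φ hh l h' hsgn
      · cases hsgn
    · by_cases hat : ∃ p, a = .tse h p
      · obtain ⟨p, rfl⟩ := hat
        simp only [hΔ', splitRules_tse] at haχ
        exact hr.neg_dom h φ hh l (hs.lits_new haχ hl) hsgn
      · push Not at hat
        rw [hΔ', splitRules_other hah hat] at haχ
        exact hr.neg_dom a χ haχ l hl hsgn
  · rw [← hr.open_iff, hopen _ fun p => by simp]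
  · rw [← hr.stable_iff, hold _ _ _ fun p => by simp]

end Grounding

/-! ### Invariants of the algorithm and their preservation -/

section Invariants

variable {D : Type u} {V : Type v} {ar : V → ℕ}

/-! ### Collected literals -/

theorem Collects.holds {φ : DFormula D (Atom D ar)} {S : Set (Lit (Atom D ar))}
    (h : Collects φ S) : φ.Holds S := by
  induction h with
  | lit l => exact rfl
  | conj n f S _ ih => exact fun i => (ih i).mono (Set.subset_iUnion S i)
  | disj n f i S _ ih => exact ⟨i, ih⟩
  | all X f S _ ih =>
    exact fun d hd => (ih d hd).mono (Set.subset_biUnion_of_mem (u := S) hd)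
  | ex X f d S hd _ ih => exact ⟨d, hd, ih⟩
  | exLarge X f S hX _ ih =>
    obtain ⟨d, hd⟩ := hX
    exact ⟨d, hd, (ih d hd).mono (Set.subset_biUnion_of_mem (u := S) hd)⟩

theorem Collects.subset_lits {φ : DFormula D (Atom D ar)} {S : Set (Lit (Atom D ar))}
    (h : Collects φ S) : S ⊆ φ.lits := by
  induction h with
  | lit l => exact subset_rfl
  | conj n f S _ ih => exact Set.iUnion_subset fun i l hl => ⟨i, ih i hl⟩
  | disj n f i S _ ih => exact fun l hl => ⟨i, ih hl⟩
  | all X f S _ ih => exact Set.iUnion₂_subset fun d hd l hl => ⟨d, hd, ih d hd hl⟩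
  | ex X f d S hd _ ih => exact fun l hl => ⟨d, hd, ih hl⟩
  | exLarge X f S hX _ ih => exact Set.iUnion₂_subset fun d hd l hl => ⟨d, hd, ih d hd hl⟩

theorem atom_mem_of_mem_lits_goalFormula {l m : Lit (Atom D ar)} {φ : DFormula D (Atom D ar)}
    (h : m ∈ (goalFormula l φ).lits) : ∃ m' ∈ φ.lits, m'.atom = m.atom := by
  unfold goalFormula at h
  split_ifs at h
  · exact ⟨m, h, rfl⟩
  · rw [DFormula.lits_neg] at h
    exact ⟨_, h, rfl⟩

/-! ### Invariants of the rules -/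

/-- The invariants of the ground and the delayed rules. -/
structure RulesInv (T : Theory D ar) (s : State D ar) : Prop where
  refines : Refines T s.Dgd
  disjoint : ∀ a, s.Dg a ≠ none → s.Dd a = none
  delayed_dom : ∀ a φ, s.Dd a = some φ → ∀ l ∈ φ.lits, ∃ b, l.atom = .dom b
  ground_occ : ∀ a φ, s.Dg a = some φ → ∀ l ∈ φ.lits,
    (∃ b, l.atom = .dom b) ∨ ∃ p, l.atom = .tse a p
  tse_defined : ∀ h p, s.Dgd (.tse h p) ≠ none → s.Dg h ≠ none

theorem State.Dgd_of_ground {s : State D ar} {a : Atom D ar} {φ : DFormula D (Atom D ar)}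
    (h : s.Dg a = some φ) : s.Dgd a = some φ := by simp [State.Dgd, h]

theorem RulesInv.Dgd_of_delayed {T : Theory D ar} {s : State D ar} (hs : RulesInv T s)
    {a : Atom D ar} {φ : DFormula D (Atom D ar)} (h : s.Dd a = some φ) : s.Dgd a = some φ := by
  have : s.Dg a = none := by
    by_contra h'
    rw [hs.disjoint a h'] at h
    cases h
  simp [State.Dgd, this, h]

theorem State.Dgd_eq_none {s : State D ar} {a : Atom D ar} :
    s.Dgd a = none ↔ s.Dg a = none ∧ s.Dd a = none := by simp [State.Dgd]

theorem State.Dgd_eq_some {s : State D ar} {a : Atom D ar} {φ : DFormula D (Atom D ar)}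
    (h : s.Dgd a = some φ) : s.Dg a = some φ ∨ s.Dd a = some φ := by
  simp only [State.Dgd, Option.or_eq_some_iff] at h
  exact h.imp_right And.right

open Classical in
/-- The state after splitting off and grounding the rule instance of `h`. -/
noncomputable def State.split (s : State D ar) (h : Atom D ar) (g : DFormula D (Atom D ar))
    (new : Pos D → Option (DFormula D (Atom D ar))) (J' : JGraph D ar)
    (q' : List (Lit (Atom D ar))) : State D ar :=
  { s with
    Dg := Function.update s.Dg h (some g)
    Dd := fun a => if a = h then none else
      match a with
      | .dom b => s.Dd (.dom b)
      | .tse h' p => if h' = h then new p else s.Dd (.tse h' p)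
    J := J'
    queue := q' }

section Split

variable {s : State D ar} {h : Atom D ar} {g : DFormula D (Atom D ar)}
  {new : Pos D → Option (DFormula D (Atom D ar))} {J' : JGraph D ar} {q' : List (Lit (Atom D ar))}

@[simp] theorem State.split_Dg_self : (s.split h g new J' q').Dg h = some g := by
  simp [State.split]

theorem State.split_Dg_of_ne {a : Atom D ar} (ha : a ≠ h) :
    (s.split h g new J' q').Dg a = s.Dg a := by simp [State.split, ha]

@[simp] theorem State.split_Dd_self : (s.split h g new J' q').Dd h = none := by
  simp [State.split]

@[simp] theorem State.split_Dd_tse (p : Pos D) :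
    (s.split h g new J' q').Dd (.tse h p) = new p := by
  simp [State.split, Atom.tse_ne]

theorem State.split_Dd_other {a : Atom D ar} (ha : a ≠ h) (ht : ∀ p, a ≠ .tse h p) :
    (s.split h g new J' q').Dd a = s.Dd a := by
  cases a with
  | dom b => simp [State.split, ha]
  | tse h' p =>
    have : h' ≠ h := fun e => ht p (e ▸ rfl)
    simp [State.split, ha, this]

/-- A Tseitin symbol gets a rule only when its head is grounded, and a grounded head is no longer
delayed. This is the freshness needed for splitting. -/
theorem RulesInv.delayed_tse {T : Theory D ar} (hs : RulesInv T s)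
    {φ : DFormula D (Atom D ar)} (hh : s.Dd h = some φ) (p : Pos D) :
    s.Dgd (.tse h p) = none := by
  by_contra h'
  rw [hs.disjoint h (hs.tse_defined h p h')] at hh
  cases hh

theorem RulesInv.Dgd_split {T : Theory D ar} (hs : RulesInv T s)
    {φ : DFormula D (Atom D ar)} (hh : s.Dd h = some φ) :
    (s.split h g new J' q').Dgd = splitRules s.Dgd h g new := by
  funext a
  by_cases ha : a = h
  · subst ha; simp [State.Dgd]
  · by_cases ht : ∃ p, a = .tse h p
    · obtain ⟨p, rfl⟩ := ht
      have := (State.Dgd_eq_none.1 (hs.delayed_tse hh p)).1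
      simp [State.Dgd, State.split_Dg_of_ne ha, this]
    · push Not at ht
      rw [splitRules_other ha ht]
      simp [State.Dgd, State.split_Dg_of_ne ha, State.split_Dd_other ha ht]

theorem RulesInv.split {T : Theory D ar} (hs : RulesInv T s)
    {φ : DFormula D (Atom D ar)} (hh : s.Dd h = some φ) {I : Struc (Atom D ar)}
    (hstep : OneStep I h φ g new) : RulesInv T (s.split h g new J' q') where
  refines := by
    rw [hs.Dgd_split hh]
    refine hs.refines.splitRules (hs.Dgd_of_delayed hh) hstep (hs.delayed_tse hh) ?_
    rintro a ψ ha l hl p e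
    rcases State.Dgd_eq_some ha with h' | h'
    · rcases hs.ground_occ a ψ h' l hl with ⟨b, hb⟩ | ⟨p', hp⟩
      · rw [e] at hb; cases hb
      · rw [e] at hp
        obtain rfl := (Atom.tse.inj hp).1
        rw [hs.disjoint h (by simp [h'])] at hh
        cases hh
    · obtain ⟨b, hb⟩ := hs.delayed_dom a ψ h' l hl
      rw [e] at hb; cases hb
  disjoint a ha := by
    by_cases hah : a = h
    · subst hah; simp
    · rw [State.split_Dg_of_ne hah] at ha
      by_cases ht : ∃ p, a = .tse h p
      · obtain ⟨p, rfl⟩ := ht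
        exact absurd (State.Dgd_eq_none.1 (hs.delayed_tse hh p)).1 ha
      · push Not at ht
        rw [State.split_Dd_other hah ht]
        exact hs.disjoint a ha
  delayed_dom a ψ ha := by
    by_cases hah : a = h
    · subst hah; simp at ha
    · by_cases ht : ∃ p, a = .tse h p
      · obtain ⟨p, rfl⟩ := ht
        rw [State.split_Dd_tse] at ha
        exact fun l hl => hs.delayed_dom h φ hh l (hstep.lits_new ha hl)
      · push Not at ht
        rw [State.split_Dd_other hah ht] at ha
        exact hs.delayed_dom a ψ ha
  ground_occ a ψ ha l hl := by
    by_cases hah : a = h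
    · subst hah
      rw [State.split_Dg_self] at ha
      obtain rfl := Option.some.inj ha
      rcases hstep.lits_ground hl with h' | ⟨p, rfl⟩
      · exact Or.inl (hs.delayed_dom a φ hh l h')
      · exact Or.inr ⟨p, rfl⟩
    · rw [State.split_Dg_of_ne hah] at ha
      exact hs.ground_occ a ψ ha l hl
  tse_defined a p ha := by
    by_cases hah : a = h
    · subst hah; simp
    · rw [State.split_Dg_of_ne hah]
      rw [hs.Dgd_split hh] at ha
      by_cases h2 : Atom.tse a p = h
      · refine hs.tse_defined a p ?_
        rw [h2, hs.Dgd_of_delayed hh]; simp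
      · rw [splitRules_other h2 (by simp [hah])] at ha
        exact hs.tse_defined a p ha

end Split

/-! ### Invariants of the justification -/

open Classical in
/-- The justification: the direct justifications of the literals that are not on the queue. -/
noncomputable def offQueue (J : JGraph D ar) (q : List (Lit (Atom D ar))) : JGraph D ar :=
  fun m => if m ∈ q then none else J m

theorem offQueue_eq_some {J : JGraph D ar} {q : List (Lit (Atom D ar))} {m : Lit (Atom D ar)}
    {S : Set (Lit (Atom D ar))} : offQueue J q m = some S ↔ m ∉ q ∧ J m = some S := by
  simp [offQueue]

/-- `K` is a subgraph of `K'`. -/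
def JGraph.Le (K K' : JGraph D ar) : Prop := ∀ m S, K m = some S → K' m = some S

theorem JGraph.NoUnfounded.mono {K K' : JGraph D ar} (h : K'.NoUnfounded) (hle : K.Le K') :
    K.NoUnfounded := fun p hp => h p fun n => by
  obtain ⟨S, h1, h2⟩ := hp n
  exact ⟨S, hle _ _ h1, h2⟩

theorem JGraph.mem_nodes {K : JGraph D ar} {m : Lit (Atom D ar)} :
    m ∈ K.nodes ↔ (∃ S, K m = some S) ∨ ∃ n S, K n = some S ∧ m ∈ S := by
  simp [JGraph.nodes, Option.ne_none_iff_exists']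

theorem JGraph.nodes_mono {K K' : JGraph D ar} (hle : K.Le K') : K.nodes ⊆ K'.nodes := by
  intro m hm
  rw [JGraph.mem_nodes] at hm ⊢
  exact hm.imp (fun ⟨S, h⟩ => ⟨S, hle _ _ h⟩) fun ⟨n, S, h, h'⟩ => ⟨n, S, hle _ _ h, h'⟩

/-- The invariants of the justification. -/
structure JustInv (Dg Dd : Rules D (Atom D ar)) (J : JGraph D ar) (I : Struc (Atom D ar))
    (q : List (Lit (Atom D ar))) : Prop where
  finite : {l | J l ≠ none}.Finite
  collects : ∀ l S, J l = some S → ∃ φ, Dd l.atom = some φ ∧ Collects (goalFormula l φ) S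
  noUnfounded : (offQueue J q).NoUnfounded
  consistent : Consistent (offQueue J q).nodes
  not_false : ∀ m ∈ (offQueue J q).nodes, m.neg ∉ I
  not_ground : ∀ n S, offQueue J q n = some S → ∀ m ∈ S, Dg m.atom = none
  covered : ∀ n S, offQueue J q n = some S → ∀ m ∈ S, Dd m.atom ≠ none → J m ≠ none ∨ m ∈ q
  needs : ∀ l ∈ I, Dd l.atom ≠ none → J l ≠ none ∨ l ∈ q

variable {Dg Dd : Rules D (Atom D ar)} {J : JGraph D ar} {I I' : Struc (Atom D ar)}
    {q q' : List (Lit (Atom D ar))}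

/-- For backjumping: the justification is kept, and the two conditions that mention the structure
only get weaker when it shrinks. -/
theorem JustInv.anti (h : JustInv Dg Dd J I q) (hI : I' ⊆ I) : JustInv Dg Dd J I' q :=
  { h with
    not_false := fun m hm hn => h.not_false m hm (hI hn)
    needs := fun l hl => h.needs l (hI hl) }

theorem offQueue_le (hq : ∀ m ∈ q, m ∈ q') : (offQueue J q').Le (offQueue J q) := by
  intro m S hm
  rw [offQueue_eq_some] at hm ⊢
  exact ⟨fun h => hm.1 (hq m h), hm.2⟩

/-- A new true literal can break the invariants in two ways, and each is repaired by the queue: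
literals whose justification now conflicts are enqueued and thus leave the active graph, and the
literal itself is enqueued if it lacks a justification. -/
theorem CheckLiteral.justInv {s : State D ar} {l : Lit (Atom D ar)} (hc : CheckLiteral s l q q')
    (h : JustInv s.Dg s.Dd s.J I q) : JustInv s.Dg s.Dd s.J (insert l I) q' := by
  obtain ⟨q₁, q₂, rfl, h1, -, h2⟩ := hc
  have hq : ∀ m ∈ q, m ∈ q ++ q₁ ++ q₂ := fun m hm => by simp [hm]
  have hle := offQueue_le (J := s.J) hq
  refine ⟨h.finite, h.collects, h.noUnfounded.mono hle, h.consistent.mono (JGraph.nodes_mono hle),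
    ?_, fun n S hn => h.not_ground n S (hle n S hn), fun n S hn m hm hd => ?_, fun m hm hd => ?_⟩
  · rintro m hm (hml | hmI)
    · have key : ∀ n S, offQueue s.J (q ++ q₁ ++ q₂) n = some S → ¬ (l.neg ∈ S ∨ n = l.neg) := by
        intro n S hn h3
        rw [offQueue_eq_some] at hn
        exact hn.1 (List.mem_append_right _ ((h2 n).2 ⟨S, hn.2, h3⟩))
      have hml' : m = l.neg := Lit.eq_neg_iff.2 hml.symm
      rcases JGraph.mem_nodes.1 hm with ⟨S, hS⟩ | ⟨n, S, hS, hmS⟩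
      · exact key m S hS (Or.inr hml')
      · exact key n S hS (Or.inl (hml' ▸ hmS))
    · exact h.not_false m (JGraph.nodes_mono hle hm) hmI
  · exact (h.covered n S (hle n S hn) m hm hd).imp_right (hq m)
  · rcases hm with rfl | hm
    · by_cases hJ : s.J m = none
      · right
        rcases h1 with ⟨-, rfl⟩ | ⟨h1, -⟩
        · simp
        · exact absurd ⟨hd, hJ⟩ h1
      · exact Or.inl hJ
    · exact (h.needs m hm hd).imp_right (hq m)

theorem extend_cons (I : Struc (Atom D ar)) (l : Lit (Atom D ar)) (L : List (Lit (Atom D ar))) :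
    extend I (l :: L) = extend (insert l I) L := by
  ext m
  simp only [extend, List.mem_cons, Set.mem_union, Set.mem_ofPred_eq, Set.mem_insert_iff]
  tauto

theorem extend_nil (I : Struc (Atom D ar)) : extend I [] = I := by
  ext m
  simp [extend]

theorem subset_extend (I : Struc (Atom D ar)) (L : List (Lit (Atom D ar))) : I ⊆ extend I L :=
  Set.subset_union_left

theorem CheckLiterals.justInv {s : State D ar} {L : List (Lit (Atom D ar))}
    (hc : CheckLiterals s L q q') (h : JustInv s.Dg s.Dd s.J I q) :
    JustInv s.Dg s.Dd s.J (extend I L) q' := by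
  induction hc generalizing I with
  | nil q => rwa [extend_nil]
  | cons l L q q' q'' hl _ ih =>
    rw [extend_cons]
    exact ih (hl.justInv h)

open Classical in
-- The hypothesis still counts `l` as queued, the conclusion does not: validity of `S` is exactly
-- what allows `l` to leave the queue. It serves both for a kept and for a newly built
-- justification.
theorem Valid.justInv {s : State D ar} {l : Lit (Atom D ar)} {S : Set (Lit (Atom D ar))}
    (hv : Valid s l S) (h : JustInv s.Dg s.Dd s.J s.I (l :: s.queue))
    (hS : ∃ φ, s.Dd l.atom = some φ ∧ Collects (goalFormula l φ) S) :
    JustInv s.Dg s.Dd (Function.update s.J l (some S)) s.I s.queue := by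
  obtain ⟨h1, h2, h3, h4, h5⟩ := hv
  have hle : (offQueue (Function.update s.J l (some S)) s.queue).Le (activeGraph s l S) := by
    intro m S' hm
    rw [offQueue_eq_some] at hm
    by_cases hml : m = l
    · subst hml; simpa [activeGraph] using hm.2
    · simpa [activeGraph, hml, hm.1] using hm.2
  have hcase : ∀ n S', offQueue (Function.update s.J l (some S)) s.queue n = some S' →
      (n = l ∧ S' = S) ∨ offQueue s.J (l :: s.queue) n = some S' := by
    intro n S' hn
    rw [offQueue_eq_some] at hn
    by_cases hnl : n = l
    · subst hnl; exact Or.inl ⟨rfl, by simpa using hn.2.symm⟩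
    · right
      rw [offQueue_eq_some]
      simpa [hnl, hn.1] using hn.2
  have hJ : ∀ m, s.J m ≠ none ∨ m ∈ l :: s.queue →
      Function.update s.J l (some S) m ≠ none ∨ m ∈ s.queue := by
    intro m hm
    by_cases hml : m = l
    · subst hml; simp
    · simpa [hml] using hm
  refine ⟨?_, ?_, h3.mono hle, h4.mono (JGraph.nodes_mono hle),
    fun m hm => h5 m (JGraph.nodes_mono hle hm), ?_, ?_, fun m hm hd => hJ m (h.needs m hm hd)⟩
  · refine (h.finite.insert l).subset fun m hm => ?_
    by_cases hml : m = l
    · exact Or.inl hml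
    · exact Or.inr (by simpa [hml] using hm)
  · intro m S' hm
    by_cases hml : m = l
    · subst hml
      obtain rfl : S = S' := by simpa using hm
      exact hS
    · exact h.collects m S' (by simpa [hml] using hm)
  · intro n S' hn
    rcases hcase n S' hn with ⟨rfl, rfl⟩ | hn
    · exact h1
    · exact h.not_ground n S' hn
  · intro n S' hn m hm hd
    rcases hcase n S' hn with ⟨rfl, rfl⟩ | hn
    · rcases h2 m hm hd with h6 | h6
      · refine hJ m ?_
        by_cases hmn : m = n
        · simp [hmn]
        · left
          intro h7
          apply h6
          simp [activeGraph, hmn, h7]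
      · exact Or.inr h6
    · exact hJ m (h.covered n S' hn m hm hd)

open Classical in
-- Removing edges cannot create a conflict or an unfounded path. The literals that relied on `l` are
-- requeued, and `l` itself owes no justification.
theorem JustInv.discard {l : Lit (Atom D ar)} {J' : JGraph D ar}
    (h : JustInv Dg Dd J I (l :: q)) (hJ' : J' = Function.update J l none)
    (hneed : ¬ (l ∈ I ∧ Dd l.atom ≠ none)) (hq : Requeue J' {l} q q') : JustInv Dg Dd J' I q' := by
  obtain ⟨q₁, rfl, -, hq⟩ := hq
  have hJle : J'.Le J := by
    intro m S hm
    by_cases hml : m = l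
    · subst hml; simp [hJ'] at hm
    · simpa [hJ', hml] using hm
  have hJne : ∀ m, m ≠ l → J' m = J m := fun m hm => by simp [hJ', hm]
  have hle : (offQueue J' (q ++ q₁)).Le (offQueue J (l :: q)) := by
    intro m S hm
    rw [offQueue_eq_some] at hm ⊢
    refine ⟨fun h' => ?_, hJle _ _ hm.2⟩
    rcases List.mem_cons.1 h' with rfl | h'
    · simp [hJ'] at hm
    · exact hm.1 (List.mem_append_left _ h')
  have hmem : ∀ m, m ≠ l → J m ≠ none ∨ m ∈ l :: q → J' m ≠ none ∨ m ∈ q ++ q₁ := by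
    intro m hml hm
    rw [hJne m hml]
    refine hm.imp_right fun h' => ?_
    rcases List.mem_cons.1 h' with rfl | h'
    exacts [absurd rfl hml, List.mem_append_left _ h']
  refine ⟨h.finite.subset fun m hm => ?_, fun m S hm => h.collects m S (hJle m S hm),
    h.noUnfounded.mono hle, h.consistent.mono (JGraph.nodes_mono hle),
    fun m hm => h.not_false m (JGraph.nodes_mono hle hm),
    fun n S hn => h.not_ground n S (hle n S hn), fun n S hn m hm hd => ?_, fun m hm hd => ?_⟩
  · obtain ⟨S, hS⟩ := Option.ne_none_iff_exists'.1 hm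
    simp [hJle m S hS]
  · refine hmem m ?_ (h.covered n S (hle n S hn) m hm hd)
    rintro rfl
    rw [offQueue_eq_some] at hn
    exact hn.1 (List.mem_append_right _ ((hq n).2 ⟨S, hn.2, m, rfl, hm⟩))
  · refine hmem m ?_ (h.needs m hm hd)
    rintro rfl
    exact hneed ⟨hm, hd⟩

open Classical in
theorem JustInv.split {T : Theory D ar} {s : State D ar} {l : Lit (Atom D ar)} {J' : JGraph D ar}
    {φ g : DFormula D (Atom D ar)} {new : Pos D → Option (DFormula D (Atom D ar))}
    (h : JustInv s.Dg s.Dd s.J s.I (l :: s.queue)) (hr : RulesInv T s)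
    (hI : ∀ m ∈ s.I, ∀ h p, m.atom = .tse h p → s.Dg h ≠ none)
    (hφ : s.Dd l.atom = some φ)
    (hJ' : J' = Function.update (Function.update s.J l none) l.neg none)
    (hq : Requeue J' {l, l.neg} s.queue q') :
    JustInv (s.split l.atom g new J' q').Dg (s.split l.atom g new J' q').Dd J' s.I q' := by
  obtain ⟨q₁, rfl, -, hq⟩ := hq
  have hJeq : ∀ m, m.atom ≠ l.atom → J' m = s.J m := by
    intro m hm
    have h1 : m ≠ l := fun e => hm (e ▸ rfl)
    have h2 : m ≠ l.neg := fun e => hm (e ▸ rfl)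
    simp [hJ', h1, h2]
  have hJnone : ∀ m, m.atom = l.atom → J' m = none := by
    intro m hm
    rcases Lit.eq_or_eq_neg hm with rfl | rfl
    · simp [hJ', Function.update_apply]
    · simp [hJ']
  have hJle : J'.Le s.J := by
    intro m S hm
    by_cases hml : m.atom = l.atom
    · rw [hJnone m hml] at hm; cases hm
    · rwa [← hJeq m hml]
  have hDgl : s.Dg l.atom = none := by
    by_contra h'
    rw [hr.disjoint _ h'] at hφ; cases hφ
  have hle : (offQueue J' (s.queue ++ q₁)).Le (offQueue s.J (l :: s.queue)) := by
    intro m S hm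
    rw [offQueue_eq_some] at hm ⊢
    refine ⟨fun h' => ?_, hJle _ _ hm.2⟩
    rcases List.mem_cons.1 h' with rfl | h'
    · rw [hJnone m rfl] at hm; cases hm.2
    · exact hm.1 (List.mem_append_left _ h')
  -- Every literal whose justification mentions the newly grounded atom is on the queue, so the
  -- active graph avoids atoms of ground rules.
  have hatom : ∀ n S, offQueue J' (s.queue ++ q₁) n = some S → ∀ m ∈ S, m.atom ≠ l.atom := by
    intro n S hn m hm e
    rw [offQueue_eq_some] at hn
    refine hn.1 (List.mem_append_right _ ((hq n).2 ⟨S, hn.2, m, ?_, hm⟩))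
    exact Lit.eq_or_eq_neg e
  have hDd : ∀ m : Lit (Atom D ar), m.atom ≠ l.atom → (∀ p, m.atom ≠ .tse l.atom p) →
      (s.split l.atom g new J' (s.queue ++ q₁)).Dd m.atom = s.Dd m.atom :=
    fun m h1 h2 => State.split_Dd_other h1 h2
  have hmem : ∀ m, m.atom ≠ l.atom → s.J m ≠ none ∨ m ∈ l :: s.queue →
      J' m ≠ none ∨ m ∈ s.queue ++ q₁ := by
    intro m hml hm
    rw [hJeq m hml]
    refine hm.imp_right fun h' => ?_
    rcases List.mem_cons.1 h' with rfl | h'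
    exacts [absurd rfl hml, List.mem_append_left _ h']
  refine ⟨h.finite.subset fun m hm => ?_, fun m S hm => ?_,
    h.noUnfounded.mono hle, h.consistent.mono (JGraph.nodes_mono hle),
    fun m hm => h.not_false m (JGraph.nodes_mono hle hm), fun n S hn m hm => ?_,
    fun n S hn m hm hd => ?_, fun m hm hd => ?_⟩
  · obtain ⟨S, hS⟩ := Option.ne_none_iff_exists'.1 hm
    simp [hJle m S hS]
  · obtain ⟨χ, h1, h2⟩ := h.collects m S (hJle m S hm)
    refine ⟨χ, ?_, h2⟩
    rw [hDd m (fun e => by rw [hJnone m e] at hm; cases hm), h1]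
    intro p e
    rw [e, (State.Dgd_eq_none.1 (hr.delayed_tse hφ p)).2] at h1
    cases h1
  · rw [State.split_Dg_of_ne (hatom n S hn m hm)]
    exact h.not_ground n S (hle n S hn) m hm
  · have h1 := hatom n S hn m hm
    -- Direct justifications are collected from delayed bodies, which contain domain atoms only;
    -- hence none mentions a newly delayed Tseitin symbol.
    have h2 : ∀ p, m.atom ≠ .tse l.atom p := by
      intro p e
      obtain ⟨χ, h3, h4⟩ := h.collects n S (offQueue_eq_some.1 (hle n S hn)).2
      obtain ⟨m', h5, h6⟩ := atom_mem_of_mem_lits_goalFormula (h4.subset_lits hm)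
      obtain ⟨b, hb⟩ := hr.delayed_dom _ _ h3 m' h5
      rw [h6, e] at hb
      cases hb
    rw [hDd m h1 h2] at hd
    exact hmem m h1 (h.covered n S (hle n S hn) m hm hd)
  · have h1 : m.atom ≠ l.atom := by
      intro e
      rw [e] at hd; exact hd State.split_Dd_self
    -- The new symbols are still unknown, so they need no justification yet.
    have h2 : ∀ p, m.atom ≠ .tse l.atom p := fun p e => hI m hm _ p e hDgl
    rw [hDd m h1 h2] at hd
    exact hmem m h1 (h.needs m hm hd)

/-! ### Invariants of the search -/

/-- The structure `I` is entailed in `G` by decisions made at the structures in the trail, the first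
of which expands `I₀`. -/
inductive TrailOk (G : Set (Struc (Atom D ar))) (I₀ : Struc (Atom D ar)) :
    Struc (Atom D ar) → List (Struc (Atom D ar)) → Prop
  | nil (I : Struc (Atom D ar)) : I₀ ⊆ I → (∀ M ∈ G, I ⊆ M) → TrailOk G I₀ I []
  | cons (I I' : Struc (Atom D ar)) (t : List (Struc (Atom D ar))) (d : Lit (Atom D ar)) :
      TrailOk G I₀ I' t → I' ⊆ I → d ∈ I → d ∉ I' → d.neg ∉ I' →
      (∀ M ∈ G, I' ⊆ M → d ∈ M → I ⊆ M) → TrailOk G I₀ I (I' :: t)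

namespace TrailOk

variable {G G' : Set (Struc (Atom D ar))} {I₀ : Struc (Atom D ar)}
  {t t' : List (Struc (Atom D ar))}

theorem anti (h : TrailOk G I₀ I t) (hG : G' ⊆ G) : TrailOk G' I₀ I t := by
  induction h with
  | nil I h0 h => exact nil I h0 fun M hM => h M (hG hM)
  | cons I I' t d _ h1 h2 h3 h4 h5 ih => exact cons I I' t d ih h1 h2 h3 h4 fun M hM => h5 M (hG hM)

/-- For propagation: entailed literals may be added at the current level without touching the saved
structures. -/
theorem expand (h : TrailOk G I₀ I t) (hI : I ⊆ I') (hG : ∀ M ∈ G, I ⊆ M → I' ⊆ M) :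
    TrailOk G I₀ I' t := by
  cases h with
  | nil I h0 h => exact nil I' (h0.trans hI) fun M hM => hG M hM (h M hM)
  | cons I J t d ht h1 h2 h3 h4 h5 =>
    exact cons I' J t d ht (h1.trans hI) (hI h2) h3 h4 fun M hM h6 h7 => hG M hM (h5 M hM h6 h7)

theorem suffix (h : TrailOk G I₀ I (t ++ I' :: t')) : TrailOk G I₀ I' t' ∧ I' ⊆ I := by
  induction t generalizing I with
  | nil => cases h with | cons _ _ _ d ht h1 => exact ⟨ht, h1⟩
  | cons J t ih =>
    cases h with
    | cons _ _ _ d ht h1 => exact ⟨(ih ht).1, (ih ht).2.trans h1⟩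

theorem base (h : TrailOk G I₀ I t) : I₀ ⊆ I := by
  induction h with
  | nil I h0 h => exact h0
  | cons I I' t d _ h1 h2 h3 h4 h5 ih => exact ih.trans h1

/-- The set of the decisions. -/
theorem exists_decisions (h : TrailOk G I₀ I t) :
    ∃ C ⊆ I, ∀ M ∈ G, C ⊆ M → I ⊆ M := by
  induction h with
  | nil I h0 h => exact ⟨∅, Set.empty_subset _, fun M hM _ => h M hM⟩
  | cons I I' t d _ h1 h2 h3 h4 h5 ih =>
    obtain ⟨C, hC, hG⟩ := ih
    refine ⟨insert d C, Set.insert_subset h2 (hC.trans h1), fun M hM hCM => ?_⟩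
    rw [Set.insert_subset_iff] at hCM
    exact h5 M hM (hG M hM hCM.2) hCM.1

end TrailOk

/-- The two-valued well-founded models of the ground rules in which the sentence of the theory is
true and that expand the input structure. -/
def targetModels (T : Theory D ar) (Iin : Struc (DomAtom D ar)) (Dg : Rules D (Atom D ar)) :
    Set (Struc (Atom D ar)) :=
  {M | TwoValued M ∧ ⟨.dom T.goal, true⟩ ∈ M ∧ IsWfModel Dg M ∧ embed Iin ⊆ M}

/-- The invariants of the search over the ground part. -/
structure SearchInv (T : Theory D ar) (Iin : Struc (DomAtom D ar)) (s : State D ar) : Prop where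
  tse_struc : ∀ l ∈ s.I, ∀ h p, l.atom = .tse h p → s.Dg h ≠ none
  tse_clause : ∀ C ∈ s.Sg, ∀ l ∈ C, ∀ h p, l.atom = .tse h p → s.Dg h ≠ none
  ground : ∀ l ∈ s.I, l ∈ embed Iin ∨ l.atom ∈ groundAtoms s
  finite : (s.I \ embed Iin).Finite
  clauses_finite : s.Sg.Finite
  clauses_nonempty : ∀ C ∈ s.Sg, C.Nonempty
  goal_mem : {⟨.dom T.goal, true⟩} ∈ s.Sg
  clauses_hold : ∀ M ∈ targetModels T Iin s.Dg, ∀ C ∈ s.Sg, ∃ l ∈ C, l ∈ M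
  trail : TrailOk (targetModels T Iin s.Dg) (embed Iin) s.I s.trail

/-- The invariants of the algorithm. -/
structure Inv (T : Theory D ar) (Iin : Struc (DomAtom D ar)) (s : State D ar) : Prop where
  rules : RulesInv T s
  just : JustInv s.Dg s.Dd s.J s.I s.queue
  search : SearchInv T Iin s
  consistent : Consistent s.I

variable {T : Theory D ar} {Iin : Struc (DomAtom D ar)} {s s' : State D ar}

theorem RulesInv.congr (h : RulesInv T s) (h1 : s'.Dg = s.Dg) (h2 : s'.Dd = s.Dd) :
    RulesInv T s' := by
  have : s'.Dgd = s.Dgd := by funext a; simp [State.Dgd, h1, h2]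
  exact ⟨this ▸ h.refines, by rw [h1, h2]; exact h.disjoint, by rw [h2]; exact h.delayed_dom,
    by rw [h1]; exact h.ground_occ, by rw [this, h1]; exact h.tse_defined⟩

theorem groundAtoms_congr (h0 : s'.Sg = s.Sg) (h1 : s'.Dg = s.Dg) :
    groundAtoms s' = groundAtoms s := by simp only [groundAtoms, h0, h1]

theorem SearchInv.congr (h : SearchInv T Iin s) (h0 : s'.Sg = s.Sg) (h1 : s'.Dg = s.Dg)
    (h2 : s'.I = s.I) (h3 : s'.trail = s.trail) : SearchInv T Iin s' := by
  have hg := groundAtoms_congr h0 h1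
  cases s; cases s'
  subst h0 h1 h2 h3
  exact ⟨h.tse_struc, h.tse_clause, h.ground, h.finite, h.clauses_finite, h.clauses_nonempty,
    h.goal_mem, h.clauses_hold, h.trail⟩

theorem SearchInv.isGroundModel {M : Struc (Atom D ar)} (h : SearchInv T Iin s)
    (hM : M ∈ targetModels T Iin s.Dg) : IsGroundModel s M :=
  ⟨hM.1.consistent, fun a _ => hM.1 a trivial, h.clauses_hold M hM, hM.2.2.1⟩

theorem SearchInv.mem_targetModels {M : Struc (Atom D ar)} (h : SearchInv T Iin s)
    (h2 : TwoValued M) (hM : IsGroundModel s M) (hI : embed Iin ⊆ M) :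
    M ∈ targetModels T Iin s.Dg := by
  refine ⟨h2, ?_, hM.2.2.2, hI⟩
  obtain ⟨l, hl, hlM⟩ := hM.2.2.1 _ h.goal_mem
  rwa [← Set.mem_singleton_iff.1 hl]

/-- Propagation and choice act on ground atoms only, so they never assign a Tseitin symbol before
its head is grounded. -/
theorem tse_of_mem_groundAtoms (hr : RulesInv T s) (hs : SearchInv T Iin s) {h : Atom D ar}
    {p : Pos D} (ha : .tse h p ∈ groundAtoms s) : s.Dg h ≠ none := by
  rcases ha with ⟨C, hC, l, hl, he⟩ | ⟨a, φ, ha, rfl | he⟩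
  · exact hs.tse_clause C hC l hl h p he
  · exact hr.tse_defined h p (by rw [State.Dgd_of_ground ha]; simp)
  · obtain ⟨l, hl, he⟩ := (DFormula.mem_atoms_iff _ _).1 he
    rcases hr.ground_occ a φ ha l hl with ⟨b, hb⟩ | ⟨p', hp⟩
    · rw [he] at hb; cases hb
    · rw [he] at hp
      rw [(Atom.tse.inj hp).1, ha]; simp

/-- Target models are models of the ground part, so an entailed literal holds in each of them that
expands the current structure. -/
theorem Propagates.subset {L : List (Lit (Atom D ar))} (hp : Propagates s L)
    (hs : SearchInv T Iin s) {M : Struc (Atom D ar)} (hM : M ∈ targetModels T Iin s.Dg)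
    (hI : s.I ⊆ M) : extend s.I L ⊆ M := by
  rintro l (hl | hl)
  · exact hI hl
  · obtain ⟨m, hm, hmM⟩ := (hp.2.1 l hl).2.2 M hM.1 (hs.isGroundModel hM) hI
    rwa [← Set.mem_singleton_iff.1 hm]

/-- Adding literals over ground atoms. -/
theorem SearchInv.addLits {I : Struc (Atom D ar)} {t : List (Struc (Atom D ar))}
    (hs : SearchInv T Iin s) (hr : RulesInv T s) (hfin : (I \ s.I).Finite)
    (hg : ∀ l ∈ I, l ∉ s.I → l.atom ∈ groundAtoms s)
    (ht : TrailOk (targetModels T Iin s.Dg) (embed Iin) I t)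
    {q : List (Lit (Atom D ar))} :
    SearchInv T Iin { s with I := I, trail := t, queue := q } where
  tse_struc l hl h p e := by
    by_cases hl' : l ∈ s.I
    · exact hs.tse_struc l hl' h p e
    · have := hg l hl hl'
      rw [e] at this
      exact tse_of_mem_groundAtoms hr hs this
  tse_clause := hs.tse_clause
  ground l hl := by
    by_cases hl' : l ∈ s.I
    · exact hs.ground l hl'
    · exact Or.inr (hg l hl hl')
  finite := (hs.finite.union hfin).subset fun l hl => by
    by_cases hl' : l ∈ s.I
    · exact Or.inl ⟨hl', hl.2⟩
    · exact Or.inr ⟨hl.1, hl'⟩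
  clauses_finite := hs.clauses_finite
  clauses_nonempty := hs.clauses_nonempty
  goal_mem := hs.goal_mem
  clauses_hold := hs.clauses_hold
  trail := ht

theorem SearchInv.propagate {L q : List (Lit (Atom D ar))} (hs : SearchInv T Iin s)
    (hr : RulesInv T s) (hp : Propagates s L) :
    SearchInv T Iin { s with I := extend s.I L, queue := q } := by
  refine hs.addLits hr ?_ ?_ (hs.trail.expand (subset_extend _ _) fun M hM => hp.subset hs hM)
  · refine L.finite_toSet.subset ?_
    rintro l ⟨hl | hl, h'⟩
    exacts [absurd hl h', hl]
  · rintro l (hl | hl) h'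
    exacts [absurd hl h', (hp.2.1 l hl).2.1]

theorem SearchInv.choose {L q : List (Lit (Atom D ar))} {l : Lit (Atom D ar)}
    (hs : SearchInv T Iin s) (hr : RulesInv T s) (hp : Propagates s L)
    (hg : l.atom ∈ groundAtoms s) (h1 : l ∉ extend s.I L) (h2 : l.neg ∉ extend s.I L) :
    SearchInv T Iin { s with
      I := insert l (extend s.I L), trail := extend s.I L :: s.trail, queue := q } := by
  refine hs.addLits hr ?_ ?_ ?_
  · refine ((L.finite_toSet).insert l).subset ?_
    rintro m ⟨hm | hm | hm, h'⟩
    exacts [Or.inl hm, absurd hm h', Or.inr hm]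
  · rintro m (rfl | hm | hm) h'
    exacts [hg, absurd hm h', (hp.2.1 m hm).2.1]
  · exact .cons _ _ _ l (hs.trail.expand (subset_extend _ _) fun M hM => hp.subset hs hM)
      (Set.subset_insert _ _) (Set.mem_insert _ _) h1 h2
      fun M _ hM hl => Set.insert_subset hl hM

/-- The learned clause is entailed from the input structure and not only from the current one, so it
holds in every target model. Its literals are complements of literals true at the conflict, so it
introduces no new Tseitin symbols. -/
theorem SearchInv.backjump {L q : List (Lit (Atom D ar))} {C : Set (Lit (Atom D ar))}
    {t t' : List (Struc (Atom D ar))} {I' : Struc (Atom D ar)}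
    (hs : SearchInv T Iin s) (hr : RulesInv T s) (hp : Propagates s L)
    (ht : s.trail = t ++ I' :: t') (hl : Learns s (embed Iin) (extend s.I L) I' C) :
    SearchInv T Iin { s with Sg := insert C s.Sg, I := I', trail := t', queue := q } := by
  have hs' := hs.propagate (q := q) hr hp
  obtain ⟨hl1, hl2, l, hlC, -⟩ := hl
  have htr := hs.trail.expand (subset_extend s.I L) fun M hM => hp.subset hs hM
  rw [ht] at htr
  obtain ⟨ht1, ht2⟩ := htr.suffix
  refine ⟨fun l hl => hs'.tse_struc l (ht2 hl), ?_, fun l hl => ?_,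
    hs'.finite.subset (Set.sdiff_subset_sdiff_left ht2), hs.clauses_finite.insert C, ?_,
    Set.mem_insert_of_mem _ hs.goal_mem, ?_, ht1⟩
  · rintro C' (rfl | hC') m hm
    · exact hs'.tse_struc m.neg (hl2 m hm)
    · exact hs.tse_clause C' hC' m hm
  · rcases hs'.ground l (ht2 hl) with h | h | h
    · exact Or.inl h
    · obtain ⟨C', hC', h⟩ := h
      exact Or.inr (Or.inl ⟨C', Set.mem_insert_of_mem _ hC', h⟩)
    · exact Or.inr (Or.inr h)
  · rintro C' (rfl | hC')
    · exact ⟨l, hlC⟩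
    · exact hs.clauses_nonempty C' hC'
  · rintro M hM C' (rfl | hC')
    · exact hl1 M hM.1 (hs.isGroundModel hM) hM.2.2.2
    · exact hs.clauses_hold M hM C' hC'

open Classical in
-- By modularity (`IsWfModel.of_le`), a two-valued model of the enlarged ground definition is a
-- model of the previous one. So learned clauses and the trail stay sound when rules are grounded.
theorem targetModels_split {h : Atom D ar} {g : DFormula D (Atom D ar)}
    {Dg : Rules D (Atom D ar)} (hh : Dg h = none) :
    targetModels T Iin (Function.update Dg h (some g)) ⊆ targetModels T Iin Dg := by
  rintro M ⟨h1, h2, h3, h4⟩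
  refine ⟨h1, h2, h3.of_le h1 fun a φ ha => ?_, h4⟩
  have : a ≠ h := by rintro rfl; rw [hh] at ha; cases ha
  simp [this, ha]

open Classical in
theorem SearchInv.split {h : Atom D ar} {g : DFormula D (Atom D ar)}
    {new : Pos D → Option (DFormula D (Atom D ar))} {J' : JGraph D ar}
    {q' : List (Lit (Atom D ar))} (hs : SearchInv T Iin s) (hh : s.Dg h = none) :
    SearchInv T Iin (s.split h g new J' q') := by
  have hD : ∀ a, s.Dg a ≠ none → (s.split h g new J' q').Dg a ≠ none := by
    intro a ha
    rwa [State.split_Dg_of_ne]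
    rintro rfl; exact ha hh
  have hG := targetModels_split (T := T) (Iin := Iin) (g := g) hh
  refine ⟨fun l hl a p e => hD a (hs.tse_struc l hl a p e),
    fun C hC l hl a p e => hD a (hs.tse_clause C hC l hl a p e), fun l hl => ?_, hs.finite,
    hs.clauses_finite, hs.clauses_nonempty, hs.goal_mem, fun M hM => hs.clauses_hold M ?_,
    hs.trail.anti ?_⟩
  · rcases hs.ground l hl with h1 | h1 | ⟨a, φ, ha, h1⟩
    · exact Or.inl h1
    · exact Or.inr (Or.inl h1)
    · refine Or.inr (Or.inr ⟨a, φ, ?_, h1⟩)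
      rw [State.split_Dg_of_ne, ha]
      rintro rfl; rw [hh] at ha; cases ha
  · exact hG hM
  · intro M hM
    exact hG hM

/-! ### Preservation of the invariants -/

theorem inv_initState (h : IsInput T Iin) : Inv T Iin (initState T Iin) := by
  have hDgd : (initState T Iin).Dgd = T.extRules := by
    funext a
    cases a <;> rfl
  refine ⟨⟨hDgd ▸ T.refines_extRules, fun a ha => absurd rfl ha, fun a φ ha l hl => ?_,
    fun a φ ha => (by cases ha), fun a p ha => absurd rfl ha⟩, ⟨by simp [initState],
    fun l S hl => (by cases hl), fun p hp => ?_, fun m hm => ?_, fun m hm => ?_,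
    fun n S hn => ?_, fun n S hn => ?_, fun l hl hd => ?_⟩, ⟨?_, ?_, fun l hl => Or.inl hl,
    by simp [initState], by simp [initState], by simp [initState], by simp [initState], ?_,
    .nil _ subset_rfl fun M hM => hM.2.2.2⟩, ?_⟩
  · exact Theory.exists_dom_of_mem_lits (T := T) (a := a) (by cases a <;> exact ha) hl
  · obtain ⟨S, hS, -⟩ := hp 0
    rw [offQueue_eq_some] at hS; cases hS.2
  · rcases JGraph.mem_nodes.1 hm with ⟨S, hS⟩ | ⟨n, S, hS, -⟩ <;>
    · rw [offQueue_eq_some] at hS; cases hS.2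
  · rcases JGraph.mem_nodes.1 hm with ⟨S, hS⟩ | ⟨n, S, hS, -⟩ <;>
    · rw [offQueue_eq_some] at hS; cases hS.2
  · rw [offQueue_eq_some] at hn; cases hn.2
  · rw [offQueue_eq_some] at hn; cases hn.2
  · obtain ⟨m, hm, rfl⟩ := hl
    exact absurd (Definition.inst_eq_none_iff.1 (h.2.2 m hm)) hd
  · rintro l ⟨m, hm, rfl⟩ h p e
    cases e
  · rintro C rfl l rfl h p e
    cases e
  · rintro M hM C rfl
    exact ⟨_, rfl, hM.2.1⟩
  · rintro l ⟨m, hm, rfl⟩ hn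
    have hn' : (⟨.dom m.atom, !m.sign⟩ : Lit (Atom D ar)) ∈ embed Iin := hn
    rw [mem_embed] at hn'
    exact h.2.1 m hm hn'

theorem Inv.propagate {L q : List (Lit (Atom D ar))} (h : Inv T Iin s) (hp : Propagates s L)
    (hc : CheckLiterals s L s.queue q) (hcons : Consistent (extend s.I L)) :
    Inv T Iin { s with I := extend s.I L, queue := q } :=
  ⟨h.rules.congr rfl rfl, hc.justInv h.just, h.search.propagate h.rules hp, hcons⟩

open Classical in
/-- Lazy grounding of a literal that was just dequeued preserves the invariants. -/
theorem LazyGround.inv {l : Lit (Atom D ar)} (hl : LazyGround s l s')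
    (h : Inv T Iin { s with queue := l :: s.queue }) : Inv T Iin s' := by
  have hr : RulesInv T s := h.rules.congr rfl rfl
  have hS : SearchInv T Iin s := h.search.congr rfl rfl rfl rfl
  cases hl with
  | keep hv =>
    obtain ⟨S, hJ, hv⟩ := hv
    refine ⟨hr, ?_, hS, h.consistent⟩
    have := hv.justInv h.just (h.just.collects l S hJ)
    rwa [← hJ, Function.update_eq_self] at this
  | build φ S _ _ hφ hc hv =>
    refine ⟨hr.congr rfl rfl, ?_, hS.congr rfl rfl rfl rfl, h.consistent⟩
    exact hv.justInv h.just ⟨φ, hφ, hc⟩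
  | split φ g new J' q' _ _ hφ hs hJ' hq =>
    have hDg : s.Dg l.atom = none := by
      by_contra h'
      rw [hr.disjoint _ h'] at hφ; cases hφ
    exact ⟨hr.split hφ hs, JustInv.split h.just hr hS.tse_struc hφ hJ' hq, hS.split hDg,
      h.consistent⟩
  | discard J' q' _ hn hJ' hq =>
    refine ⟨hr.congr rfl rfl, ?_, hS.congr rfl rfl rfl rfl, h.consistent⟩
    exact h.just.discard hJ' hn hq

theorem Step.inv (hstep : Step Iin (.running s) (.running s')) (h : Inv T Iin s) :
    Inv T Iin s' := by
  cases hstep with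
  | backjump _ L q C t t' I' hp hc hcons ht hl =>
    have htr := h.search.trail.expand (subset_extend s.I L) fun M hM => hp.subset h.search hM
    have htr' := h.search.trail
    rw [ht] at htr htr'
    refine ⟨h.rules.congr rfl rfl, (hc.justInv h.just).anti htr.suffix.2,
      h.search.backjump h.rules hp ht hl, h.consistent.mono htr'.suffix.2⟩
  | justify _ _ L q l hp hc hcons hl =>
    exact hl.inv (h.propagate hp hc hcons)
  | choose _ L q l hp hc hcons _ hg h1 h2 hcl =>
    have hJ := CheckLiteral.justInv hcl (hc.justInv h.just)
    refine ⟨h.rules.congr rfl rfl, hJ, h.search.choose h.rules hp hg h1 h2, ?_⟩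
    rintro m (rfl | hm) (hn | hn)
    · exact Lit.neg_ne m hn
    · exact h2 hn
    · exact h2 (hn ▸ by simpa using hm)
    · exact hcons m hm hn

theorem Reaches.inv (hin : IsInput T Iin) (h : Reaches T Iin (.running s)) : Inv T Iin s := by
  suffices ∀ c, Reaches T Iin c → ∀ s, c = .running s → Inv T Iin s from this _ h s rfl
  intro c hc
  induction hc with
  | refl => rintro s h; cases h; exact inv_initState hin
  | tail _ hstep ih =>
    rintro s rfl
    cases hstep with
    | backjump s L q C t t' I' hp hc hcons ht hl =>
      exact (Step.backjump s L q C t t' I' hp hc hcons ht hl).inv (ih s rfl)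
    | justify s _ L q l hp hc hcons hl =>
      exact (Step.justify s _ L q l hp hc hcons hl).inv (ih s rfl)
    | choose s L q l hp hc hcons hm hg h1 h2 hcl =>
      exact (Step.choose s L q l hp hc hcons hm hg h1 h2 hcl).inv (ih s rfl)

/-- A returned state comes from a state that satisfies the invariants, with an empty queue. -/
theorem Reaches.inv_returned (hin : IsInput T Iin) (h : Reaches T Iin (.returned s)) :
    Inv T Iin s ∧ s.queue = [] ∧ IsGroundModel s s.I := by
  rcases Relation.ReflTransGen.cases_tail h with h | ⟨c, hc, hstep⟩
  · cases h
  · cases hstep with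
    | success s L hp hcl hcons hm =>
      exact ⟨(Reaches.inv hin hc).propagate hp hcl hcons, rfl, hm.1,
        hm.2.1, hm.2.2.1, hm.2.2.2⟩

end Invariants

/-! ### Soundness of both answers -/

section Correctness

variable {D : Type u} {V : Type v} {ar : V → ℕ}

/-! ### Literals in a justification hold in the well-founded model -/

/-- If from each element of `B` one can stay in `B` while moving along `R`, decreasing a rank unless
`P` holds, then there is an infinite path on which `P` holds infinitely often. -/
theorem exists_path_frequently {α : Type*} {R : α → α → Prop} {B P : α → Prop} {r : α → ℕ}
    (hstep : ∀ x, B x → ∃ y, B y ∧ R x y ∧ (P x ∨ r y < r x)) {x : α} (hx : B x) :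
    ∃ p : ℕ → α, (∀ n, R (p n) (p (n + 1))) ∧ ∀ N, ∃ n, N ≤ n ∧ P (p n) := by
  have : Nonempty α := ⟨x⟩
  choose! f hB hR hP using hstep
  have hBn : ∀ n, B (f^[n] x) := by
    intro n
    induction n with
    | zero => exact hx
    | succ n ih => rw [Function.iterate_succ_apply']; exact hB _ ih
  refine ⟨fun n => f^[n] x, fun n => ?_, fun N => ?_⟩
  · simp only [Function.iterate_succ_apply']
    exact hR _ (hBn n)
  -- If `P` failed from `N` on, the rank would drop at each step, more often than its value at `N`
  -- permits.
  · by_contra! h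
    have hk : ∀ k, r (f^[N + k] x) + k ≤ r (f^[N] x) := by
      intro k
      induction k with
      | zero => simp
      | succ k ih =>
        have h1 := (hP _ (hBn (N + k))).resolve_left (h (N + k) (by omega))
        rw [← Function.iterate_succ_apply' f] at h1
        have : N + (k + 1) = (N + k).succ := rfl
        rw [this]
        omega
    have := hk (r (f^[N] x) + 1)
    omega

variable {Δ : Rules D (Atom D ar)} {O : Struc (Atom D ar)} {K : JGraph D ar}

theorem wf_subset_mixed : wf Δ O ⊆ mixed Δ O (wfTrue Δ O) (stableOp Δ O (wfTrue Δ O)) := by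
  rintro ⟨a, b⟩ hl
  by_cases ha : a ∈ openAtoms Δ
  · rw [mem_wf_of_open ha] at hl; rwa [mem_mixed_of_open ha]
  · rw [mem_mixed_of_defined ha]
    cases b
    · exact (neg_mem_wf ha).1 hl
    · exact (pos_mem_wf ha).1 hl

/-- `l` has a direct justification, but does not hold in the well-founded model. -/
def Unjust (Δ : Rules D (Atom D ar)) (O : Struc (Atom D ar)) (K : JGraph D ar)
    (l : Lit (Atom D ar)) : Prop := K l ≠ none ∧ l ∉ wf Δ O

/-- One can reach a positive literal from `l` in `n` steps among the literals in `Unjust`. -/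
def ReachesPos (Δ : Rules D (Atom D ar)) (O : Struc (Atom D ar)) (K : JGraph D ar) :
    ℕ → Lit (Atom D ar) → Prop
  | 0, l => Unjust Δ O K l ∧ l.sign = true
  | n + 1, l => Unjust Δ O K l ∧ ∃ S, K l = some S ∧ ∃ m ∈ S, ReachesPos Δ O K n m

theorem ReachesPos.unjust {n : ℕ} {l : Lit (Atom D ar)} (h : ReachesPos Δ O K n l) :
    Unjust Δ O K l := by
  cases n <;> exact h.1

/-- Call a justified literal outside the well-founded model unjust. A positive unjust literal has an
unjust child, since otherwise its rule would fire. A negative unjust literal can reach a positive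
one, since otherwise such atoms would form an unfounded set. Chaining these steps produces a path
that `NoUnfounded` forbids. -/
theorem mem_wf_of_justified
    (hK : ∀ l S, K l = some S → ∃ φ, Δ l.atom = some φ ∧ Collects (goalFormula l φ) S)
    (hnu : K.NoUnfounded) (hO : Consistent O)
    (hcov : ∀ l S, K l = some S → ∀ m ∈ S, (m.atom ∈ openAtoms Δ ∧ m ∈ O) ∨ K m ≠ none)
    {l : Lit (Atom D ar)} (hl : K l ≠ none) : l ∈ wf Δ O := by
  have hKd : ∀ l, K l ≠ none → l.atom ∈ definedAtoms Δ := fun l hl => by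
    obtain ⟨S, hS⟩ := Option.ne_none_iff_exists'.1 hl
    obtain ⟨φ, h, -⟩ := hK l S hS
    exact mem_definedAtoms.2 ⟨φ, h⟩
  have hpos : ∀ l, Unjust Δ O K l → l.sign = true → ∃ S, K l = some S ∧ ∃ m ∈ S,
      Unjust Δ O K m := by
    rintro ⟨a, s⟩ ⟨h1, h2⟩ rfl
    obtain ⟨S, hS⟩ := Option.ne_none_iff_exists'.1 h1
    refine ⟨S, hS, ?_⟩
    by_contra! hno
    obtain ⟨φ, h3, h4⟩ := hK _ S hS
    apply h2
    rw [pos_mem_wf (hKd _ h1), ← stableOp_stableOp_wfTrue]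
    refine stableOp_closed h3 ((h4.holds.mono fun m hm => ?_))
    rw [stableOp_stableOp_wfTrue]
    apply wf_subset_mixed
    rcases hcov _ S hS m hm with ⟨h5, h6⟩ | h5
    · exact (mem_wf_of_open h5).2 h6
    · by_contra h6
      exact hno m hm ⟨h5, h6⟩
  have hreach : ∀ l, Unjust Δ O K l → ∃ n, ReachesPos Δ O K n l := by
    rintro ⟨a, s⟩ hl
    cases s
    swap
    · exact ⟨0, hl, rfl⟩
    by_contra hno
    -- `Z` is the set of possibly true atoms. Removing those whose negation is unjust and reaches no
    -- positive unjust literal leaves a closed set, against the leastness of `Z`.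
    set Z := stableOp Δ O (wfTrue Δ O) with hZ
    have hsub : Z ⊆ {b | b ∈ Z ∧
        ¬ (Unjust Δ O K ⟨b, false⟩ ∧ ¬ ∃ n, ReachesPos Δ O K n ⟨b, false⟩)} := by
      refine stableOp_le fun b φ hb hφ => ⟨stableOp_closed hb
        (hφ.mono (mixed_mono (fun _ h => h.1) subset_rfl)), fun ⟨h1, h2⟩ => ?_⟩
      obtain ⟨S, hS⟩ := Option.ne_none_iff_exists'.1 h1.1
      obtain ⟨ψ, h3, h4⟩ := hK _ S hS
      obtain rfl : φ = ψ := by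
        rw [hb] at h3; exact Option.some.inj h3
      obtain ⟨m, -, h5, h6⟩ := DFormula.Holds.exists_neg_mem (I := S) h4.holds hφ
      have hnr : ∀ n, ¬ ReachesPos Δ O K n m.neg := fun n hn =>
        h2 ⟨n + 1, h1, S, hS, m.neg, h5, hn⟩
      rcases hcov _ S hS _ h5 with ⟨h7, h8⟩ | h7
      · rw [mem_mixed_of_open (l := m) h7] at h6
        exact hO m h6 h8
      · have hmd : m.atom ∈ definedAtoms Δ := hKd m.neg h7
        rcases m with ⟨c, _ | _⟩
        · rw [mem_mixed_of_defined hmd] at h6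
          have h8 : (⟨c, true⟩ : Lit (Atom D ar)) ∉ wf Δ O := by
            rw [pos_mem_wf hmd]; exact h6
          exact hnr 0 ⟨⟨h7, h8⟩, rfl⟩
        · rw [mem_mixed_of_defined hmd] at h6
          have h8 : (⟨c, false⟩ : Lit (Atom D ar)) ∉ wf Δ O := by
            rw [neg_mem_wf hmd]; exact not_not.2 h6.1
          exact h6.2 ⟨⟨h7, h8⟩, fun ⟨n, hn⟩ => hnr n hn⟩
    have h1 : a ∈ Z := by
      by_contra h
      exact hl.2 ((neg_mem_wf (hKd _ hl.1)).2 h)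
    exact (hsub h1).2 ⟨hl, hno⟩
  by_contra hlw
  classical
  -- The rank is the distance to the nearest positive literal within the unjust ones; it decreases
  -- at negative literals and is unconstrained at positive ones.
  obtain ⟨p, hp1, hp2⟩ := exists_path_frequently
    (R := fun l m => ∃ S, K l = some S ∧ m ∈ S) (B := Unjust Δ O K) (P := fun l => l.sign = true)
    (r := fun l => sInf {n | ReachesPos Δ O K n l}) (x := l) (fun x hx => by
      by_cases hs : x.sign = true
      · obtain ⟨S, hS, m, hm, hmu⟩ := hpos x hx hs
        exact ⟨m, hmu, ⟨S, hS, hm⟩, Or.inl hs⟩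
      · have hmem : ReachesPos Δ O K (sInf {n | ReachesPos Δ O K n x}) x :=
          Nat.sInf_mem (s := {n | ReachesPos Δ O K n x}) (hreach x hx)
        obtain ⟨n, hn⟩ : ∃ n, n = sInf {n | ReachesPos Δ O K n x} := ⟨_, rfl⟩
        rw [← hn] at hmem
        cases n with
        | zero => exact absurd hmem.2 hs
        | succ n =>
          obtain ⟨-, S, hS, m, hm, hr⟩ := hmem
          refine ⟨m, hr.unjust, ⟨S, hS, hm⟩, Or.inr ?_⟩
          rw [← hn]
          exact Nat.lt_succ_of_le (Nat.sInf_le hr)) ⟨hl, hlw⟩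
  obtain ⟨N, hN⟩ := hnu p hp1
  obtain ⟨n, hn, hs⟩ := hp2 N
  rw [hN n hn] at hs
  cases hs

/-! ### Correctness of a returned structure -/

variable {T : Theory D ar} {Iin : Struc (DomAtom D ar)} {s : State D ar}

theorem offQueue_nil (J : JGraph D ar) : offQueue J [] = J := by
  funext m; simp [offQueue]

theorem Inv.consistent_expanded (h : Inv T Iin s) (hq : s.queue = []) :
    Consistent s.expanded := by
  have h1 := h.just.consistent
  have h2 := h.just.not_false
  rw [hq, offQueue_nil] at h1 h2
  have hn : ∀ l S, s.J l = some S → ∀ m ∈ S, m ∈ s.J.nodes := fun l S hl m hm =>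
    JGraph.mem_nodes.2 (Or.inr ⟨l, S, hl, hm⟩)
  rintro m (hm | ⟨l, S, hl, hm⟩) (hm' | ⟨l', S', hl', hm'⟩)
  · exact h.consistent m hm hm'
  · exact h2 _ (hn _ _ hl' _ hm') (by simpa using hm)
  · exact h2 _ (hn _ _ hl _ hm) hm'
  · exact h1 m (hn _ _ hl _ hm) (hn _ _ hl' _ hm')

/-- Open literals are given by `O`, and delayed ones hold because they are justified. For literals
defined by ground rules, `s.I` and the well-founded model are both well-founded models of the ground
rules and agree on the open literals of their bodies, hence also on the heads. -/
theorem Inv.expanded_subset_wf (h : Inv T Iin s) (hq : s.queue = []) (hT : Total T.defn.toRules)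
    (hg : IsGroundModel s s.I) (hO : TwoValuedStrucOf O (openAtoms s.Dgd))
    (hE : restrict s.expanded (openAtoms s.Dgd) ⊆ O) : s.expanded ⊆ wf s.Dgd O := by
  have hM : TwoValued (wf s.Dgd O) := h.rules.refines.twoValued_wf hT hO.1
  have hOc : Consistent O := fun l hl hn =>
    TwoValuedOn.neg_notMem hO.1 (hO.2 l hl) hl hn
  have hj := h.just
  rw [hq] at hj
  have hnu := hj.noUnfounded
  have hng := hj.not_ground
  have hcv := hj.covered
  rw [offQueue_nil] at hnu hng hcv
  have hJ : ∀ l, s.J l ≠ none → l ∈ wf s.Dgd O := by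
    intro l hl
    refine mem_wf_of_justified (fun l S hS => ?_) hnu hOc (fun l S hS m hm => ?_) hl
    · obtain ⟨φ, h1, h2⟩ := hj.collects l S hS
      exact ⟨φ, h.rules.Dgd_of_delayed h1, h2⟩
    · by_cases hd : s.Dd m.atom = none
      · have ho : m.atom ∈ openAtoms s.Dgd := State.Dgd_eq_none.2 ⟨hng l S hS m hm, hd⟩
        exact Or.inl ⟨ho, hE ⟨Or.inr ⟨l, S, hS, hm⟩, ho⟩⟩
      · exact Or.inr ((hcv l S hS m hm hd).resolve_right (by simp))
  have hnotDg : ∀ l ∈ s.expanded, s.Dg l.atom = none → l ∈ wf s.Dgd O := by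
    intro l hl hd
    by_cases hdd : s.Dd l.atom = none
    · have ho : l.atom ∈ openAtoms s.Dgd := State.Dgd_eq_none.2 ⟨hd, hdd⟩
      exact (mem_wf_of_open ho).2 (hE ⟨hl, ho⟩)
    · rcases hl with hl | ⟨n, S, hS, hl⟩
      · exact hJ l ((hj.needs l hl hdd).resolve_right (by simp))
      · exact hJ l ((hcv n S hS l hl hdd).resolve_right (by simp))
  intro l hl
  by_cases hd : s.Dg l.atom = none
  · exact hnotDg l hl hd
  · rcases hl with hl | ⟨n, S, hS, hl⟩
    · have hMg := isWfModel_iff.1 ((isWfModel_wf (Δ := s.Dgd) (O := O)).of_le hM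
        fun a φ ha => State.Dgd_of_ground ha)
      have hIg := isWfModel_iff.1 hg.2.2.2
      rw [hMg, ← mem_wf_congr (O := s.I) _ hd, ← hIg]
      · exact hl
      · intro a φ ha m hm ho
        refine ⟨fun h1 => hnotDg m (Or.inl h1) ho, fun h1 => ?_⟩
        have hmg : m.atom ∈ groundAtoms s :=
          Or.inr ⟨a, φ, ha, Or.inr (DFormula.atom_mem_atoms hm)⟩
        rcases hg.2.1.mem_or hmg with h2 | h2
        · exact h2
        · exact absurd (hnotDg _ (Or.inl h2) ho) (hM.consistent m h1)
    · exact absurd (hng n S hS l hl) hd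

theorem twoValued_restrictVoc {M : Struc (Atom D ar)} (hM : TwoValued M) :
    TwoValued (restrictVoc M) := fun a _ => hM (.dom a) trivial

theorem Reaches.returned_correct (hin : IsInput T Iin) (h : Reaches T Iin (.returned s)) :
    Consistent s.expanded ∧
      ∀ O : Struc (Atom D ar), TwoValuedStrucOf O (openAtoms s.Dgd) →
        restrict s.expanded (openAtoms s.Dgd) ⊆ O →
        TwoValued (wf s.Dgd O) ∧ s.expanded ⊆ wf s.Dgd O ∧
        T.IsModel (restrictVoc (wf s.Dgd O)) ∧ Iin ⊆ restrictVoc (wf s.Dgd O) := by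
  obtain ⟨h, hq, hg⟩ := h.inv_returned hin
  refine ⟨h.consistent_expanded hq, fun O hO hE => ?_⟩
  have hM : TwoValued (wf s.Dgd O) := h.rules.refines.twoValued_wf hin.1 hO.1
  have hsub := h.expanded_subset_wf hq hin.1 hg hO hE
  refine ⟨hM, hsub, ⟨twoValued_restrictVoc hM, ?_, ?_⟩, fun l hl => ?_⟩
  · obtain ⟨l, hl, hlI⟩ := hg.2.2.1 _ h.search.goal_mem
    exact hsub (Or.inl (Set.mem_singleton_iff.1 hl ▸ hlI))
  · rw [h.rules.refines.restrictVoc_wf]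
    exact isWfModel_wf
  · exact hsub (Or.inl (h.search.trail.base (mem_embed.2 hl)))

/-! ### Correctness of the answer false -/

/-- A model of the theory extends to a model of the ground part. -/
theorem Inv.exists_targetModel (h : Inv T Iin s) (hT : Total T.defn.toRules)
    {M₀ : Struc (DomAtom D ar)} (hM₀ : T.IsModel M₀) (hI : Iin ⊆ M₀) :
    ∃ M, M ∈ targetModels T Iin s.Dg := by
  -- Undefined Tseitin symbols are open and irrelevant to the vocabulary; they are made true only in
  -- order to have a value.
  set O : Struc (Atom D ar) := {l | l.atom ∈ openAtoms s.Dgd ∧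
    ((∃ b, l.atom = .dom b ∧ ⟨b, l.sign⟩ ∈ M₀) ∨ (∃ h p, l.atom = .tse h p) ∧ l.sign = true)}
    with hOdef
  have hO : TwoValuedOn O (openAtoms s.Dgd) := by
    intro a ha
    cases a with
    | dom b =>
      have h1 : ∀ i, (⟨.dom b, i⟩ : Lit (Atom D ar)) ∈ O ↔ ⟨b, i⟩ ∈ M₀ := by
        intro i; simp [hOdef, ha]
      rw [h1, h1]
      exact hM₀.1 b trivial
    | tse h p =>
      have h1 : ∀ i, (⟨.tse h p, i⟩ : Lit (Atom D ar)) ∈ O ↔ i = true := by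
        intro i; simp [hOdef, ha]
      rw [h1, h1]
      simp [Xor]
  have hM : TwoValued (wf s.Dgd O) := h.rules.refines.twoValued_wf hT hO
  have hres : restrictVoc (wf s.Dgd O) = M₀ := by
    rw [h.rules.refines.restrictVoc_wf]
    conv_rhs => rw [hM₀.2.2]
    congr 1
    ext ⟨b, i⟩
    rw [mem_restrictVoc]
    simp [hOdef, restrict, h.rules.refines.open_iff, and_comm]
  refine ⟨wf s.Dgd O, hM, ?_, isWfModel_wf.of_le hM fun a φ ha => State.Dgd_of_ground ha, ?_⟩
  · have := hM₀.2.1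
    rwa [← hres] at this
  · rintro l ⟨m, hm, rfl⟩
    have := hI hm
    rwa [← hres] at this

theorem Reaches.failed_correct (hin : IsInput T Iin) (h : Reaches T Iin .failed) :
    ¬ ∃ M : Struc (DomAtom D ar), T.IsModel M ∧ Iin ⊆ M := by
  rintro ⟨M₀, hM₀, hI⟩
  rcases Relation.ReflTransGen.cases_tail h with h | ⟨c, hc, hstep⟩
  · cases h
  · cases hstep with
    | fail s L hp hcons ht =>
      have hinv := Reaches.inv hin hc
      obtain ⟨M, hM⟩ := hinv.exists_targetModel hin.1 hM₀ hI
      have hs := hinv.search.trail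
      rw [ht] at hs
      cases hs with
      | nil _ _ hs =>
        -- With no active choice, the structure and everything propagated from it lie in the target
        -- model, which is consistent.
        exact hcons (hM.1.consistent.mono (hp.subset hinv.search hM (hs M hM)))

end Correctness

section Progress

variable {D : Type u} {V : Type v} {ar : V → ℕ} {T : Theory D ar} {Iin : Struc (DomAtom D ar)}
  {s : State D ar}

/-! ### A further iteration is always possible -/

/-- Being a model of the ground part depends only on the values of its atoms, and on these `E` and
`M` coincide. -/
theorem IsGroundModel.of_subset {M E : Struc (Atom D ar)} (hM : IsGroundModel s M) (hE : E ⊆ M)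
    (h2 : TwoValuedOn E (groundAtoms s)) : IsGroundModel s E := by
  have hiff : ∀ l : Lit (Atom D ar), l.atom ∈ groundAtoms s → (l ∈ E ↔ l ∈ M) := by
    intro l hl
    refine ⟨fun h => hE h, fun h => ?_⟩
    rcases h2.mem_or hl with h' | h'
    · exact h'
    · exact absurd (hE h') (hM.1 l h)
  refine ⟨hM.1.mono hE, h2, fun C hC => ?_, isWfModel_iff.2 ?_⟩
  · obtain ⟨l, hl, hlM⟩ := hM.2.2.1 C hC
    exact ⟨l, hl, (hiff l (Or.inl ⟨C, hC, l, hl, rfl⟩)).2 hlM⟩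
  · ext l
    by_cases ho : l.atom ∈ openAtoms s.Dg
    · rw [mem_wf_of_open ho]
    · obtain ⟨φ, hφ⟩ := mem_definedAtoms.1 (notMem_openAtoms.1 ho)
      rw [hiff l (Or.inr ⟨l.atom, φ, hφ, Or.inl rfl⟩)]
      conv_lhs => rw [isWfModel_iff.1 hM.2.2.2]
      refine mem_wf_congr (fun a ψ ha m hm _ => ?_) ho
      exact (hiff m (Or.inr ⟨a, ψ, ha, Or.inr (DFormula.atom_mem_atoms hm)⟩)).symm

/-- If some model expands the structure, propagating just the unit literals is admissible. If none
does, every literal is entailed, and a conflict can be forced. -/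
theorem SearchInv.exists_propagates (h : SearchInv T Iin s) : ∃ L, Propagates s L := by
  classical
  by_cases hM : ∃ M, TwoValued M ∧ IsGroundModel s M ∧ s.I ⊆ M
  · obtain ⟨M, hM2, hM, hIM⟩ := hM
    -- A satisfiable clause has at most one unit literal: two different ones would make all literals
    -- of the clause false. There are finitely many clauses.
    have hfin : {l | l ∉ s.I ∧ ∃ C ∈ s.Sg, l ∈ C ∧ ∀ m ∈ C, m ≠ l → m.neg ∈ s.I}.Finite := by
      have : ∀ C ∈ s.Sg, {l | l ∈ C ∧ ∀ m ∈ C, m ≠ l → m.neg ∈ s.I}.Finite := by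
        intro C hC
        refine Set.Subsingleton.finite ?_
        rintro l ⟨hl, hl'⟩ m ⟨hm, hm'⟩
        by_contra hne
        obtain ⟨n, hn, hnM⟩ := hM.2.2.1 C hC
        refine hM.1 n hnM (hIM ?_)
        by_cases hnl : n = l
        · exact hm' n hn (hnl ▸ hne)
        · exact hl' n hn hnl
      refine (h.clauses_finite.biUnion this).subset ?_
      rintro l ⟨-, C, hC, hl⟩
      exact Set.mem_biUnion hC hl
    have hmem : ∀ l, l ∈ hfin.toFinset.toList ↔
        l ∉ s.I ∧ ∃ C ∈ s.Sg, l ∈ C ∧ ∀ m ∈ C, m ≠ l → m.neg ∈ s.I := fun l => by simp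
    have hent : ∀ l ∈ hfin.toFinset.toList, Entails s s.I {l} := by
      intro l hl M _ hM hIM
      obtain ⟨-, C, hC, -, hu⟩ := (hmem l).1 hl
      obtain ⟨n, hn, hnM⟩ := hM.2.2.1 C hC
      refine ⟨l, rfl, ?_⟩
      by_contra hlM
      refine hM.1 n hnM (hIM (hu n hn ?_))
      rintro rfl; exact hlM hnM
    have hext : extend s.I hfin.toFinset.toList ⊆ M := by
      rintro l (hl | hl)
      · exact hIM hl
      · obtain ⟨m, hm, hmM⟩ := hent l hl M hM2 hM hIM
        rwa [← Set.mem_singleton_iff.1 hm]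
    refine ⟨hfin.toFinset.toList, Finset.nodup_toList _, fun l hl => ?_, fun _ =>
      ⟨fun C hC l hl hu => ?_, fun h2 => hM.of_subset hext h2⟩⟩
    · obtain ⟨h1, C, hC, hlC, -⟩ := (hmem l).1 hl
      exact ⟨h1, Or.inl ⟨C, hC, l, hlC, rfl⟩, hent l hl⟩
    · by_cases hlI : l ∈ s.I
      · exact Or.inl hlI
      · exact Or.inr ((hmem l).2 ⟨hlI, C, hC, hl, hu⟩)
  -- The atom of the sentence is always a ground atom; both of its literals are vacuously entailed,
  -- and together they are inconsistent.
  · set p : Lit (Atom D ar) := ⟨.dom T.goal, true⟩ with hp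
    have hmem : ∀ l, l ∈ [p, p.neg].filter (· ∉ s.I) ↔ (l = p ∨ l = p.neg) ∧ l ∉ s.I := by
      intro l; simp [List.mem_filter]
    refine ⟨[p, p.neg].filter (· ∉ s.I), ?_, fun l hl => ?_, fun hc => ?_⟩
    · refine List.Nodup.filter _ ?_
      simp [(Lit.neg_ne p).symm]
    · obtain ⟨h1, h2⟩ := (hmem l).1 hl
      refine ⟨h2, Or.inl ⟨_, h.goal_mem, p, rfl, ?_⟩, fun M hM2 hMg hI => absurd ⟨M, hM2, hMg, hI⟩ hM⟩
      rcases h1 with rfl | rfl <;> rfl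
    · exfalso
      have : ∀ l, l = p ∨ l = p.neg → l ∈ extend s.I ([p, p.neg].filter (· ∉ s.I)) := by
        intro l hl
        by_cases hlI : l ∈ s.I
        · exact Or.inl hlI
        · exact Or.inr ((hmem l).2 ⟨hl, hlI⟩)
      exact hc p (this _ (Or.inl rfl)) (this _ (Or.inr rfl))

theorem exists_checkLiteral (hJ : {l | s.J l ≠ none}.Finite) (l : Lit (Atom D ar))
    (q : List (Lit (Atom D ar))) : ∃ q', CheckLiteral s l q q' := by
  classical
  have hfin : {m | ∃ S, s.J m = some S ∧ (l.neg ∈ S ∨ m = l.neg)}.Finite :=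
    hJ.subset fun m ⟨S, hS, _⟩ => by simp [hS]
  by_cases h : s.Dd l.atom ≠ none ∧ s.J l = none
  · exact ⟨_, [l], hfin.toFinset.toList, rfl, Or.inl ⟨h, rfl⟩, Finset.nodup_toList _,
      fun m => by simp⟩
  · exact ⟨_, [], hfin.toFinset.toList, rfl, Or.inr ⟨h, rfl⟩, Finset.nodup_toList _,
      fun m => by simp⟩

theorem exists_checkLiterals (hJ : {l | s.J l ≠ none}.Finite) (L q : List (Lit (Atom D ar))) :
    ∃ q', CheckLiterals s L q q' := by
  induction L generalizing q with
  | nil => exact ⟨q, .nil q⟩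
  | cons l L ih =>
    obtain ⟨q', h⟩ := exists_checkLiteral hJ l q
    obtain ⟨q'', h'⟩ := ih q'
    exact ⟨q'', .cons l L q q' q'' h h'⟩

theorem exists_requeue {J : JGraph D ar} (hJ : {l | J l ≠ none}.Finite)
    (B : Set (Lit (Atom D ar))) (q : List (Lit (Atom D ar))) : ∃ q', Requeue J B q q' := by
  classical
  have hfin : {m | ∃ S, J m = some S ∧ ∃ b ∈ B, b ∈ S}.Finite :=
    hJ.subset fun m ⟨S, hS, _⟩ => by simp [hS]
  exact ⟨_, hfin.toFinset.toList, rfl, Finset.nodup_toList _, fun m => by simp⟩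

open Classical in
theorem finite_update_none {J : JGraph D ar} (hJ : {l | J l ≠ none}.Finite)
    (l : Lit (Atom D ar)) : {m | Function.update J l none m ≠ none}.Finite := by
  refine hJ.subset fun m hm => ?_
  by_cases h : m = l
  · subst h; simp at hm
  · simpa [h] using hm

theorem exists_lazyGround (hJ : {l | s.J l ≠ none}.Finite) (l : Lit (Atom D ar)) :
    ∃ s', LazyGround s l s' := by
  classical
  by_cases hv : HasValid s l
  · exact ⟨_, .keep hv⟩
  by_cases hn : Needs s l
  · obtain ⟨φ, hφ⟩ := Option.ne_none_iff_exists'.1 hn.2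
    obtain ⟨g, new, hs⟩ := OneStep.exists_step s.I l.atom φ
    obtain ⟨q', hq⟩ := exists_requeue (finite_update_none (finite_update_none hJ l) l.neg)
      {l, l.neg} s.queue
    exact ⟨_, .split φ g new _ q' hv hn hφ hs rfl hq⟩
  · obtain ⟨q', hq⟩ := exists_requeue (finite_update_none hJ l) {l} s.queue
    exact ⟨_, .discard _ q' hv hn rfl hq⟩

theorem Inv.exists_step (h : Inv T Iin s) : ∃ c, Step Iin (.running s) c := by
  obtain ⟨L, hL⟩ := h.search.exists_propagates
  obtain ⟨q, hq⟩ := exists_checkLiterals h.just.finite L s.queue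
  by_cases hc : Consistent (extend s.I L)
  · cases q with
    | cons l q =>
      obtain ⟨s', hs'⟩ := exists_lazyGround (s := { s with I := extend s.I L, queue := q })
        h.just.finite l
      exact ⟨_, .justify s s' L q l hL hq hc hs'⟩
    | nil =>
      by_cases hm : IsGroundModel s (extend s.I L)
      · exact ⟨_, .success s L hL hq hc hm⟩
      -- Complete assignments that are not models are detected as conflicts, so an unknown ground
      -- atom must be left to choose.
      · obtain ⟨a, ha, hna⟩ : ∃ a ∈ groundAtoms s, ¬ ((⟨a, true⟩ : Lit (Atom D ar)) ∈
            extend s.I L ∨ (⟨a, false⟩ : Lit (Atom D ar)) ∈ extend s.I L) := by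
          by_contra! hno
          exact hm ((hL.2.2 hc).2 (TwoValuedOn.of_mem_or hc hno))
        rw [not_or] at hna
        obtain ⟨q', hq'⟩ := exists_checkLiteral h.just.finite (⟨a, true⟩ : Lit (Atom D ar)) []
        exact ⟨_, .choose s L q' ⟨a, true⟩ hL hq hc hm ha hna.1 hna.2 hq'⟩
  · cases ht : s.trail with
    | nil => exact ⟨_, .fail s L hL hc ht⟩
    | cons I' t' =>
      have htr := h.search.trail
      rw [ht] at htr
      cases htr with
      | cons _ _ _ d ht' h1 h2 h3 h4 h5 =>
        -- The learned clause negates all decisions. At the last backjump point the earlier ones are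
        -- still true and the last one, `d`, is unknown, so its complement is the unit literal.
        obtain ⟨C, hCI, hC⟩ := ht'.exists_decisions
        refine ⟨_, .backjump s L q {m | m.neg ∈ insert d C} [] t' I' hL hq hc ht
          ⟨fun M hM2 hM hI => ?_, fun m hm => ?_, d.neg, ?_, h4, by simpa using h3,
            fun m hm hne => ?_⟩⟩
        · have hMt := h.search.mem_targetModels hM2 hM hI
          by_contra! hno
          have hsub : ∀ m ∈ insert d C, m ∈ M := by
            intro m hm
            by_contra hmM
            exact hno m.neg (by simpa using hm) ((hM2.neg_mem_iff m).2 hmM)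
          refine hc (hM2.consistent.mono (hL.subset h.search hMt (h5 M hMt
            (hC M hMt fun m hm => hsub m (Or.inr hm)) (hsub d (Or.inl rfl)))))
        · rcases hm with hm | hm
          · rw [hm]; exact Or.inl h2
          · exact Or.inl (h1 (hCI hm))
        · simp
        · rcases hm with hm | hm
          · exact absurd (by rw [← hm, Lit.neg_neg]) hne
          · exact hCI hm

end Progress

/-! ### Termination on finite domains: the size of the delayed rules -/

section Size

variable {D : Type u} {V : Type v} {ar : V → ℕ}

open Classical in
/-- The size of a domain formula over a finite domain. -/
noncomputable def DFormula.size [Fintype D] {A : Type w} : DFormula D A → ℕ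
  | lit _ => 1
  | conj n f => 1 + ∑ i : Fin n, (1 + (f i).size)
  | disj n f => 1 + ∑ i : Fin n, (1 + (f i).size)
  | all S f => 1 + ∑ d : D, if d ∈ S then 1 + (f d).size else 0
  | ex S f => 1 + ∑ d : D, if d ∈ S then 1 + (f d).size else 0

theorem DFormula.finite_lits [Finite D] {A : Type w} (φ : DFormula D A) : φ.lits.Finite := by
  induction φ with
  | lit l => exact Set.finite_singleton l
  | conj n f ih | disj n f ih =>
    refine (Set.finite_iUnion ih).subset ?_
    rintro l ⟨i, hl⟩
    exact Set.mem_iUnion.2 ⟨i, hl⟩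
  | all S f ih | ex S f ih =>
    refine (Set.finite_iUnion ih).subset ?_
    rintro l ⟨i, _, hl⟩
    exact Set.mem_iUnion.2 ⟨i, hl⟩

theorem DFormula.finite_atoms [Finite D] {A : Type w} (φ : DFormula D A) : φ.atoms.Finite := by
  refine (φ.finite_lits.image Lit.atom).subset fun a ha => ?_
  obtain ⟨l, hl, rfl⟩ := (mem_atoms_iff _ _).1 ha
  exact ⟨l, hl, rfl⟩

/-- The size of the body of a rule, zero if there is no rule. -/
noncomputable def bodySize [Fintype D] {A : Type w} (o : Option (DFormula D A)) : ℕ :=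
  o.elim 0 DFormula.size

@[simp] theorem bodySize_none [Fintype D] {A : Type w} :
    bodySize (none : Option (DFormula D A)) = 0 := rfl

@[simp] theorem bodySize_some [Fintype D] {A : Type w} (φ : DFormula D A) :
    bodySize (some φ) = φ.size := rfl

theorem Part.bodySize_le [Fintype D] {h : Atom D ar} {p : Pos D} {ψ g : DFormula D (Atom D ar)}
    {o : Option (DFormula D (Atom D ar))} (hp : Part h p ψ g o) : bodySize o ≤ ψ.size := by
  cases hp <;> simp

open Classical in
theorem sum_ite_diff_singleton [Fintype D] {S S' : Set D} {d : D} (hd : d ∈ S)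
    (hS : S' = S \ {d}) (f : D → ℕ) : (∑ c : D, if c ∈ S then f c else 0) =
      f d + ∑ c : D, if c ∈ S' then f c else 0 := by
  have h1 : (∑ c : D, if c = d then f c else 0) = f d := by simp
  rw [← h1, ← Finset.sum_add_distrib]
  refine Finset.sum_congr rfl fun c _ => ?_
  by_cases hc : c = d
  · subst hc; simp [hd, hS]
  · simp [hc, hS]

open Classical in
-- Each child contributes one more than its own size. This surplus is what makes splitting off a
-- single part decrease the total, since the remainder is again a formula with its own root.
theorem OneStep.size_lt [Fintype D] {I : Struc (Atom D ar)} {h : Atom D ar}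
    {φ g : DFormula D (Atom D ar)} {new : Pos D → Option (DFormula D (Atom D ar))}
    (hs : OneStep I h φ g new) : ∃ P : Finset (Pos D), (∀ p, new p ≠ none → p ∈ P) ∧
      ∑ p ∈ P, bodySize (new p) < φ.size := by
  cases hs with
  | lit l => exact ⟨∅, fun p hp => absurd rfl hp, by simp [DFormula.size]⟩
  | conj n f | disj n f =>
    refine ⟨Finset.univ.image fun i : Fin n => Pos.sub (i : ℕ), fun p hp => ?_, ?_⟩
    · cases p with
      | sub i =>
        have hi : i < n := by
          by_contra hi
          simp [hi] at hp
        exact Finset.mem_image.2 ⟨⟨i, hi⟩, Finset.mem_univ _, rfl⟩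
      | elem d => simp at hp
      | rest => simp at hp
    · rw [Finset.sum_image fun i _ j _ hij => Fin.ext (Pos.sub.inj hij)]
      simp [DFormula.size, Finset.sum_add_distrib]
      omega
  | all S f | ex S f =>
    refine ⟨Finset.univ.image Pos.elem, fun p hp => ?_, ?_⟩
    · cases p with
      | elem d => simp
      | sub i => simp at hp
      | rest => simp at hp
    · rw [Finset.sum_image fun i _ j _ hij => Pos.elem.inj hij]
      rw [DFormula.size, Nat.lt_one_add_iff]
      refine Finset.sum_le_sum fun d _ => ?_
      by_cases hd : d ∈ S <;> simp [hd]
  | disjTrue n f i g o _ hpart | conjFalse n f i g o _ hpart =>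
    refine ⟨{Pos.sub (i : ℕ), Pos.rest}, fun p hp => ?_, ?_⟩
    · cases p with
      | sub j =>
        by_cases hj : j = i
        · simp [hj]
        · simp [hj] at hp
      | elem d => simp at hp
      | rest => simp
    · rw [Finset.sum_pair (by simp)]
      have := hpart.bodySize_le
      simp only [if_true, bodySize_some, DFormula.size, Fin.sum_univ_succAbove _ i]
      omega
  | exTrue S f d g o _ hd hpart | allFalse S f d g o _ hd hpart =>
    refine ⟨{Pos.elem d, Pos.rest}, fun p hp => ?_, ?_⟩
    · cases p with
      | elem c =>
        by_cases hj : c = d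
        · simp [hj]
        · simp [hj] at hp
      | sub j => simp at hp
      | rest => simp
    · rw [Finset.sum_pair (by simp)]
      have := hpart.bodySize_le
      simp only [if_true, bodySize_some, DFormula.size]
      rw [sum_ite_diff_singleton hd rfl]
      omega

/-- The size of the delayed rules. -/
noncomputable def State.delayedSize [Fintype D] (s : State D ar) : ℕ :=
  ∑ᶠ a, bodySize (s.Dd a)

section Split

variable {T : Theory D ar} {s : State D ar} {h : Atom D ar} {φ g : DFormula D (Atom D ar)}
  {new : Pos D → Option (DFormula D (Atom D ar))} {J' : JGraph D ar} {q' : List (Lit (Atom D ar))}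

theorem State.finite_delayed_split [Finite D] {I : Struc (Atom D ar)} (hs : OneStep I h φ g new)
    (hfin : {a | s.Dd a ≠ none}.Finite) : {a | (s.split h g new J' q').Dd a ≠ none}.Finite := by
  classical
  have := Fintype.ofFinite D
  obtain ⟨P, hP, -⟩ := hs.size_lt
  refine (hfin.union (P.finite_toSet.image (Atom.tse h))).subset fun a ha => ?_
  by_cases hah : a = h
  · subst hah; simp at ha
  · by_cases ht : ∃ p, a = .tse h p
    · obtain ⟨p, rfl⟩ := ht
      rw [Set.mem_ofPred_eq, State.split_Dd_tse] at ha
      exact Or.inr ⟨p, hP p ha, rfl⟩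
    · push Not at ht
      rw [Set.mem_ofPred_eq, State.split_Dd_other hah ht] at ha
      exact Or.inl ha

theorem RulesInv.delayedSize_split_lt [Fintype D] (hr : RulesInv T s) {I : Struc (Atom D ar)}
    (hs : OneStep I h φ g new) (hφ : s.Dd h = some φ) (hfin : {a | s.Dd a ≠ none}.Finite) :
    (s.split h g new J' q').delayedSize < s.delayedSize := by
  classical
  obtain ⟨P, hP, hlt⟩ := hs.size_lt
  have hinj : Function.Injective (Atom.tse h : Pos D → Atom D ar) := fun p p' e => (Atom.tse.inj e).2
  set v : Atom D ar → ℕ := fun a => if a = h then φ.size else 0 with hv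
  set z : Atom D ar → ℕ := fun a => ∑ p ∈ P, if a = .tse h p then bodySize (new p) else 0 with hz
  have hvsum : ∑ᶠ a, v a = φ.size := by
    rw [finsum_eq_single v h fun a ha => by simp [hv, ha]]
    simp [hv]
  have hzsupp : Function.support z ⊆ (P.image (Atom.tse h) : Finset (Atom D ar)) := by
    intro a ha
    obtain ⟨p, hp, hne⟩ := Finset.exists_ne_zero_of_sum_ne_zero ha
    have : a = .tse h p := by
      by_contra h'
      simp [h'] at hne
    simp only [Finset.coe_image, this]
    exact ⟨p, hp, rfl⟩
  have hztse : ∀ p, z (.tse h p) = bodySize (new p) := by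
    intro p
    simp only [hz, Atom.tse.injEq, true_and]
    rw [Finset.sum_ite_eq]
    split_ifs with hp
    · rfl
    · have : new p = none := by
        by_contra h'
        exact hp (hP p h')
      simp [this]
  have hzsum : ∑ᶠ a, z a = ∑ p ∈ P, bodySize (new p) := by
    rw [finsum_eq_sum_of_support_subset z hzsupp, Finset.sum_image fun p _ p' _ e => hinj e]
    exact Finset.sum_congr rfl fun p _ => hztse p
  -- A balance without subtraction: `v` accounts for the removed body and `z` for the added ones.
  have hpt : ∀ a, bodySize ((s.split h g new J' q').Dd a) + v a = bodySize (s.Dd a) + z a := by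
    intro a
    by_cases hah : a = h
    · subst hah
      have : z a = 0 := Finset.sum_eq_zero fun p _ => if_neg (Atom.tse_ne a p).symm
      simp [hv, hφ, this]
    · by_cases ht : ∃ p, a = .tse h p
      · obtain ⟨p, rfl⟩ := ht
        have h0 := (State.Dgd_eq_none.1 (hr.delayed_tse hφ p)).2
        rw [hztse, State.split_Dd_tse, h0]
        simp [hv, hah]
      · push Not at ht
        have : z a = 0 := Finset.sum_eq_zero fun p _ => if_neg (ht p)
        rw [State.split_Dd_other hah ht, this]
        simp [hv, hah]
  have hsupp : ∀ t : State D ar, {a | t.Dd a ≠ none}.Finite →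
      (Function.support fun a => bodySize (t.Dd a)).Finite := by
    intro t ht
    refine ht.subset fun a ha h' => ?_
    simp [h'] at ha
  have hsum := finsum_congr hpt
  rw [finsum_add_distrib (hsupp _ (State.finite_delayed_split hs hfin)),
    finsum_add_distrib (hsupp _ hfin), hvsum, hzsum] at hsum
  · simp only [State.delayedSize]
    omega
  · exact (Finset.finite_toSet _).subset hzsupp
  · refine (Set.finite_singleton h).subset fun a ha => ?_
    by_contra h'
    simp [hv, Set.mem_singleton_iff.not.1 h'] at ha

end Split

end Size

/-! ### Termination on finite domains: search, queue and the combined measure -/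

section Termination

variable {D : Type u} {V : Type v} {ar : V → ℕ}

/-! ### Encoding of lists of numbers in lexicographic order -/

/-- The number with the given digits (the first digit of the list being the least significant one)
in base `B`, where the last digit of the list has weight `B ^ M`. -/
def encode (B M : ℕ) : List ℕ → ℕ
  | [] => 0
  | x :: t => (x + 1) * B ^ (M - t.length) + encode B M t

/-- The carry estimate: as every digit `x + 1` is at most `B - 1`, filling in lower digits costs
less than one unit of the lowest digit of `r`. For `r = []` that unit is `B ^ (M + 1)`, which bounds
all codes. -/
theorem encode_append_le {B M : ℕ} (t r : List ℕ) (ht : ∀ x ∈ t, x + 2 ≤ B)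
    (hlen : (t ++ r).length ≤ M + 1) :
    encode B M (t ++ r) + B ^ (M + 1 - (t ++ r).length) ≤
      encode B M r + B ^ (M + 1 - r.length) := by
  induction t with
  | nil => simp
  | cons x t ih =>
    refine le_trans ?_ (ih (fun y hy => ht y (List.mem_cons_of_mem _ hy))
      (by simp at hlen ⊢; omega))
    have hx := ht x List.mem_cons_self
    simp only [List.cons_append, encode, List.length_cons] at hlen ⊢
    have e1 : M + 1 - ((t ++ r).length + 1) = M - (t ++ r).length := by omega
    have e2 : M + 1 - (t ++ r).length = (M - (t ++ r).length) + 1 := by omega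
    rw [e1, e2, pow_succ]
    have := Nat.mul_le_mul_left (B ^ (M - (t ++ r).length)) hx
    nlinarith

/-- Levels above the backjump point are dropped, but the digit there grows by one for the new unit
clause, which outweighs everything dropped. -/
theorem encode_lt_of_backjump {B M e n : ℕ} {t r : List ℕ} (hB : 0 < B)
    (ht : ∀ x ∈ e :: t, x + 2 ≤ B) (hlen : (e :: (t ++ n :: r)).length ≤ M + 1) :
    encode B M (e :: (t ++ n :: r)) < encode B M ((n + 1) :: r) := by
  have h := encode_append_le (e :: t) (n :: r) ht hlen
  have e1 : M + 1 - (n :: r).length = M - r.length := by simp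
  rw [e1] at h
  have hpos : 0 < B ^ (M + 1 - (e :: t ++ n :: r).length) := pow_pos hB _
  simp only [encode, List.cons_append] at h hpos ⊢
  nlinarith

theorem encode_lt_pow {B M : ℕ} {t : List ℕ} (hB : 0 < B) (ht : ∀ x ∈ t, x + 2 ≤ B)
    (hlen : t.length ≤ M + 1) : encode B M t < B ^ (M + 1) := by
  have h := encode_append_le t [] ht (by simpa using hlen)
  have hpos : 0 < B ^ (M + 1 - t.length) := pow_pos hB _
  simp only [List.append_nil, encode, List.length_nil] at h
  simp at h
  omega

/-! ### The search measure -/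

/-- The ground atoms whose value is not given by the input structure. -/
def freeAtoms (Iin : Struc (DomAtom D ar)) (s : State D ar) : Set (Atom D ar) :=
  {a | a ∈ groundAtoms s ∧ ∀ b, (⟨a, b⟩ : Lit (Atom D ar)) ∉ embed Iin}

/-- The number of literals over `F`. -/
noncomputable def count {A : Type w} (F : Set A) (I : Struc A) : ℕ := {l | l ∈ I ∧ l.atom ∈ F}.ncard

section Count

variable {A : Type w} {F : Set A} {I I' : Struc A}

theorem finite_count (hF : F.Finite) (I : Struc A) : {l | l ∈ I ∧ l.atom ∈ F}.Finite := by
  refine ((hF.image fun a => (⟨a, true⟩ : Lit A)).union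
    (hF.image fun a => (⟨a, false⟩ : Lit A))).subset ?_
  rintro ⟨a, b⟩ ⟨-, h⟩
  cases b
  · exact Or.inr ⟨a, h, rfl⟩
  · exact Or.inl ⟨a, h, rfl⟩

theorem count_mono (hF : F.Finite) (h : I ⊆ I') : count F I ≤ count F I' :=
  Set.ncard_le_ncard (fun _ hl => ⟨h hl.1, hl.2⟩) (finite_count hF I')

theorem count_lt (hF : F.Finite) (h : I ⊆ I') {l : Lit A} (hl : l ∈ I') (hn : l ∉ I)
    (ha : l.atom ∈ F) : count F I < count F I' :=
  Set.ncard_lt_ncard ⟨fun _ hl => ⟨h hl.1, hl.2⟩, fun h' => hn (h' ⟨hl, ha⟩).1⟩ (finite_count hF I')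

theorem count_le (hF : F.Finite) (h : Consistent I) : count F I ≤ F.ncard := by
  refine Set.ncard_le_ncard_of_injOn Lit.atom (fun l hl => hl.2) ?_ hF
  rintro l ⟨hl, -⟩ m ⟨hm, -⟩ e
  rcases Lit.eq_or_eq_neg e with e | e
  · exact e
  · exact absurd (e ▸ hl) (h m hm)

end Count

/-- Some clause is unit. -/
def HasUnit (Sg : Set (Set (Lit (Atom D ar)))) (I : Struc (Atom D ar)) : Prop :=
  ∃ C ∈ Sg, ∃ l ∈ C, l ∉ I ∧ l.neg ∉ I ∧ ∀ m ∈ C, m ≠ l → m.neg ∈ I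

open Classical in
/-- The numbers of the literals at the decision levels; a unit clause counts as a literal. -/
noncomputable def levels (F : Set (Atom D ar)) (s : State D ar) : List ℕ :=
  (count F s.I + if HasUnit s.Sg s.I then 1 else 0) :: s.trail.map (count F)

/-- A digit plus two is at most `F.ncard + 3`, a count being at most `F.ncard` and the unit bonus at
most one. There are at most `F.ncard + 1` levels, so the highest exponent is `F.ncard`. -/
noncomputable def searchValue (F : Set (Atom D ar)) (s : State D ar) : ℕ :=
  encode (F.ncard + 3) F.ncard (levels F s)

variable {T : Theory D ar} {Iin : Struc (DomAtom D ar)} {s s' : State D ar}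

/-- The additional invariants for a finite domain. -/
structure FinInv (Iin : Struc (DomAtom D ar)) (s : State D ar) : Prop where
  delayed : {a | s.Dd a ≠ none}.Finite
  free : (freeAtoms Iin s).Finite

/-- Each choice adds a literal that was unknown at the structure saved for it. -/
theorem TrailOk.length_le {F : Set (Atom D ar)} {G : Set (Struc (Atom D ar))}
    {I₀ I : Struc (Atom D ar)} {t : List (Struc (Atom D ar))} (h : TrailOk G I₀ I t)
    (hF : F.Finite) (hI : ∀ l ∈ I, l ∉ I₀ → l.neg ∉ I₀ → l.atom ∈ F) :
    t.length ≤ count F I := by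
  induction h with
  | nil => simp
  | cons I I' t d ht h1 h2 h3 h4 h5 ih =>
    have := ih fun l hl => hI l (h1 hl)
    have hd := hI d h2 (fun h => h3 (ht.base h)) fun h => h4 (ht.base h)
    have := count_lt hF h1 h2 h3 hd
    simp only [List.length_cons]
    omega

theorem TrailOk.subset_of_mem {G : Set (Struc (Atom D ar))} {I₀ I : Struc (Atom D ar)}
    {t : List (Struc (Atom D ar))} (h : TrailOk G I₀ I t) {I' : Struc (Atom D ar)} (hI' : I' ∈ t) :
    I' ⊆ I := by
  obtain ⟨t₁, t₂, rfl⟩ := List.append_of_mem hI'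
  exact h.suffix.2

theorem mem_freeAtoms_of_notMem {l : Lit (Atom D ar)} (hg : l.atom ∈ groundAtoms s)
    (h1 : l ∉ embed Iin) (h2 : l.neg ∉ embed Iin) : l.atom ∈ freeAtoms Iin s := by
  refine ⟨hg, fun b hb => ?_⟩
  rcases Lit.eq_or_eq_neg (l := ⟨l.atom, b⟩) (m := l) rfl with e | e
  · exact h1 (e ▸ hb)
  · exact h2 (e ▸ hb)

theorem SearchInv.mem_freeAtoms (h : SearchInv T Iin s) {l : Lit (Atom D ar)} (hl : l ∈ s.I)
    (h1 : l ∉ embed Iin) (h2 : l.neg ∉ embed Iin) : l.atom ∈ freeAtoms Iin s :=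
  mem_freeAtoms_of_notMem ((h.ground l hl).resolve_left h1) h1 h2

theorem Inv.levels_le (h : Inv T Iin s) (hF : (freeAtoms Iin s).Finite) :
    ∀ x ∈ levels (freeAtoms Iin s) s, x + 2 ≤ (freeAtoms Iin s).ncard + 3 := by
  intro x hx
  rcases List.mem_cons.1 hx with rfl | hx
  · have := count_le hF h.consistent
    split_ifs <;> omega
  · obtain ⟨I', hI', rfl⟩ := List.mem_map.1 hx
    have := count_le hF (h.consistent.mono (h.search.trail.subset_of_mem hI'))
    omega

theorem Inv.length_levels_le (h : Inv T Iin s) (hF : (freeAtoms Iin s).Finite) :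
    (levels (freeAtoms Iin s) s).length ≤ (freeAtoms Iin s).ncard + 1 := by
  have h1 := h.search.trail.length_le hF fun l hl => h.search.mem_freeAtoms hl
  have h2 := count_le hF h.consistent
  simp only [levels, List.length_cons, List.length_map]
  omega

theorem Inv.searchValue_lt (h : Inv T Iin s) (hF : (freeAtoms Iin s).Finite) :
    searchValue (freeAtoms Iin s) s < ((freeAtoms Iin s).ncard + 3) ^ ((freeAtoms Iin s).ncard + 1) :=
  encode_lt_pow (by omega) (h.levels_le hF) (h.length_levels_le hF)

/-- Propagation of at least one literal increases the number of literals. -/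
theorem Inv.count_lt_of_propagates (h : Inv T Iin s) (hF : (freeAtoms Iin s).Finite)
    {L : List (Lit (Atom D ar))} (hL : Propagates s L) (hc : Consistent (extend s.I L))
    (hne : L ≠ []) : count (freeAtoms Iin s) s.I < count (freeAtoms Iin s) (extend s.I L) := by
  obtain ⟨l, hl⟩ := List.exists_mem_of_ne_nil L hne
  obtain ⟨h1, h2, -⟩ := hL.2.1 l hl
  have hb := h.search.trail.base
  exact count_lt hF (subset_extend _ _) (Or.inr hl) h1 (mem_freeAtoms_of_notMem h2
    (fun h' => h1 (hb h')) fun h' => hc l (Or.inr hl) (Or.inl (hb h')))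

open Classical in
-- A unit clause forces unit propagation to add a literal, which pays back the bonus counted for it.
theorem Inv.count_le_of_propagates (h : Inv T Iin s) (hF : (freeAtoms Iin s).Finite)
    {L : List (Lit (Atom D ar))} (hL : Propagates s L) (hc : Consistent (extend s.I L)) :
    (count (freeAtoms Iin s) s.I + if HasUnit s.Sg s.I then 1 else 0) ≤
      count (freeAtoms Iin s) (extend s.I L) := by
  split_ifs with hu
  · obtain ⟨C, hC, l, hl, h1, -, h3⟩ := hu
    refine h.count_lt_of_propagates hF hL hc ?_
    rintro rfl
    have := (hL.2.2 hc).1 C hC l hl h3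
    rw [extend_nil] at this
    exact h1 this
  · exact count_mono hF (subset_extend _ _)

/-! ### The measure of the queue -/

theorem needs_congr (h1 : s'.I = s.I) (h2 : s'.Dd = s.Dd) (l : Lit (Atom D ar)) :
    Needs s' l ↔ Needs s l := by rw [Needs, Needs, h1, h2]

/-- The number of literals that have a direct justification, but do not need it. -/
noncomputable def superfluous (s : State D ar) : ℕ := {l | s.J l ≠ none ∧ ¬ Needs s l}.ncard

open Classical in
/-- The number of occurrences on the queue of literals that neither have nor need a direct
justification. -/
noncomputable def idle (s : State D ar) : ℕ :=
  s.queue.countP fun l => s.J l = none ∧ ¬ Needs s l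

/-- The measure of the queue. -/
noncomputable def queueMeasure (s : State D ar) : ℕ ×ₗ ℕ ×ₗ ℕ :=
  toLex (superfluous s, toLex (idle s, s.queue.length))

open Classical in
theorem idle_congr (hI : s'.I = s.I) (hDd : s'.Dd = s.Dd) {l : Lit (Atom D ar)}
    {q : List (Lit (Atom D ar))} (hq' : s'.queue = q) (hq : s.queue = l :: q)
    (hJ : ∀ m ∈ q, s'.J m = none → ¬ Needs s m → s.J m = none) : idle s' ≤ idle s := by
  unfold idle
  rw [hq', hq]
  refine le_trans (List.countP_mono_left fun m hm h => ?_) (List.sublist_cons_self l q).countP_le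
  simp only [decide_eq_true_eq, needs_congr hI hDd] at h ⊢
  exact ⟨hJ m hm h.1 h.2, h.2⟩

open Classical in
/-- Processing a literal on the queue, without splitting off a rule. -/
theorem queueMeasure_lt {l : Lit (Atom D ar)} {q : List (Lit (Atom D ar))}
    (hfin : {l | s.J l ≠ none}.Finite) (hq : s.queue = l :: q)
    (hs : LazyGround { s with queue := q } l s') (hDd : s'.Dd = s.Dd) :
    queueMeasure s' < queueMeasure s := by
  have hq1 : q.length < s.queue.length := by simp [hq]
  cases hs with
  | keep hv =>
    refine Prod.Lex.toLex_lt_toLex'.2 ⟨le_rfl, fun _ => Prod.Lex.toLex_lt_toLex'.2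
      ⟨idle_congr rfl rfl rfl hq fun m _ h _ => h, fun _ => hq1⟩⟩
  | build φ S _ hn hφ _ _ =>
    have hn' : Needs s l := hn
    refine Prod.Lex.toLex_lt_toLex'.2 ⟨le_of_eq ?_, fun _ => Prod.Lex.toLex_lt_toLex'.2
      ⟨idle_congr rfl rfl rfl hq fun m _ h hm => ?_, fun _ => hq1⟩⟩
    · simp only [superfluous]
      congr 1
      ext m
      simp only [Set.mem_ofPred_eq, Needs]
      by_cases hml : m = l
      · subst hml
        simp only [Needs] at hn'
        tauto
      · simp [hml]
    · by_cases hml : m = l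
      · subst hml; exact absurd hn' hm
      · simpa [hml] using h
  | split φ g new J' q' _ _ hφ =>
    have := congrFun hDd l.atom
    simp only [if_true] at this
    rw [← this] at hφ
    cases hφ
  | discard J' q' _ hn hJ' hq' =>
    have hn' : ¬ Needs s l := hn
    have hsub : {m | J' m ≠ none ∧ ¬ Needs s m} ⊆ {m | s.J m ≠ none ∧ ¬ Needs s m} := by
      rintro m ⟨h1, h2⟩
      refine ⟨?_, h2⟩
      by_cases hml : m = l
      · subst hml; simp [hJ'] at h1
      · simpa [hJ', hml] using h1
    have hfin' : {m | s.J m ≠ none ∧ ¬ Needs s m}.Finite := hfin.subset fun m hm => hm.1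
    refine Prod.Lex.toLex_lt_toLex'.2 ⟨Set.ncard_le_ncard hsub hfin', fun he =>
      Prod.Lex.toLex_lt_toLex.2 (Or.inl ?_)⟩
    have he' : {m | J' m ≠ none ∧ ¬ Needs s m} = {m | s.J m ≠ none ∧ ¬ Needs s m} :=
      Set.eq_of_subset_of_ncard_le hsub (le_of_eq (Eq.symm he)) hfin'
    -- An unchanged first component means that nothing was discarded: `l` was idle. Every requeued
    -- literal has a justification and so is not idle, and removing `l` lowers the idle count.
    have hJl : s.J l = none := by
      by_contra h
      have : l ∈ {m | J' m ≠ none ∧ ¬ Needs s m} := he' ▸ ⟨h, hn'⟩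
      simp [hJ'] at this
    have hJJ : J' = s.J := by
      rw [hJ']; simp only [← hJl]; exact Function.update_eq_self _ _
    obtain ⟨q₁, rfl, -, hq₁⟩ := hq'
    have h0 : q₁.countP (fun m => decide (s.J m = none ∧ ¬ Needs s m)) = 0 := by
      rw [List.countP_eq_zero]
      intro m hm
      obtain ⟨S, hS, -⟩ := (hq₁ m).1 hm
      rw [hJJ] at hS
      simp [hS]
    change (q ++ q₁).countP (fun m => decide (J' m = none ∧ ¬ Needs s m)) <
      s.queue.countP (fun m => decide (s.J m = none ∧ ¬ Needs s m))
    rw [hJJ, hq, List.countP_append, h0, List.countP_cons_of_pos]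
    · omega
    · simp [hJl, hn']

/-! ### The measure of a state -/

/-- The measure that decreases in each iteration. -/
noncomputable def State.measure [Fintype D] (Iin : Struc (DomAtom D ar)) (s : State D ar) :
    ℕ ×ₗ ℕ ×ₗ ℕ ×ₗ ℕ ×ₗ ℕ ×ₗ ℕ :=
  toLex (s.delayedSize, toLex
    (((freeAtoms Iin s).ncard + 3) ^ ((freeAtoms Iin s).ncard + 1) -
      searchValue (freeAtoms Iin s) s,
    toLex ((freeAtoms Iin s).ncard - count (freeAtoms Iin s) s.I, queueMeasure s)))

/-- The bound on the new value keeps the truncated subtraction strictly monotone. -/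
theorem measure_lt_of_searchValue [Fintype D] (h' : Inv T Iin s')
    (hDd : s'.Dd = s.Dd) (hfree : freeAtoms Iin s' = freeAtoms Iin s)
    (hF : (freeAtoms Iin s).Finite)
    (hlt : searchValue (freeAtoms Iin s) s < searchValue (freeAtoms Iin s) s') :
    s'.measure Iin < s.measure Iin := by
  have h1 := h'.searchValue_lt (hfree ▸ hF)
  refine Prod.Lex.toLex_lt_toLex'.2 ⟨le_of_eq ?_, fun _ => Prod.Lex.toLex_lt_toLex.2 (Or.inl ?_)⟩
  · simp only [State.delayedSize, hDd]
  · rw [hfree] at h1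
    simp only [hfree]
    omega

/-- A learned clause may contain arbitrarily many complements of input literals, so the ground atoms
can grow. The atoms not valued by the input cannot, since the violated literals over them are
already ground. -/
theorem freeAtoms_backjump {L : List (Lit (Atom D ar))} {C : Set (Lit (Atom D ar))}
    {I' : Struc (Atom D ar)} {t' : List (Struc (Atom D ar))} {q : List (Lit (Atom D ar))}
    (hs : SearchInv T Iin s) (hr : RulesInv T s) (hp : Propagates s L)
    (hC : ∀ m ∈ C, m.neg ∈ extend s.I L) :
    freeAtoms Iin { s with Sg := insert C s.Sg, I := I', trail := t', queue := q } =
      freeAtoms Iin s := by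
  ext a
  refine and_congr_left fun hb => ⟨fun ha => ?_, fun ha => ?_⟩
  · rcases ha with ⟨C', hC' | hC', l, hl, rfl⟩ | ha
    · rw [hC'] at hl
      rcases (hs.propagate (q := q) hr hp).ground l.neg (hC l hl) with h | h
      · exact absurd h (hb _)
      · exact h
    · exact Or.inl ⟨C', hC', l, hl, rfl⟩
    · exact Or.inr ha
  · rcases ha with ⟨C', hC', hl⟩ | ha
    · exact Or.inl ⟨C', Set.mem_insert_of_mem _ hC', hl⟩
    · exact Or.inr ha

theorem LazyGround.same_search {l : Lit (Atom D ar)} (h : LazyGround s l s') :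
    s'.Sg = s.Sg ∧ s'.I = s.I ∧ s'.trail = s.trail := by
  cases h <;> exact ⟨rfl, rfl, rfl⟩

open Classical in
/-- Either a rule is split off, or the rules do not change. -/
theorem LazyGround.split_or_same {l : Lit (Atom D ar)} (h : LazyGround s l s') :
    (∃ φ g new J' q', s.Dd l.atom = some φ ∧ OneStep s.I l.atom φ g new ∧
      s' = s.split l.atom g new J' q') ∨ (s'.Dg = s.Dg ∧ s'.Dd = s.Dd) := by
  cases h with
  | keep => exact Or.inr ⟨rfl, rfl⟩
  | build => exact Or.inr ⟨rfl, rfl⟩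
  | split φ g new J' q' _ _ hφ hs => exact Or.inl ⟨φ, g, new, J', q', hφ, hs, rfl⟩
  | discard => exact Or.inr ⟨rfl, rfl⟩

theorem freeAtoms_congr (h0 : s'.Sg = s.Sg) (h1 : s'.Dg = s.Dg) :
    freeAtoms Iin s' = freeAtoms Iin s := by
  simp only [freeAtoms, groundAtoms_congr h0 h1]

theorem CheckLiterals.eq_of_nil {q q' : List (Lit (Atom D ar))} (h : CheckLiterals s [] q q') :
    q' = q := by
  cases h; rfl

theorem Step.measure_lt [Fintype D] (hstep : Step Iin (.running s) (.running s'))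
    (h : Inv T Iin s) (hfin : FinInv Iin s) : s'.measure Iin < s.measure Iin := by
  classical
  have hF := hfin.free
  have h' := hstep.inv h
  cases hstep with
  | backjump _ L q C t t' I' hp hc hcons ht hl =>
    have hfree := freeAtoms_backjump (I' := I') (t' := t') (q := q) h.search h.rules hp hl.2.1
    refine measure_lt_of_searchValue h' (s := s) rfl hfree hF ?_
    have hu : HasUnit (insert C s.Sg) I' := by
      obtain ⟨-, -, l, hlC, hl1, hl2, hl3⟩ := hl
      exact ⟨C, Set.mem_insert _ _, l, hlC, hl1, hl2, hl3⟩
    have hle := h.levels_le hF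
    have hlen := h.length_levels_le hF
    simp only [searchValue, levels, ht, List.map_append, List.map_cons] at hle hlen ⊢
    rw [if_pos hu]
    refine encode_lt_of_backjump (by omega) (fun x hx => hle x ?_) hlen
    rcases List.mem_cons.1 hx with rfl | hx
    · exact List.mem_cons_self
    · exact List.mem_cons_of_mem _ (List.mem_append_left _ hx)
  | choose _ L q l hp hc hcons _ hg h1 h2 hcl =>
    refine measure_lt_of_searchValue h' (s := s) rfl rfl hF ?_
    -- The saved level keeps a digit at least as large as the old one, bonus included, and a new
    -- nonzero digit is appended below it.
    have := h.count_le_of_propagates hF hp hcons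
    simp only [searchValue, levels, encode, List.map_cons]
    have h3 := Nat.mul_le_mul_right (((freeAtoms Iin s).ncard + 3) ^
      ((freeAtoms Iin s).ncard - (List.map (count (freeAtoms Iin s)) s.trail).length))
      (Nat.add_le_add_right this 1)
    refine lt_of_le_of_lt (Nat.add_le_add_right h3 _) (lt_add_of_pos_left _ ?_)
    positivity
  | justify _ _ L q l hp hc hcons hl =>
    have hinv := h.propagate hp hc hcons
    obtain ⟨hSg, hI, htr⟩ := hl.same_search
    rcases hl.split_or_same with ⟨φ, g, new, J', q', hφ, hs, rfl⟩ | ⟨hDg, hDd⟩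
    · refine Prod.Lex.toLex_lt_toLex.2 (Or.inl ?_)
      exact (h.rules.congr rfl rfl : RulesInv T { s with I := extend s.I L, queue := q })
        |>.delayedSize_split_lt hs hφ hfin.delayed
    · have hfree : freeAtoms Iin s' = freeAtoms Iin s := freeAtoms_congr hSg hDg
      have hcl := h.count_le_of_propagates hF hp hcons
      have hval : searchValue (freeAtoms Iin s) s ≤ searchValue (freeAtoms Iin s) s' := by
        simp only [searchValue, levels, encode, htr, hI]
        refine Nat.add_le_add_right (Nat.mul_le_mul_right _ ?_) _
        omega
      have hw : s'.delayedSize = s.delayedSize := by simp only [State.delayedSize, hDd]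
      refine Prod.Lex.toLex_lt_toLex'.2 ⟨hw.le, fun _ => Prod.Lex.toLex_lt_toLex'.2
        ⟨?_, fun _ => ?_⟩⟩
      · simp only [hfree]
        exact Nat.sub_le_sub_left hval _
      -- Propagating just the unit literal can leave the search value unchanged, the bonus turning
      -- into a count; the third component then decreases. If nothing is propagated, the old queue
      -- shrinks in its measure.
      · by_cases hL : L = []
        · subst hL
          have hq : s.queue = l :: q := hc.eq_of_nil.symm
          rw [extend_nil] at hI hl
          refine Prod.Lex.toLex_lt_toLex'.2 ⟨?_, fun _ => ?_⟩
          · simp only [hfree, hI]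
            exact le_rfl
          · exact queueMeasure_lt h.just.finite hq hl hDd
        · refine Prod.Lex.toLex_lt_toLex.2 (Or.inl ?_)
          have h3 := h.count_lt_of_propagates hF hp hcons hL
          have h4 := count_le hF hcons
          simp only [hfree, hI]
          omega

theorem finInv_initState [Finite D] (T : Theory D ar) (Iin : Struc (DomAtom D ar)) :
    FinInv Iin (initState T Iin) where
  delayed := by
    refine (T.defn.finite.biUnion (t := fun r => Set.range fun t : Fin (ar r.pred) → D =>
      (Atom.dom ⟨r.pred, t⟩ : Atom D ar)) fun r _ => Set.finite_range _).subset ?_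
    intro a ha
    obtain ⟨φ, hφ⟩ := Option.ne_none_iff_exists'.1 ha
    cases a with
    | dom b =>
      obtain ⟨r, hr, t, -, rfl, -⟩ := Definition.inst_eq_some.1 hφ
      exact Set.mem_biUnion hr ⟨t, rfl⟩
    | tse h p => cases hφ
  free := by
    refine (Set.finite_singleton (Atom.dom T.goal)).subset ?_
    rintro a ⟨⟨C, rfl, l, rfl, rfl⟩ | ⟨h, φ, hφ, -⟩, -⟩
    · rfl
    · cases hφ

theorem Step.finInv [Finite D] (hstep : Step Iin (.running s) (.running s'))
    (h : Inv T Iin s) (hfin : FinInv Iin s) : FinInv Iin s' := by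
  cases hstep with
  | backjump _ L q C t t' I' hp hc hcons ht hl =>
    refine ⟨hfin.delayed, ?_⟩
    rw [freeAtoms_backjump h.search h.rules hp hl.2.1]
    exact hfin.free
  | choose _ L q l hp hc hcons _ hg h1 h2 hcl => exact ⟨hfin.delayed, hfin.free⟩
  | justify _ _ L q l hp hc hcons hl =>
    rcases hl.split_or_same with ⟨φ, g, new, J', q', hφ, hs, rfl⟩ | ⟨hDg, hDd⟩
    · refine ⟨State.finite_delayed_split hs hfin.delayed, ?_⟩
      refine (hfin.free.union (g.finite_atoms.insert l.atom)).subset ?_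
      rintro a ⟨ha | ⟨b, ψ, hb, ha⟩, hn⟩
      · exact Or.inl ⟨Or.inl ha, hn⟩
      · by_cases hbl : b = l.atom
        · subst hbl
          rw [State.split_Dg_self] at hb
          obtain rfl := Option.some.inj hb
          exact Or.inr ha
        · rw [State.split_Dg_of_ne hbl] at hb
          exact Or.inl ⟨Or.inr ⟨b, ψ, hb, ha⟩, hn⟩
    · refine ⟨by rw [hDd]; exact hfin.delayed, ?_⟩
      rw [freeAtoms_congr (s := s) hl.same_search.1 hDg]
      exact hfin.free

theorem not_hasInfiniteRun [Finite D] (hin : IsInput T Iin) : ¬ HasInfiniteRun T Iin := by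
  rintro ⟨c, h0, hc⟩
  have := Fintype.ofFinite D
  have hrun : ∀ n, ∃ s, c n = .running s := by
    intro n
    have := hc n
    cases hcn : c n with
    | running s => exact ⟨s, rfl⟩
    | returned s => rw [hcn] at this; cases this
    | failed => rw [hcn] at this; cases this
  choose s hs using hrun
  have hstep : ∀ n, Step Iin (.running (s n)) (.running (s (n + 1))) := fun n => by
    rw [← hs, ← hs]; exact hc n
  have hinv : ∀ n, Inv T Iin (s n) ∧ FinInv Iin (s n) := by
    intro n
    induction n with
    | zero =>
      have e : s 0 = initState T Iin := by
        have := (hs 0).symm.trans h0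
        exact Config.running.inj this
      rw [e]
      exact ⟨inv_initState hin, finInv_initState T Iin⟩
    | succ n ih => exact ⟨(hstep n).inv ih.1, (hstep n).finInv ih.1 ih.2⟩
  exact not_strictAnti_of_wellFoundedLT (fun n => (s n).measure Iin)
    (strictAnti_nat_of_succ_lt fun n => (hstep n).measure_lt (hinv n).1 (hinv n).2)

end Termination

/-! ### Infinite domains: an example -/

section Example

/-- A definition in which literals only occur positively is total. -/
theorem total_of_pos {D : Type u} {A : Type w} {Δ : Rules D A}
    (h : ∀ a φ, Δ a = some φ → ∀ l ∈ φ.lits, l.sign = true) : Total Δ := by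
  refine fun O hO => twoValued_wf hO.1 ?_
  conv_rhs => rw [← stableOp_stableOp_wfTrue]
  refine stableOp_congr fun a φ ha l hl => ⟨fun _ => Iff.rfl, fun _ hs => ?_⟩
  rw [h a φ ha l hl] at hs
  cases hs

/-- Predicate symbols: the propositional symbol `p`, and the unary symbols `q` and `r`. -/
inductive ExSymbol : Type
  | p : ExSymbol
  | q : ExSymbol
  | r : ExSymbol

/-- The arities. -/
def exArity : ExSymbol → ℕ
  | .p => 0
  | .q => 1
  | .r => 1

variable (D : Type u)

/-- The rule `p ← ∀ x ∈ D : q(x)`. -/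
def exRuleP : Rule D exArity where
  pred := .p
  dom := Set.univ
  body := .all Set.univ (.lit true .q fun _ => .var (Fin.last 0))

/-- The rule `∀ x ∈ D : q(x) ← r(x)`. -/
def exRuleQ : Rule D exArity where
  pred := .q
  dom := Set.univ
  body := .lit true .r fun i => .var i

/-- The definition with the rules `p ← ∀ x ∈ D : q(x)` and `∀ x ∈ D : q(x) ← r(x)`. -/
def exDefinition : Definition D exArity where
  rules := {exRuleP D, exRuleQ D}
  finite := Set.toFinite _
  disjoint := by
    rintro r (rfl | rfl) r' (rfl | rfl) t _ t' _ h
    · rfl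
    · cases congrArg DomAtom.pred h
    · cases congrArg DomAtom.pred h
    · rfl

variable {D}

def atomP : DomAtom D exArity := ⟨.p, fun i => i.elim0⟩

def atomQ (d : D) : DomAtom D exArity := ⟨.q, fun _ => d⟩

def atomR (d : D) : DomAtom D exArity := ⟨.r, fun _ => d⟩

theorem atomQ_injective : Function.Injective (atomQ : D → DomAtom D exArity) := by
  intro d d' h
  simp only [atomQ, DomAtom.mk.injEq, heq_eq_eq, true_and] at h
  exact congrFun h (0 : Fin 1)

variable {A : Type w} (e : DomAtom D exArity → A)

/-- The body of the rule for `p`. -/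
def bodyP : DFormula D A := .all Set.univ fun d => .lit ⟨e (atomQ d), true⟩

theorem exDefinition_p : (exDefinition D).inst e atomP = some (bodyP e) := by
  refine Definition.inst_eq_some.2 ⟨exRuleP D, Or.inl rfl, fun i => i.elim0, trivial, rfl, ?_⟩
  simp only [exRuleP, Formula.inst, bodyP, atomQ, Term.eval]
  congr

theorem exDefinition_q (d : D) :
    (exDefinition D).inst e (atomQ d) = some (.lit ⟨e (atomR d), true⟩) :=
  Definition.inst_eq_some.2 ⟨exRuleQ D, Or.inr rfl, fun _ => d, trivial, rfl, rfl⟩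

theorem exDefinition_r (d : D) : (exDefinition D).inst e (atomR d) = none := by
  rw [Option.eq_none_iff_forall_ne_some]
  intro φ h
  obtain ⟨r, rfl | rfl, t, -, h, -⟩ := Definition.inst_eq_some.1 h
  · cases congrArg DomAtom.pred h
  · cases congrArg DomAtom.pred h

theorem exDefinition_total : Total (exDefinition D).toRules := by
  refine total_of_pos fun a φ ha l hl => ?_
  obtain ⟨r, rfl | rfl, t, -, -, rfl⟩ := Definition.inst_eq_some.1 ha
  · obtain ⟨d, -, hl⟩ := hl
    rw [Set.mem_singleton_iff.1 hl]
  · rw [Set.mem_singleton_iff.1 hl]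

theorem exDefinition_isInput (a : DomAtom D exArity) : IsInput ⟨a, exDefinition D⟩ ∅ :=
  ⟨exDefinition_total, fun l hl => absurd hl (Set.notMem_empty l),
    fun l hl => absurd hl (Set.notMem_empty l)⟩

theorem embed_empty {V : Type v} {ar : V → ℕ} :
    embed (∅ : Struc (DomAtom D ar)) = ∅ := by
  ext l; simp [embed]

theorem exDefinition_infinite [Infinite D] :
    (definedAtoms (exDefinition D).toRules).Infinite := by
  refine (Set.infinite_range_of_injective atomQ_injective).mono ?_
  rintro a ⟨d, rfl⟩
  exact mem_definedAtoms.2 ⟨_, exDefinition_q id d⟩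

/-! A run that returns, for the sentence `q(d)`. -/

/-- The theory with the sentence `q(d)`. -/
def theoryQ (d : D) : Theory D exArity := ⟨atomQ d, exDefinition D⟩

def litQ (d : D) : Lit (Atom D exArity) := ⟨.dom (atomQ d), true⟩

def litR (d : D) : Lit (Atom D exArity) := ⟨.dom (atomR d), true⟩

/-- A state of the run for the sentence `q(d)`. -/
noncomputable def stateQ (d : D) (I : Struc (Atom D exArity)) (J : JGraph D exArity) : State D exArity :=
  { initState (theoryQ d) ∅ with I := I, J := J }

theorem stateQ_groundAtoms {d : D} {I : Struc (Atom D exArity)} {J : JGraph D exArity} :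
    groundAtoms (stateQ d I J) = {.dom (atomQ d)} := by
  ext a
  constructor
  · rintro (⟨C, rfl, l, rfl, rfl⟩ | ⟨h, φ, hφ, -⟩)
    · rfl
    · cases hφ
  · rintro rfl
    exact Or.inl ⟨_, rfl, litQ d, rfl, rfl⟩

theorem stateQ_isGroundModel {d : D} {I : Struc (Atom D exArity)} {J : JGraph D exArity} :
    IsGroundModel (stateQ d I J) {litQ d} := by
  refine ⟨?_, ?_, ?_, isWfModel_iff.2 ?_⟩
  · rintro l rfl h
    exact Lit.neg_ne _ h
  · rw [stateQ_groundAtoms]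
    rintro a rfl
    left
    simp [litQ]
  · rintro C rfl
    exact ⟨litQ d, rfl, rfl⟩
  · ext l
    exact (mem_wf_of_open (Δ := fun _ => none) rfl).symm

theorem stateQ_propagates {d : D} {I : Struc (Atom D exArity)} {J : JGraph D exArity}
    {L : List (Lit (Atom D exArity))} (hd : L.Nodup) (hL : ∀ l ∈ L, l ∉ I ∧ l = litQ d)
    (he : extend I L = {litQ d}) : Propagates (stateQ d I J) L := by
  refine ⟨hd, fun l hl => ?_, fun _ => ⟨?_, fun _ => ?_⟩⟩
  · obtain ⟨h1, rfl⟩ := hL l hl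
    refine ⟨h1, by rw [stateQ_groundAtoms]; rfl, fun M _ hM _ => ?_⟩
    exact hM.2.2.1 _ rfl
  · rintro C rfl l rfl -
    change litQ d ∈ extend I L
    rw [he]; rfl
  · change IsGroundModel _ (extend I L)
    rw [he]
    exact stateQ_isGroundModel

theorem stateQ_delayed {d : D} {I : Struc (Atom D exArity)} {J : JGraph D exArity} :
    (stateQ d I J).Dd (litQ d).atom = some (.lit (litR d)) := exDefinition_q _ d

theorem litQ_ne_litR (d : D) : litR d ≠ litQ d := by
  simp [litQ, litR, atomQ, atomR]

open Classical in
-- Two iterations suffice: unit propagation makes `q(d)` true and it is justified by the open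
-- literal `r(d)`; then the structure is already a ground model. The infinitely many other rule
-- instances are never touched.
theorem exists_returned (d : D) : ∃ s, Reaches (theoryQ d) ∅ (.returned s) := by
  set J : JGraph D exArity := Function.update (fun _ => none) (litQ d) (some {litR d}) with hJ
  have he1 : extend ∅ [litQ d] = {litQ d} := by
    ext l; simp [extend]
  have hc : Consistent ({litQ d} : Struc (Atom D exArity)) := by
    rintro l rfl h
    exact Lit.neg_ne _ h
  have h0 : initState (theoryQ d) ∅ = stateQ d ∅ fun _ => none := by
    simp [stateQ, initState, embed_empty]
  have hmem : ∀ m ∈ (activeGraph (stateQ d {litQ d} fun _ => none) (litQ d) {litR d}).nodes,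
      m = litQ d ∨ m = litR d := by
    intro m hm
    have key : ∀ n S, activeGraph (stateQ d {litQ d} fun _ => none) (litQ d) {litR d} n = some S →
        n = litQ d ∧ S = {litR d} := by
      intro n S h
      by_cases hn : n = litQ d
      · simp only [activeGraph, hn, if_true, Option.some.injEq] at h
        exact ⟨hn, h.symm⟩
      · simp only [activeGraph, hn, if_false] at h
        split_ifs at h
        cases h
    rcases JGraph.mem_nodes.1 hm with ⟨S, hS⟩ | ⟨n, S, hS, hmS⟩
    · exact Or.inl (key m S hS).1
    · rw [(key n S hS).2] at hmS
      exact Or.inr hmS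
  have h1 : Step ∅ (.running (stateQ d ∅ fun _ => none)) (.running (stateQ d {litQ d} J)) := by
    refine .justify _ _ [litQ d] [] (litQ d) (stateQ_propagates (by simp) (by simp) he1)
      (.cons _ _ _ [litQ d] _ ⟨[litQ d], [], rfl, Or.inl ⟨⟨?_, rfl⟩, rfl⟩, List.nodup_nil, ?_⟩
        (.nil _)) ?_ ?_
    · rw [stateQ_delayed]; simp
    · intro m
      refine ⟨fun h => by simp at h, ?_⟩
      rintro ⟨S, hS, -⟩
      cases hS
    · change Consistent (extend ∅ [litQ d])
      rwa [he1]
    · change LazyGround { stateQ d ∅ (fun _ => none) with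
        I := extend ∅ [litQ d], queue := [] } (litQ d) _
      rw [he1]
      refine LazyGround.build (s := stateQ d {litQ d} fun _ => none) (.lit (litR d)) {litR d}
        ?_ ⟨rfl, ?_⟩ stateQ_delayed (.lit _) ⟨?_, ?_, ?_, ?_, ?_⟩
      · rintro ⟨S, hS, -⟩
        cases hS
      · rw [stateQ_delayed]; simp
      · exact fun m _ => rfl
      · rintro m rfl hm
        exact absurd (exDefinition_r _ d) hm
      · intro p hp
        have hp1 : p 1 = litR d := by
          obtain ⟨S, hS, h1⟩ := hp 0
          by_cases h0 : p 0 = litQ d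
          · simp only [activeGraph, h0, if_true, Option.some.injEq] at hS
            rw [← hS] at h1; exact h1
          · simp only [activeGraph, h0, if_false] at hS
            split_ifs at hS
            cases hS
        obtain ⟨S, hS, -⟩ := hp 1
        simp only [activeGraph, hp1, litQ_ne_litR, if_false] at hS
        split_ifs at hS
        cases hS
      · intro m hm hn
        have h3 : m.sign = true := by rcases hmem m hm with rfl | rfl <;> rfl
        have h4 : m.neg.sign = true := by rcases hmem _ hn with h | h <;> rw [h] <;> rfl
        simp [h3] at h4
      · intro m hm hn
        have h3 : m.sign = true := by rcases hmem m hm with rfl | rfl <;> rfl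
        have h4 : m.neg.sign = true := by rw [Set.mem_singleton_iff.1 hn]; rfl
        simp [h3] at h4
  have h2 : Step ∅ (.running (stateQ d {litQ d} J))
      (.returned { stateQ d {litQ d} J with I := extend {litQ d} [], queue := [] }) := by
    refine .success _ [] (stateQ_propagates List.nodup_nil (by simp) (extend_nil _)) (.nil _) ?_ ?_
    · change Consistent (extend {litQ d} [])
      rwa [extend_nil]
    · change IsGroundModel _ (extend {litQ d} [])
      rw [extend_nil]
      exact stateQ_isGroundModel
  refine ⟨{ stateQ d {litQ d} J with I := extend {litQ d} [], queue := [] }, ?_⟩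
  rw [Reaches, h0]
  exact (Relation.ReflTransGen.single h1).tail h2

/-! No run returns, for the sentence `p`. -/

variable (D) in
/-- The theory with the sentence `p`. -/
def theoryP : Theory D exArity := ⟨atomP, exDefinition D⟩

/-- Making `r` true everywhere derives every `q(d)` and then `p`. By soundness this rules out the
answer false. -/
theorem theoryP_exists_model : ∃ M, (theoryP D).IsModel M ∧ ∅ ⊆ M := by
  set O : Struc (DomAtom D exArity) := {l | l.sign = true} with hO
  set R := (exDefinition D).toRules with hR
  have hM : TwoValued (wf R O) := by
    rw [← wf_restrict]
    refine exDefinition_total _ ⟨fun a ha => Or.inl ?_, fun l hl => hl.2⟩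
    exact ⟨⟨rfl, ha⟩, fun h => by cases h.1⟩
  refine ⟨wf R O, ⟨hM, ?_, isWfModel_wf⟩, Set.empty_subset _⟩
  have hp : R atomP = some (bodyP id) := exDefinition_p id
  refine (pos_mem_wf (mem_definedAtoms.2 ⟨_, hp⟩)).2 ?_
  rw [← stableOp_stableOp_wfTrue]
  refine stableOp_closed hp fun d _ => ?_
  have hq : R (atomQ d) = some (.lit ⟨atomR d, true⟩) := exDefinition_q id d
  refine (mem_mixed_of_defined (mem_definedAtoms.2 ⟨_, hq⟩)).2 (stableOp_closed hq ?_)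
  exact (mem_mixed_of_open (l := ⟨atomR d, true⟩) (exDefinition_r id d)).2 rfl

/-- Either the rule for `p` is still delayed, or it was grounded for all domain elements. -/
def PRule (s : State D exArity) : Prop :=
  s.Dd (.dom atomP) = some (bodyP .dom) ∨
    s.Dg (.dom atomP) = some (.all Set.univ fun d => tseLit (.dom atomP) (.elem d))

theorem Step.pRule {s s' : State D exArity} (hstep : Step ∅ (.running s) (.running s'))
    (h : Inv (theoryP D) ∅ s) (hs : PRule s) : PRule s' := by
  classical
  cases hstep with
  | backjump => exact hs
  | choose => exact hs
  | justify _ _ L q l hp hc hcons hl =>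
    rcases hl.split_or_same with ⟨φ, g, new, J', q', hφ, hstep, rfl⟩ | ⟨hDg, hDd⟩
    · by_cases hlp : l.atom = .dom atomP
      · have hDg : s.Dg l.atom = none := by
          by_contra h'
          rw [h.rules.disjoint _ h'] at hφ; cases hφ
        rcases hs with hs | hs
        · right
          have hφ' : φ = bodyP .dom := by
            rw [← hlp] at hs
            exact Option.some.inj (hφ.symm.trans hs)
          subst hφ'
          have hgoal : (⟨l.atom, true⟩ : Lit (Atom D exArity)) ∈ extend s.I L := by
            rw [hlp]
            refine (hp.2.2 hcons).1 _ h.search.goal_mem _ rfl fun m hm hne => absurd hm hne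
          rw [← hlp]
          unfold bodyP at hstep
          cases hstep with
          | all => exact State.split_Dg_self
          -- Splitting off a single instance requires a false head, but the sentence `p` is unit
          -- propagated and the structure is consistent here.
          | allFalse _ _ d g o hf => exact absurd hf (hcons _ hgoal)
        · rw [hlp, hs] at hDg
          cases hDg
      · rcases hs with hs | hs
        · left
          rw [State.split_Dd_other (Ne.symm hlp) (by simp)]
          exact hs
        · right
          rw [State.split_Dg_of_ne (Ne.symm hlp)]
          exact hs
    · unfold PRule
      rw [hDg, hDd]
      exact hs

theorem Reaches.pRule {s : State D exArity} (h : Reaches (theoryP D) ∅ (.running s)) :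
    PRule s := by
  suffices ∀ c, Reaches (theoryP D) ∅ c → ∀ s, c = .running s → PRule s from this _ h s rfl
  intro c hc
  induction hc with
  | refl => rintro s h; cases h; exact Or.inl (exDefinition_p _)
  | @tail b c hb hstep ih =>
    rintro s rfl
    cases b with
    | running s' => exact hstep.pRule (Reaches.inv (exDefinition_isInput _) hb) (ih s' rfl)
    | returned s' => cases hstep
    | failed => cases hstep

/-- Every state has finitely many direct justifications and, the input being empty, finitely many
true literals. A returned state needs infinitely many of one kind: justifications of all `q(d)` if
the rule for `p` is delayed, values of all its Tseitin symbols if it is ground. -/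
theorem theoryP_not_returned [Infinite D] (s : State D exArity) :
    ¬ Reaches (theoryP D) ∅ (.returned s) := by
  intro h
  obtain ⟨hinv, hq, hg⟩ := h.inv_returned (exDefinition_isInput _)
  have hP : PRule s := by
    rcases Relation.ReflTransGen.cases_tail h with h | ⟨c, hc, hstep⟩
    · cases h
    · cases hstep with
      | success s L =>
        have hs := Reaches.pRule hc
        exact hs
  rcases hP with hP | hP
  · have hj := hinv.just
    rw [hq] at hj
    have hng := hj.not_ground
    have hcv := hj.covered
    rw [offQueue_nil] at hng hcv
    obtain ⟨l, hl, hlI⟩ := hg.2.2.1 _ hinv.search.goal_mem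
    obtain rfl := Set.mem_singleton_iff.1 hl
    have hPd : s.Dd (Atom.dom (theoryP D).goal) ≠ none := by
      change s.Dd (Atom.dom atomP) ≠ none
      rw [hP]; simp
    obtain ⟨S, hS⟩ := Option.ne_none_iff_exists'.1
      ((hj.needs _ hlI hPd).resolve_right (by simp))
    obtain ⟨φ, hφ, hcol⟩ := hj.collects _ S hS
    obtain rfl : bodyP .dom = φ := Option.some.inj (hP.symm.trans hφ)
    -- Collecting from a universal quantification leaves no choice: every instance contributes its
    -- literal.
    have hQS : ∀ d, litQ d ∈ S := by
      simp only [goalFormula, if_true, bodyP] at hcol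
      cases hcol with
      | all _ _ S' hS' =>
        intro d
        refine Set.mem_biUnion (Set.mem_univ d) ?_
        have := hS' d trivial
        generalize S' d = S'' at this
        cases this
        rfl
    refine (Set.infinite_range_of_injective (f := (litQ : D → _)) ?_).mono ?_ hj.finite
    · intro d d' h
      simp only [litQ, Lit.mk.injEq, Atom.dom.injEq, and_true] at h
      exact atomQ_injective h
    · rintro _ ⟨d, rfl⟩
      refine (hcv _ S hS _ (hQS d) fun hd => ?_).resolve_right (by simp)
      have h2 : Atom.dom (atomQ d) ∈ openAtoms s.Dgd :=
        State.Dgd_eq_none.2 ⟨hng _ S hS _ (hQS d), hd⟩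
      rw [hinv.rules.refines.open_iff] at h2
      have h3 : (exDefinition D).inst id (atomQ d) = none := h2
      rw [exDefinition_q] at h3
      cases h3
  · have hfin := hinv.search.finite
    rw [embed_empty, Set.sdiff_empty] at hfin
    refine (Set.infinite_range_of_injective
      (f := fun d : D => Atom.tse (.dom atomP : Atom D exArity) (.elem d)) ?_).mono ?_
      (hfin.image Lit.atom)
    · intro d d' h
      exact Pos.elem.inj (Atom.tse.inj h).2
    · rintro _ ⟨d, rfl⟩
      have hga : Atom.tse (.dom atomP : Atom D exArity) (.elem d) ∈ groundAtoms s :=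
        Or.inr ⟨_, _, hP, Or.inr ⟨d, trivial, rfl⟩⟩
      rcases (hg.2.1 _ hga).or with h | h
      · exact ⟨_, h, rfl⟩
      · exact ⟨_, h, rfl⟩

theorem theoryP_not_failed : ¬ Reaches (theoryP D) ∅ .failed := fun h =>
  h.failed_correct (exDefinition_isInput _) theoryP_exists_model

/-- A further iteration is always possible and none ends in a return, so iterating any choice of
successor gives an infinite run. -/
theorem theoryP_hasInfiniteRun [Infinite D] : HasInfiniteRun (theoryP D) ∅ := by
  have hnext : ∀ s : {s : State D exArity // Reaches (theoryP D) ∅ (.running s)},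
      ∃ s' : {s : State D exArity // Reaches (theoryP D) ∅ (.running s)},
        Step ∅ (.running s.1) (.running s'.1) := by
    rintro ⟨s, hs⟩
    obtain ⟨c, hc⟩ := (Reaches.inv (exDefinition_isInput _) hs).exists_step
    have hr : Reaches (theoryP D) ∅ c := Relation.ReflTransGen.tail hs hc
    cases c with
    | running s' => exact ⟨⟨s', hr⟩, hc⟩
    | returned s' => exact absurd hr (theoryP_not_returned s')
    | failed => exact absurd hr theoryP_not_failed
  choose f hf using hnext
  refine ⟨fun n => .running (f^[n] ⟨initState (theoryP D) ∅, .refl⟩).1, rfl, fun n => ?_⟩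
  simp only [Function.iterate_succ_apply']
  exact hf _

end Example

end LazyMX

/-! ### The main theorem -/

theorem mainTheorem3 (D : Type u) :
    (∀ (V : Type v) (ar : V → ℕ) (T : Theory D ar) (Iin : Struc (DomAtom D ar)), IsInput T Iin →
      -- correctness of a returned structure
      (∀ s : State D ar, Reaches T Iin (.returned s) →
        Consistent s.expanded ∧
        ∀ O : Struc (Atom D ar), TwoValuedStrucOf O (openAtoms s.Dgd) →
          restrict s.expanded (openAtoms s.Dgd) ⊆ O →
          TwoValued (wf s.Dgd O) ∧ s.expanded ⊆ wf s.Dgd O ∧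
          T.IsModel (restrictVoc (wf s.Dgd O)) ∧ Iin ⊆ restrictVoc (wf s.Dgd O)) ∧
      -- correctness of the answer false
      (Reaches T Iin .failed → ¬ ∃ M : Struc (DomAtom D ar), T.IsModel M ∧ Iin ⊆ M) ∧
      -- the algorithm can only stop by returning, and on a finite domain it does stop
      (∀ s : State D ar, Reaches T Iin (.running s) → ∃ c, Step Iin (.running s) c) ∧
      (Finite D → ¬ HasInfiniteRun T Iin)) ∧
    -- on an infinite domain, termination is possible but not guaranteed
    (Infinite D →
      (∃ (V : Type) (ar : V → ℕ) (T : Theory D ar) (Iin : Struc (DomAtom D ar)),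
        IsInput T Iin ∧ (definedAtoms T.defn.toRules).Infinite ∧
        ∃ s : State D ar, Reaches T Iin (.returned s)) ∧
      (∃ (V : Type) (ar : V → ℕ) (T : Theory D ar) (Iin : Struc (DomAtom D ar)),
        IsInput T Iin ∧ HasInfiniteRun T Iin ∧
        ¬ Reaches T Iin .failed ∧ ∀ s : State D ar, ¬ Reaches T Iin (.returned s))) := by
  refine ⟨fun V ar T Iin hin => ⟨fun s hs => hs.returned_correct hin,
    fun hf => hf.failed_correct hin, fun s hs => (Reaches.inv hin hs).exists_step,
    fun _ => not_hasInfiniteRun hin⟩, fun _ => ⟨?_, ?_⟩⟩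
  · obtain ⟨d⟩ := (inferInstance : Nonempty D)
    exact ⟨ExSymbol, exArity, theoryQ d, ∅, exDefinition_isInput _, exDefinition_infinite,
      exists_returned d⟩
  · exact ⟨ExSymbol, exArity, theoryP D, ∅, exDefinition_isInput _, theoryP_hasInfiniteRun,
      theoryP_not_failed, theoryP_not_returned⟩
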